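/- Let $a,b\in C^0([0,1])$ with $a(0)=0$, $a>0$ on $(0,1]$, $\frac ba\in L^1(0,1)$, and suppose that for some $\alpha>0$ the function $x\mapsto x^\alpha/a(x)$ is non-decreasing in a right neighbourhood of $0$. Let $c>0$, $m\in[0,1]$, and let $\mu:(0,\infty)\to[0,\infty)$ satisfy $\mu\in L^1(0,\infty)\cap C^1(0,\infty)$, $\int_0^\infty\mu(s)\,ds>0$, $\lim_{s\to0^+}\mu(s)<\infty$ and $\mu'(s)\le -K_\mu\,\mu(s)$ for all $s>0$, with some $K_\mu>0$. Put $$\eta(x)=\exp\Big(\int_{1/2}^x\frac{b(s)}{a(s)}\,ds\Big),\qquad \sigma=\frac a\eta \qquad\text{on }[0,1].$$ All spaces are complex. Let $L^2_{1/\sigma}(0,1)$ be the $L^2$-space of the measure $\frac1\sigma dx$ on $(0,1)$, let $H^1_{1/\sigma,L}(0,1)=\{u\in H^1(0,1): u(0)=0,\ u\in L^2_{1/\sigma}(0,1)\}$ and $H^2_{1/\sigma,L}(0,1)=\{u\in H^1_{1/\sigma,L}(0,1):\sigma(\eta u_x)_x\in L^2_{1/\sigma}(0,1)\}$, let $H^1_R(1,2)=\{y\in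 H^1(1,2):y(2)=0\}$ with norm $\|y_x\|_{L^2(1,2)}$, and let $W$ be the space of $H^1_R(1,2)$-valued functions on $(0,\infty)$ that are square integrable for the measure $c\,m\,\mu(s)\,ds$, functions that agree almost everywhere for this measure being identified (so $W=\{0\}$ if $m=0$). The energy space is $$\mathcal H=H^1_{1/\sigma,L}(0,1)\times L^2_{1/\sigma}(0,1)\times L^2(1,2)\times W,$$ $$\langle U_1,U_2\rangle_{\mathcal H}=\int_0^1\eta u_{1x}\overline{u_{2x}}\,dx+\int_0^1\frac1\sigma v_1\overline{v_2}\,dx+\int_1^2y_1\overline{y_2}\,dx+cm\int_1^2\int_0^\infty\mu(s)\gamma_{1x}\overline{\gamma_{2x}}\,ds\,dx,$$ where $U_i=(u_i,v_i,y_i,\gamma_i)$. For $y\in H^1_R(1,2)$ and $\gamma\in W$ put $\zeta=c(1-m)y+cm\int_0^\infty\mu(s)\gamma(s)\,ds$. Define the operator $$\mathcal A(u,v,y,\gamma)=\big(v,\ \sigma(\eta u_x)_x,\ \zeta_{xx},\ -\gamma_s+y\big)$$ on the domain $D(\mathcal A)$ of all $(u,v,y,\gamma)\in\mathcal H$ with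 $u\in H^2_{1/\sigma,L}(0,1)$, $v\in H^1_{1/\sigma,L}(0,1)$, $y\in H^1_R(1,2)$, $\zeta\in H^2(1,2)$, $\gamma_s\in W$, $\gamma(\cdot,0)=0$, $\eta(1)u_x(1)=\zeta_x(1)$ and $v(1)=y(1)$ (for $m=0$ the conditions on $\gamma$ are void). Then $\mathcal A$ is m-dissipative in $\mathcal H$: $\operatorname{Re}\langle\mathcal AU,U\rangle_{\mathcal H}\le0$ for all $U\in D(\mathcal A)$, and $\lambda I-\mathcal A$ maps $D(\mathcal A)$ onto $\mathcal H$ for every $\lambda>0$. Hence $D(\mathcal A)$ is dense in $\mathcal H$ and $\mathcal A$ is the infinitesimal generator of a $C_0$-semigroup $(T(t))_{t\ge0}$ of contractions on $\mathcal H$; in particular, for every $U_0\in D(\mathcal A)$ the problem $U_t=\mathcal AU$, $U(0)=U_0$, has exactly one solution $U\in C^1([0,\infty),\mathcal H)$ with values in $D(\mathcal A)$, namely $U(t)=T(t)U_0$. -/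

import Mathlib

open MeasureTheory Set Filter Topology
open scoped ENNReal

noncomputable section

namespace DegenerateWaveHeat

/-! ### Local absolute continuity -/

/-- `F` is locally absolutely continuous on the interval `I`, with (weak) derivative `f`. -/
def IsPrimitiveOn {E : Type*} [NormedAddCommGroup E] [NormedSpace ℝ E]
    (I : Set ℝ) (F f : ℝ → E) : Prop :=
  ∀ x ∈ I, ∀ y ∈ I, IntervalIntegrable f volume x y ∧ F y - F x = ∫ t in x..y, f t

section IsPrimitiveOn

variable {E : Type*} [NormedAddCommGroup E] [NormedSpace ℝ E] {I : Set ℝ} {F G f g : ℝ → E}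

theorem IsPrimitiveOn.zero : IsPrimitiveOn I (0 : ℝ → E) 0 := by
  intro x _ y _
  exact ⟨intervalIntegrable_const (c := (0 : E)), by simp⟩

theorem IsPrimitiveOn.add (h : IsPrimitiveOn I F f) (k : IsPrimitiveOn I G g) :
    IsPrimitiveOn I (F + G) (f + g) := by
  intro x hx y hy
  obtain ⟨h1, h2⟩ := h x hx y hy
  obtain ⟨k1, k2⟩ := k x hx y hy
  refine ⟨h1.add k1, ?_⟩
  simp only [Pi.add_apply]
  rw [intervalIntegral.integral_add h1 k1, ← h2, ← k2]
  abel

theorem IsPrimitiveOn.smul [NormedSpace ℂ E] (r : ℂ)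
    (h : IsPrimitiveOn I F f) : IsPrimitiveOn I (r • F) (r • f) := by
  intro x hx y hy
  obtain ⟨h1, h2⟩ := h x hx y hy
  refine ⟨h1.smul r, ?_⟩
  simp only [Pi.smul_apply]
  rw [intervalIntegral.integral_smul, ← h2, smul_sub]

theorem IsPrimitiveOn.congr [I.OrdConnected] (h : IsPrimitiveOn I F f) (hF : EqOn F G I)
    (hf : ∀ᵐ x, x ∈ I → f x = g x) : IsPrimitiveOn I G g := by
  intro x hx y hy
  obtain ⟨h1, h2⟩ := h x hx y hy
  have hsub : uIoc x y ⊆ I := uIoc_subset_uIcc.trans (OrdConnected.uIcc_subset ‹_› hx hy)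
  have hae : ∀ᵐ t, t ∈ uIoc x y → f t = g t := by
    filter_upwards [hf] with t ht h't using ht (hsub h't)
  refine ⟨h1.congr_ae ?_, ?_⟩
  · exact (ae_restrict_iff' measurableSet_uIoc).2 hae
  · rw [← hF hx, ← hF hy, h2]
    exact intervalIntegral.integral_congr_ae hae

theorem IsPrimitiveOn.ae_eq_zero [CompleteSpace E] [I.OrdConnected]
    (h : IsPrimitiveOn I F f) (hF : ∀ᵐ x, x ∈ I → F x = 0) :
    ∀ᵐ x, x ∈ I → f x = 0 := by
  refine ae_of_mem_of_ae_of_mem_inter_Ioo (fun p q hp hq hpq => ?_)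
  have hsub : Icc p q ⊆ I := OrdConnected.out ‹_› hp hq
  have hint := (h p hp q hq).1
  have hcont : ContinuousOn (fun x => ∫ t in p..x, f t) (Icc p q) := by
    have := intervalIntegral.continuousOn_primitive_interval' hint left_mem_uIcc
    rwa [uIcc_of_le hpq.le] at this
  have hconst : EqOn (fun x => ∫ t in p..x, f t) (fun _ => - F p) (Ioo p q) := by
    refine Measure.eqOn_Ioo_of_ae_eq (μ := volume) ?_ (hcont.mono Ioo_subset_Icc_self)
      continuousOn_const
    refine (ae_restrict_iff' measurableSet_Ioo).2 ?_
    filter_upwards [hF] with x hx hxI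
    have hxI' := hsub (Ioo_subset_Icc_self hxI)
    rw [← (h p hp x hxI').2, hx hxI']
    simp
  filter_upwards [hint.ae_hasDerivAt_integral] with x hx hxI
  have h1 := hx (by rw [uIcc_of_le hpq.le]; exact Ioo_subset_Icc_self hxI.2) p left_mem_uIcc
  have h2 : HasDerivAt (fun x => ∫ t in p..x, f t) 0 x := by
    refine (hasDerivAt_const x (- F p)).congr_of_eventuallyEq ?_
    filter_upwards [isOpen_Ioo.mem_nhds hxI.2] with z hz using hconst hz
  exact h1.unique h2

end IsPrimitiveOn

/-! ### Sobolev spaces of order one on a bounded interval -/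

/-- The complex space `L²(p, q)`. -/
abbrev L2 (p q : ℝ) : Type := Lp ℂ 2 (volume.restrict (Ioo p q))

/-- A continuous function on `[p, q]`, extended by zero to the real line. -/
def zeroExt {p q : ℝ} (u : C(Icc p q, ℂ)) : ℝ → ℂ := Function.extend Subtype.val u 0

theorem zeroExt_apply {p q : ℝ} (u : C(Icc p q, ℂ)) {x : ℝ} (hx : x ∈ Icc p q) :
    zeroExt u x = u ⟨x, hx⟩ :=
  Subtype.val_injective.extend_apply u 0 (⟨x, hx⟩ : Icc p q)

theorem zeroExt_of_notMem {p q : ℝ} (u : C(Icc p q, ℂ)) {x : ℝ} (hx : x ∉ Icc p q) :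
    zeroExt u x = 0 :=
  Function.extend_apply' (f := Subtype.val) u (0 : ℝ → ℂ) x (by rintro ⟨z, rfl⟩; exact hx z.2)

theorem zeroExt_zero {p q : ℝ} : zeroExt (0 : C(Icc p q, ℂ)) = 0 := by
  funext x
  by_cases hx : x ∈ Icc p q
  · simp [zeroExt_apply _ hx]
  · simp [zeroExt_of_notMem _ hx]

theorem zeroExt_add {p q : ℝ} (u v : C(Icc p q, ℂ)) :
    zeroExt (u + v) = zeroExt u + zeroExt v := by
  funext x
  by_cases hx : x ∈ Icc p q
  · simp [zeroExt_apply _ hx]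
  · simp [zeroExt_of_notMem _ hx]

theorem zeroExt_smul {p q : ℝ} (r : ℂ) (u : C(Icc p q, ℂ)) :
    zeroExt (r • u) = r • zeroExt u := by
  funext x
  by_cases hx : x ∈ Icc p q
  · simp [zeroExt_apply _ hx]
  · simp [zeroExt_of_notMem _ hx]

theorem ae_mem_Icc_of_ae_restrict {p q : ℝ} {P : ℝ → Prop}
    (h : ∀ᵐ x ∂(volume.restrict (Ioo p q)), P x) : ∀ᵐ x, x ∈ Icc p q → P x := by
  rw [restrict_Ioo_eq_restrict_Icc] at h
  exact (ae_restrict_iff' measurableSet_Icc).1 h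

/-- `H¹(p, q)`: an element is a continuous function on `[p, q]` together with its (unique)
derivative in `L²(p, q)`. -/
def H1 (p q : ℝ) : Submodule ℂ (C(Icc p q, ℂ) × L2 p q) where
  carrier := {w | IsPrimitiveOn (Icc p q) (zeroExt w.1) w.2}
  zero_mem' := by
    refine IsPrimitiveOn.zero.congr (fun x _ => by simp [zeroExt_zero]) ?_
    apply ae_mem_Icc_of_ae_restrict
    filter_upwards [Lp.coeFn_zero ℂ 2 (volume.restrict (Ioo p q))] with x hx
    exact hx.symm
  add_mem' := by
    intro w z hw hz
    refine (IsPrimitiveOn.add hw hz).congr (fun x _ => by simp [zeroExt_add]) ?_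
    apply ae_mem_Icc_of_ae_restrict
    filter_upwards [Lp.coeFn_add w.2 z.2] with x hx
    exact hx.symm
  smul_mem' := by
    intro r w hw
    refine (IsPrimitiveOn.smul r hw).congr (fun x _ => by simp [zeroExt_smul]) ?_
    apply ae_mem_Icc_of_ae_restrict
    filter_upwards [Lp.coeFn_smul r w.2] with x hx
    exact hx.symm

/-! ### The space `H¹_R(1, 2)` -/

/-- The elements of `H¹(1, 2)` that vanish at `2`. -/
def h1R : Submodule ℂ (C(Icc (1 : ℝ) 2, ℂ) × L2 1 2) where
  carrier := {w | w ∈ H1 1 2 ∧ zeroExt w.1 2 = 0}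
  zero_mem' := ⟨(H1 1 2).zero_mem, by simp [zeroExt_zero]⟩
  add_mem' := by
    intro w z hw hz
    exact ⟨(H1 1 2).add_mem hw.1 hz.1, by simp [zeroExt_add, hw.2, hz.2]⟩
  smul_mem' := by
    intro r w hw
    exact ⟨(H1 1 2).smul_mem r hw.1, by simp [zeroExt_smul, hw.2]⟩

/-- `H¹_R(1, 2)`, normed below by `‖y‖² = ∫₁² |y_x|² dx`. -/
def H1R : Type := ↥h1R

instance : AddCommGroup H1R := inferInstanceAs (AddCommGroup ↥h1R)

instance : Module ℂ H1R := inferInstanceAs (Module ℂ ↥h1R)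

/-- The function underlying an element of `H¹_R(1, 2)`. -/
def H1R.fn (y : H1R) : ℝ → ℂ := zeroExt (Subtype.val (p := (· ∈ h1R)) y).1

/-- The derivative `y_x` of an element of `H¹_R(1, 2)`. -/
def H1R.dx : H1R →ₗ[ℂ] L2 1 2 := (LinearMap.snd ℂ C(Icc (1 : ℝ) 2, ℂ) (L2 1 2)).comp h1R.subtype

theorem H1R.fn_add (y z : H1R) : (y + z).fn = y.fn + z.fn := zeroExt_add _ _

theorem H1R.fn_smul (r : ℂ) (y : H1R) : (r • y).fn = r • y.fn := zeroExt_smul _ _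

theorem H1R.isPrimitiveOn (y : H1R) : IsPrimitiveOn (Icc 1 2) y.fn y.dx := y.2.1

theorem H1R.fn_two (y : H1R) : y.fn 2 = 0 := y.2.2

theorem H1R.ext_fn {y z : H1R} (h : EqOn y.fn z.fn (Icc 1 2)) (h' : y.dx = z.dx) : y = z := by
  refine Subtype.ext (Prod.ext (ContinuousMap.ext fun x => ?_) h')
  have := h x.2
  simpa [H1R.fn, zeroExt_apply _ x.2] using this

theorem H1R.dx_injective : Function.Injective H1R.dx := by
  intro y z h
  refine H1R.ext_fn (fun x hx => ?_) h
  have h1 := (y.isPrimitiveOn x hx 2 (by norm_num)).2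
  have h2 := (z.isPrimitiveOn x hx 2 (by norm_num)).2
  rw [H1R.fn_two, h, ← h2, H1R.fn_two] at h1
  simpa using h1

/-- The inner product of `H¹_R(1, 2)`. -/
@[reducible]
def H1R.core : InnerProductSpace.Core ℂ H1R where
  inner y z := inner ℂ y.dx z.dx
  conj_inner_symm y z := inner_conj_symm _ _
  re_inner_nonneg y := inner_self_nonneg
  add_left x y z := by simp [inner_add_left]
  smul_left x y r := by simp [inner_smul_left]
  definite x hx := by
    apply H1R.dx_injective
    simpa using hx

instance : NormedAddCommGroup H1R := H1R.core.toNormedAddCommGroup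

instance : InnerProductSpace ℂ H1R := InnerProductSpace.ofCore H1R.core.toCore

theorem H1R.dx_surjective : Function.Surjective H1R.dx := by
  intro g
  have hg : Integrable g (volume.restrict (Ioo (1 : ℝ) 2)) :=
    (Lp.memLp g).integrable (by norm_num)
  have hI : IntervalIntegrable g volume 1 2 := by
    rw [intervalIntegrable_iff_integrableOn_Ioo_of_le (by norm_num)]
    exact hg
  have hsub : ∀ x ∈ Icc (1 : ℝ) 2, ∀ y ∈ Icc (1 : ℝ) 2, IntervalIntegrable g volume x y := by
    intro x hx y hy
    refine hI.mono_set ?_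
    rw [uIcc_of_le (by norm_num : (1 : ℝ) ≤ 2)]
    exact OrdConnected.uIcc_subset inferInstance hx hy
  have hc : ContinuousOn (fun x => ∫ t in (2 : ℝ)..x, g t) (Icc 1 2) := by
    have := intervalIntegral.continuousOn_primitive_interval' hI right_mem_uIcc
    rwa [uIcc_of_le (by norm_num : (1 : ℝ) ≤ 2)] at this
  let u : C(Icc (1 : ℝ) 2, ℂ) := ⟨fun x => ∫ t in (2 : ℝ)..x, g t, hc.domRestrict⟩
  have hu : ∀ x ∈ Icc (1 : ℝ) 2, zeroExt u x = ∫ t in (2 : ℝ)..x, g t := fun x hx =>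
    zeroExt_apply u hx
  have h2 : (2 : ℝ) ∈ Icc (1 : ℝ) 2 := by norm_num
  refine ⟨⟨(u, g), ?_, ?_⟩, rfl⟩
  · intro x hx y hy
    refine ⟨hsub x hx y hy, ?_⟩
    simp only [hu x hx, hu y hy]
    exact intervalIntegral.integral_interval_sub_left (hsub 2 h2 y hy) (hsub 2 h2 x hx)
  · simp [hu 2 h2]

/-- `y ↦ y_x` identifies `H¹_R(1, 2)` isometrically with `L²(1, 2)`. -/
def H1R.dxIso : H1R ≃ₗᵢ[ℂ] L2 1 2 where
  toLinearEquiv := LinearEquiv.ofBijective H1R.dx ⟨H1R.dx_injective, H1R.dx_surjective⟩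
  norm_map' y := by
    rw [norm_eq_sqrt_re_inner (𝕜 := ℂ) y, norm_eq_sqrt_re_inner (𝕜 := ℂ)]
    rfl

instance : CompleteSpace H1R :=
  (completeSpace_congr (e := H1R.dxIso.toEquiv) H1R.dxIso.isometry.isUniformEmbedding).2
    inferInstance

/-! ### The data of the transmission system -/

/-- The coefficients `a`, `b` of the degenerate wave equation on `(0, 1)`, the heat conductivity
`c`, the memory kernel `μ` and the parameter `m`, with all the assumptions made on them. -/
structure TransmissionData where
  /-- the leading coefficient -/
  a : ℝ → ℝ
  /-- the drift coefficient -/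
  b : ℝ → ℝ
  /-- the memory kernel; `μ 0` stands for its limit at `0` -/
  μ : ℝ → ℝ
  /-- the heat conductivity -/
  c : ℝ
  /-- `0` for the law of Fourier, in `(0, 1)` for Coleman-Gurtin, `1` for Gurtin-Pipkin -/
  m : ℝ
  a_cont : ContinuousOn a (Icc 0 1)
  b_cont : ContinuousOn b (Icc 0 1)
  b_div_a_integrable : IntegrableOn (fun x => b x / a x) (Ioo 0 1)
  a_zero : a 0 = 0
  a_pos : ∀ x ∈ Ioc (0 : ℝ) 1, 0 < a x
  a_mono : ∃ α > (0 : ℝ), ∃ δ ∈ Ioc (0 : ℝ) 1, MonotoneOn (fun x => x ^ α / a x) (Ioo 0 δ)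
  c_pos : 0 < c
  m_mem : m ∈ Icc (0 : ℝ) 1
  μ_nonneg : ∀ s > 0, 0 ≤ μ s
  μ_integrable : IntegrableOn μ (Ioi 0)
  μ_contDiff : ContDiffOn ℝ 1 μ (Ioi 0)
  μ_integral_pos : 0 < ∫ s in Ioi 0, μ s
  μ_tendsto : Tendsto μ (𝓝[>] 0) (𝓝 (μ 0))
  μ_dafermos : ∃ K > 0, ∀ s > 0, deriv μ s ≤ -K * μ s

namespace TransmissionData

variable (S : TransmissionData)

/-- The weight `η`. -/
def η (x : ℝ) : ℝ := Real.exp (∫ s in (1 / 2 : ℝ)..x, S.b s / S.a s)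

/-- The weight `σ = a / η`. -/
def σ (x : ℝ) : ℝ := S.a x / S.η x

theorem b_div_a_intervalIntegrable : IntervalIntegrable (fun x => S.b x / S.a x) volume 0 1 := by
  rw [intervalIntegrable_iff_integrableOn_Ioo_of_le zero_le_one]
  exact S.b_div_a_integrable

theorem η_pos (x : ℝ) : 0 < S.η x := Real.exp_pos _

theorem η_cont : ContinuousOn S.η (Icc 0 1) := by
  have h := intervalIntegral.continuousOn_primitive_interval' (a := 1 / 2)
    S.b_div_a_intervalIntegrable (by rw [uIcc_of_le zero_le_one]; norm_num)
  rw [uIcc_of_le zero_le_one] at h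
  exact h.rexp

theorem σ_pos {x : ℝ} (hx : x ∈ Ioc (0 : ℝ) 1) : 0 < S.σ x := div_pos (S.a_pos x hx) (S.η_pos x)

theorem σ_cont : ContinuousOn S.σ (Icc 0 1) :=
  S.a_cont.div S.η_cont fun x _ => (S.η_pos x).ne'

/-! ### The weighted spaces on `(0, 1)` -/

/-- The measure `(1/σ) dx` on `(0, 1)`. -/
def invσMeasure : Measure ℝ :=
  (volume.restrict (Ioo 0 1)).withDensity fun x => ENNReal.ofReal (1 / S.σ x)

/-- The space `L²_{1/σ}(0, 1)`. -/
abbrev L2σ : Type := Lp ℂ 2 S.invσMeasure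

/-- The elements `u` of `H¹(0, 1)` with `u 0 = 0` that lie in `L²_{1/σ}(0, 1)`. -/
def h1σL : Submodule ℂ (C(Icc (0 : ℝ) 1, ℂ) × L2 0 1) where
  carrier := {w | w ∈ H1 0 1 ∧ zeroExt w.1 0 = 0 ∧ MemLp (zeroExt w.1) 2 S.invσMeasure}
  zero_mem' := ⟨(H1 0 1).zero_mem, by simp [zeroExt_zero], by simp [zeroExt_zero]⟩
  add_mem' := by
    intro w z hw hz
    refine ⟨(H1 0 1).add_mem hw.1 hz.1, by simp [zeroExt_add, hw.2.1, hz.2.1], ?_⟩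
    rw [Prod.fst_add, zeroExt_add]
    exact hw.2.2.add hz.2.2
  smul_mem' := by
    intro r w hw
    refine ⟨(H1 0 1).smul_mem r hw.1, by simp [zeroExt_smul, hw.2.1], ?_⟩
    rw [Prod.smul_fst, zeroExt_smul]
    exact hw.2.2.const_smul r

/-- `H¹_{1/σ,L}(0, 1)`, normed below by the energy norm `‖u‖² = ∫₀¹ η |u_x|² dx`. -/
def H1σL : Type := ↥S.h1σL

instance : AddCommGroup S.H1σL := inferInstanceAs (AddCommGroup ↥S.h1σL)

instance : Module ℂ S.H1σL := inferInstanceAs (Module ℂ ↥S.h1σL)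

variable {S}

/-- The function underlying an element of `H¹_{1/σ,L}(0, 1)`. -/
def H1σL.fn (u : S.H1σL) : ℝ → ℂ := zeroExt (Subtype.val (p := (· ∈ S.h1σL)) u).1

/-- The derivative `u_x` of an element of `H¹_{1/σ,L}(0, 1)`. -/
def H1σL.dx : S.H1σL →ₗ[ℂ] L2 0 1 :=
  (LinearMap.snd ℂ C(Icc (0 : ℝ) 1, ℂ) (L2 0 1)).comp S.h1σL.subtype

theorem H1σL.fn_add (u v : S.H1σL) : (u + v).fn = u.fn + v.fn := zeroExt_add _ _

theorem H1σL.fn_smul (r : ℂ) (u : S.H1σL) : (r • u).fn = r • u.fn := zeroExt_smul _ _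

theorem H1σL.isPrimitiveOn (u : S.H1σL) : IsPrimitiveOn (Icc 0 1) u.fn u.dx := u.2.1

theorem H1σL.fn_zero (u : S.H1σL) : u.fn 0 = 0 := u.2.2.1

theorem H1σL.dx_injective : Function.Injective (H1σL.dx (S := S)) := by
  intro y z h
  have hfn : EqOn y.fn z.fn (Icc 0 1) := fun x hx => by
    have h1 := (y.isPrimitiveOn 0 (by norm_num) x hx).2
    have h2 := (z.isPrimitiveOn 0 (by norm_num) x hx).2
    rw [H1σL.fn_zero, h, ← h2, H1σL.fn_zero] at h1
    simpa using h1
  refine Subtype.ext (Prod.ext (ContinuousMap.ext fun x => ?_) h)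
  have := hfn x.2
  simpa [H1σL.fn, zeroExt_apply _ x.2] using this

theorem integrable_η_mul (f g : L2 0 1) :
    Integrable (fun x => (S.η x : ℂ) * (starRingEnd ℂ (f x) * g x))
      (volume.restrict (Ioo 0 1)) := by
  have h1 : Integrable (fun x => starRingEnd ℂ (f x) * g x) (volume.restrict (Ioo 0 1)) := by
    have := L2.integrable_inner (𝕜 := ℂ) f g
    refine this.congr (Eventually.of_forall fun x => ?_)
    simp [mul_comm]
  obtain ⟨C, hC⟩ := isCompact_Icc.exists_bound_of_continuousOn S.η_cont
  refine h1.bdd_mul (c := C) ?_ ?_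
  · exact (Complex.continuous_ofReal.comp_continuousOn
      (S.η_cont.mono Ioo_subset_Icc_self)).aestronglyMeasurable measurableSet_Ioo
  · refine (ae_restrict_iff' measurableSet_Ioo).2 (Eventually.of_forall fun x hx => ?_)
    simpa using hC x (Ioo_subset_Icc_self hx)

/-- The inner product of `H¹_{1/σ,L}(0, 1)` used in the energy space. -/
@[reducible]
def H1σL.core : InnerProductSpace.Core ℂ S.H1σL where
  inner u v := ∫ x in Ioo (0 : ℝ) 1, (S.η x : ℂ) * (starRingEnd ℂ (u.dx x) * v.dx x)
  conj_inner_symm u v := by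
    rw [← integral_conj]
    refine integral_congr_ae (Eventually.of_forall fun x => ?_)
    simp [mul_comm]
  re_inner_nonneg u := by
    have : ∀ x, (S.η x : ℂ) * (starRingEnd ℂ (u.dx x) * u.dx x)
        = ((S.η x * ‖u.dx x‖ ^ 2 : ℝ) : ℂ) := fun x => by
      rw [Complex.conj_mul']
      push_cast
      ring
    simp_rw [this]
    rw [integral_complex_ofReal]
    change 0 ≤ (∫ x in Ioo (0 : ℝ) 1, S.η x * ‖u.dx x‖ ^ 2)
    exact integral_nonneg fun x => mul_nonneg (S.η_pos x).le (by positivity)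
  add_left u v w := by
    rw [← integral_add (integrable_η_mul _ _) (integrable_η_mul _ _)]
    refine integral_congr_ae ?_
    filter_upwards [Lp.coeFn_add u.dx v.dx] with x hx
    rw [map_add, hx]
    simp only [Pi.add_apply, map_add]
    ring
  smul_left u v r := by
    rw [← integral_const_mul]
    refine integral_congr_ae ?_
    filter_upwards [Lp.coeFn_smul r u.dx] with x hx
    rw [map_smul, hx]
    simp only [Pi.smul_apply, smul_eq_mul, map_mul]
    ring
  definite u hu := by
    have h0 : ∀ x, (S.η x : ℂ) * (starRingEnd ℂ (u.dx x) * u.dx x)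
        = ((S.η x * ‖u.dx x‖ ^ 2 : ℝ) : ℂ) := fun x => by
      rw [Complex.conj_mul']
      push_cast
      ring
    have hi := (integrable_η_mul (S := S) u.dx u.dx)
    simp_rw [h0] at hu hi
    rw [integral_complex_ofReal] at hu
    have hu' := Complex.ofReal_eq_zero.1 hu
    have hi' : Integrable (fun x => S.η x * ‖u.dx x‖ ^ 2) (volume.restrict (Ioo 0 1)) := by
      exact hi.re
    rw [integral_eq_zero_iff_of_nonneg
      (fun x => mul_nonneg (S.η_pos x).le (by positivity)) hi'] at hu'
    apply H1σL.dx_injective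
    rw [map_zero]
    refine Lp.ext ?_
    filter_upwards [hu', Lp.coeFn_zero ℂ 2 (volume.restrict (Ioo (0 : ℝ) 1))] with x hx h'x
    rw [h'x]
    have hη := (S.η_pos x).ne'
    simpa [hη] using hx

instance : NormedAddCommGroup S.H1σL := H1σL.core.toNormedAddCommGroup

instance : InnerProductSpace ℂ S.H1σL := InnerProductSpace.ofCore H1σL.core.toCore

variable (S)

/-! ### The memory space and the energy space -/

/-- The measure `c m μ(s) ds` on `(0, ∞)`. -/
def memoryMeasure : Measure ℝ :=
  (volume.restrict (Ioi 0)).withDensity fun s => ENNReal.ofReal (S.c * S.m * S.μ s)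

/-- The memory space `W`: square integrable functions of `s > 0` with values in `H¹_R(1, 2)`, for
the measure `c m μ(s) ds`. For `m = 0` this measure, hence the norm of `W`, vanishes, and `W` is
the zero space. -/
abbrev W : Type := Lp H1R 2 S.memoryMeasure

/-- The energy space
`H¹_{1/σ,L}(0, 1) × L²_{1/σ}(0, 1) × L²(1, 2) × W`, with the sum of the four inner products. -/
abbrev Energy : Type := WithLp 2 (S.H1σL × WithLp 2 (S.L2σ × WithLp 2 (L2 1 2 × S.W)))

variable {S}

/-- The component `u` of `(u, v, y, γ)`. -/
def Energy.u (U : S.Energy) : S.H1σL := U.fst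

/-- The component `v` of `(u, v, y, γ)`. -/
def Energy.v (U : S.Energy) : S.L2σ := U.snd.fst

/-- The component `y` of `(u, v, y, γ)`. -/
def Energy.y (U : S.Energy) : L2 1 2 := U.snd.snd.fst

/-- The component `γ` of `(u, v, y, γ)`. -/
def Energy.γ (U : S.Energy) : S.W := U.snd.snd.snd

/-- The inner product of the energy space, written out (conjugate linear in the first variable). -/
theorem energy_inner (U V : S.Energy) : inner ℂ U V =
    (∫ x in Ioo (0 : ℝ) 1, (S.η x : ℂ) * (starRingEnd ℂ (U.u.dx x) * V.u.dx x)) +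
      ((∫ x, inner ℂ (U.v x) (V.v x) ∂S.invσMeasure) +
        ((∫ x in Ioo (1 : ℝ) 2, inner ℂ (U.y x) (V.y x)) +
          ∫ s, inner ℂ (U.γ s) (V.γ s) ∂S.memoryMeasure)) := rfl

/-! ### The operator -/

theorem μ_antitone : AntitoneOn S.μ (Ioi 0) := by
  obtain ⟨K, hK, h⟩ := S.μ_dafermos
  refine antitoneOn_of_deriv_nonpos (convex_Ioi 0) S.μ_contDiff.continuousOn ?_ ?_
  · rw [interior_Ioi]
    exact S.μ_contDiff.differentiableOn one_ne_zero
  · rw [interior_Ioi]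
    intro s hs
    have h1 := h s hs
    have h2 := mul_nonneg hK.le (S.μ_nonneg s hs)
    linarith

variable (S) in
/-- The interval of all `s ≥ 0` that the memory sees: `0` and the points where `c m μ > 0`. Up to
null sets, the classes in `W` are functions on this interval. -/
def memoryInterval : Set ℝ := insert 0 {s | 0 < s ∧ 0 < S.c * S.m * S.μ s}

instance : S.memoryInterval.OrdConnected := by
  refine ⟨fun x hx y hy z hz => ?_⟩
  rcases (show 0 ≤ x by rcases hx with rfl | hx; exacts [le_rfl, hx.1.le]).trans hz.1 |>.eq_or_lt
    with h | h
  · exact Or.inl h.symm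
  · rcases hy with rfl | hy
    · exact absurd (h.trans_le hz.2) (lt_irrefl _)
    · refine Or.inr ⟨h, hy.2.trans_le ?_⟩
      exact mul_le_mul_of_nonneg_left (S.μ_antitone h hy.1 hz.2)
        (mul_nonneg S.c_pos.le S.m_mem.1)

/-- `ζ = c (1 - m) y + c m ∫₀^∞ μ(s) γ(s) ds`. -/
def zeta (y : H1R) (γ : S.W) : H1R :=
  ((S.c * (1 - S.m) : ℝ) : ℂ) • y +
    ((S.c * S.m : ℝ) : ℂ) • ∫ s in Ioi 0, (S.μ s : ℂ) • γ s

/-- `IsValue U F q y z Γ γs` says that `U = (u, v, y, γ)` lies in the domain of the operator and is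
mapped to `F`. Here `q` is the continuous representative of `η u_x` on `(0, 1]`, `y` the
representative of the third component in `H¹_R(1, 2)`, `z` is `ζ_x`, `Γ` is the continuous
representative of `γ`, and `γs` is the derivative of `γ` in `s`. -/
structure IsValue (U F : S.Energy) (q : ℝ → ℂ) (y : H1R) (z : H1 1 2) (Γ : ℝ → H1R)
    (γs : S.W) : Prop where
  /-- `v ∈ H¹_{1/σ,L}(0, 1)`, and the first component of the value is `v` -/
  v_eq : U.v =ᵐ[S.invσMeasure] F.u.fn
  /-- `q = η u_x` -/
  flux_eq : q =ᵐ[volume.restrict (Ioo 0 1)] fun x => (S.η x : ℂ) * U.u.dx x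
  /-- `u ∈ H²_{1/σ,L}(0, 1)`, and the second component of the value is `σ (η u_x)_x` -/
  flux_deriv : IsPrimitiveOn (Ioc 0 1) q fun x => F.v x / (S.σ x : ℂ)
  /-- `y ∈ H¹_R(1, 2)` -/
  y_eq : U.y =ᵐ[volume.restrict (Ioo 1 2)] y.fn
  /-- `ζ ∈ H²(1, 2)`, since `ζ_x = z ∈ H¹(1, 2)` -/
  zeta_eq : (zeta y U.γ).dx =ᵐ[volume.restrict (Ioo 1 2)] zeroExt z.1.1
  /-- the third component of the value is `ζ_xx` -/
  zeta_deriv : F.y = z.1.2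
  /-- `Γ` represents `γ` -/
  γ_eq : U.γ =ᵐ[S.memoryMeasure] Γ
  /-- `γ(·, 0) = 0` -/
  γ_zero : Γ 0 = 0
  /-- `γ_s ∈ W` -/
  γ_deriv : IsPrimitiveOn S.memoryInterval Γ γs
  /-- the fourth component of the value is `-γ_s + y` -/
  γ_value : F.γ =ᵐ[S.memoryMeasure] fun s => -γs s + y
  /-- `η(1) u_x(1) = ζ_x(1)` -/
  flux_one : q 1 = zeroExt z.1.1 1
  /-- `v(1) = y(1)` -/
  v_one : F.u.fn 1 = y.fn 1

theorem integrable_μ : Integrable (fun s => S.c * S.m * S.μ s) (volume.restrict (Ioi 0)) :=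
  S.μ_integrable.const_mul _

instance : IsFiniteMeasure S.memoryMeasure :=
  isFiniteMeasure_withDensity_ofReal S.integrable_μ.2

theorem zeta_eq_integral (y : H1R) (γ : S.W) :
    zeta y γ = ((S.c * (1 - S.m) : ℝ) : ℂ) • y + ∫ s, γ s ∂S.memoryMeasure := by
  have hW : ∫ s, γ s ∂S.memoryMeasure
      = ∫ s in Ioi 0, (ENNReal.ofReal (S.c * S.m * S.μ s)).toReal • γ s :=
    integral_withDensity_eq_integral_toReal_smul₀
    S.integrable_μ.aestronglyMeasurable.aemeasurable.ennreal_ofReal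
    (Eventually.of_forall fun _ => ENNReal.ofReal_lt_top) _
  rw [zeta, hW, ← integral_smul]
  congr 1
  refine setIntegral_congr_fun measurableSet_Ioi fun s hs => ?_
  rw [ENNReal.toReal_ofReal
    (mul_nonneg (mul_nonneg S.c_pos.le S.m_mem.1) (S.μ_nonneg s hs)), smul_smul,
    ← Complex.ofReal_mul, Complex.coe_smul]

theorem integrable_memory (γ : S.W) : Integrable γ S.memoryMeasure :=
  (Lp.memLp γ).integrable (by norm_num)

theorem zeta_add (y y' : H1R) (γ γ' : S.W) : zeta (y + y') (γ + γ') = zeta y γ + zeta y' γ' := by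
  simp only [zeta_eq_integral]
  rw [integral_congr_ae (Lp.coeFn_add γ γ')]
  simp only [Pi.add_apply]
  rw [integral_add (integrable_memory γ) (integrable_memory γ'), smul_add]
  abel

theorem zeta_smul (r : ℂ) (y : H1R) (γ : S.W) : zeta (r • y) (r • γ) = r • zeta y γ := by
  simp only [zeta_eq_integral]
  rw [integral_congr_ae (Lp.coeFn_smul r γ)]
  simp only [Pi.smul_apply]
  rw [integral_smul, smul_add, smul_comm]

theorem ae_memory {P : ℝ → Prop} :
    (∀ᵐ s ∂S.memoryMeasure, P s) ↔ ∀ᵐ s, s ∈ S.memoryInterval → P s := by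
  rw [memoryMeasure, ae_withDensity_iff'
    S.integrable_μ.aestronglyMeasurable.aemeasurable.ennreal_ofReal,
    ae_restrict_iff' measurableSet_Ioi]
  have h0 : ∀ᵐ s : ℝ, s ≠ 0 := by simp [ae_iff]
  constructor
  · intro h
    filter_upwards [h, h0] with s hs hs0 hsI
    rcases hsI with rfl | hsI
    · exact absurd rfl hs0
    · exact hs hsI.1 (by simpa using hsI.2)
  · intro h
    filter_upwards [h] with s hs hs1 hs2
    exact hs (Or.inr ⟨hs1, by simpa using hs2⟩)

theorem ae_invσ {P : ℝ → Prop} :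
    (∀ᵐ x ∂S.invσMeasure, P x) ↔ ∀ᵐ x ∂(volume.restrict (Ioo 0 1)), P x := by
  have hm : AEMeasurable (fun x => ENNReal.ofReal (1 / S.σ x)) (volume.restrict (Ioo 0 1)) := by
    refine AEMeasurable.ennreal_ofReal ?_
    refine ContinuousOn.aemeasurable ?_ measurableSet_Ioo
    exact continuousOn_const.div (S.σ_cont.mono Ioo_subset_Icc_self)
      fun x hx => (S.σ_pos (Ioo_subset_Ioc_self hx)).ne'
  rw [invσMeasure, ae_withDensity_iff' hm, ae_restrict_iff' measurableSet_Ioo,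
    ae_restrict_iff' measurableSet_Ioo]
  refine eventually_congr (Eventually.of_forall fun x => ?_)
  refine forall_congr' fun hx => ?_
  have : ENNReal.ofReal (1 / S.σ x) ≠ 0 := by
    simpa using S.σ_pos (Ioo_subset_Ioc_self hx)
  exact ⟨fun h => h this, fun h _ => h⟩

theorem ae_mem_Ioc_of_ae_restrict {p q : ℝ} {P : ℝ → Prop}
    (h : ∀ᵐ x ∂(volume.restrict (Ioo p q)), P x) : ∀ᵐ x, x ∈ Ioc p q → P x := by
  filter_upwards [ae_mem_Icc_of_ae_restrict h] with x hx h'x using hx (Ioc_subset_Icc_self h'x)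

theorem IsValue.add {U F U' F' : S.Energy} {q q' : ℝ → ℂ} {y y' : H1R} {z z' : H1 1 2}
    {Γ Γ' : ℝ → H1R} {γs γs' : S.W} (h : IsValue U F q y z Γ γs)
    (h' : IsValue U' F' q' y' z' Γ' γs') :
    IsValue (U + U') (F + F') (q + q') (y + y') (z + z') (Γ + Γ') (γs + γs') where
  v_eq := by
    filter_upwards [h.v_eq, h'.v_eq, Lp.coeFn_add U.v U'.v] with x h1 h2 h3
    change (U.v + U'.v : S.L2σ) x = (F.u + F'.u).fn x
    rw [h3, H1σL.fn_add, Pi.add_apply, Pi.add_apply, h1, h2]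
  flux_eq := by
    filter_upwards [h.flux_eq, h'.flux_eq, Lp.coeFn_add U.u.dx U'.u.dx] with x h1 h2 h3
    change q x + q' x = S.η x * (H1σL.dx (U.u + U'.u)) x
    rw [map_add, h3, Pi.add_apply, h1, h2, mul_add]
  flux_deriv := by
    refine (h.flux_deriv.add h'.flux_deriv).congr (fun _ _ => rfl) ?_
    apply ae_mem_Ioc_of_ae_restrict
    filter_upwards [ae_invσ.1 (Lp.coeFn_add F.v F'.v)] with x h3
    change F.v x / S.σ x + F'.v x / S.σ x = (F.v + F'.v : S.L2σ) x / S.σ x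
    rw [h3, Pi.add_apply, add_div]
  y_eq := by
    filter_upwards [h.y_eq, h'.y_eq, Lp.coeFn_add U.y U'.y] with x h1 h2 h3
    change (U.y + U'.y : L2 1 2) x = (y + y').fn x
    rw [h3, H1R.fn_add, Pi.add_apply, Pi.add_apply, h1, h2]
  zeta_eq := by
    change (zeta (y + y') (U.γ + U'.γ)).dx =ᵐ[_] zeroExt (z.1.1 + z'.1.1)
    rw [zeta_add, map_add, zeroExt_add]
    exact (Lp.coeFn_add _ _).trans (h.zeta_eq.add h'.zeta_eq)
  zeta_deriv := by
    change F.y + F'.y = z.1.2 + z'.1.2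
    rw [h.zeta_deriv, h'.zeta_deriv]
  γ_eq := (Lp.coeFn_add _ _).trans (h.γ_eq.add h'.γ_eq)
  γ_zero := by simp [h.γ_zero, h'.γ_zero]
  γ_deriv := by
    refine (h.γ_deriv.add h'.γ_deriv).congr (fun _ _ => rfl) ?_
    filter_upwards [ae_memory.1 (Lp.coeFn_add γs γs')] with s hs h's
    exact (hs h's).symm
  γ_value := by
    filter_upwards [h.γ_value, h'.γ_value, Lp.coeFn_add F.γ F'.γ, Lp.coeFn_add γs γs']
      with s h1 h2 h3 h4
    change (F.γ + F'.γ : S.W) s = _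
    rw [h3, h4, Pi.add_apply, Pi.add_apply, h1, h2]
    abel
  flux_one := by
    change q 1 + q' 1 = zeroExt (z.1.1 + z'.1.1) 1
    rw [zeroExt_add, h.flux_one, h'.flux_one, Pi.add_apply]
  v_one := by
    change (F.u + F'.u).fn 1 = _
    rw [H1σL.fn_add, H1R.fn_add, Pi.add_apply, Pi.add_apply, h.v_one, h'.v_one]

theorem IsValue.smul {U F : S.Energy} {q : ℝ → ℂ} {y : H1R} {z : H1 1 2}
    {Γ : ℝ → H1R} {γs : S.W} (r : ℂ) (h : IsValue U F q y z Γ γs) :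
    IsValue (r • U) (r • F) (r • q) (r • y) (r • z) (r • Γ) (r • γs) where
  v_eq := by
    filter_upwards [h.v_eq, Lp.coeFn_smul r U.v] with x h1 h3
    change (r • U.v : S.L2σ) x = (r • F.u).fn x
    rw [h3, H1σL.fn_smul, Pi.smul_apply, Pi.smul_apply, h1]
  flux_eq := by
    filter_upwards [h.flux_eq, Lp.coeFn_smul r U.u.dx] with x h1 h3
    change r * q x = S.η x * (H1σL.dx (r • U.u)) x
    rw [map_smul, h3, Pi.smul_apply, h1, smul_eq_mul]
    ring
  flux_deriv := by
    refine (h.flux_deriv.smul r).congr (fun _ _ => rfl) ?_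
    apply ae_mem_Ioc_of_ae_restrict
    filter_upwards [ae_invσ.1 (Lp.coeFn_smul r F.v)] with x h3
    change r * (F.v x / S.σ x) = (r • F.v : S.L2σ) x / S.σ x
    rw [h3, Pi.smul_apply, smul_eq_mul, mul_div_assoc]
  y_eq := by
    filter_upwards [h.y_eq, Lp.coeFn_smul r U.y] with x h1 h3
    change (r • U.y : L2 1 2) x = (r • y).fn x
    rw [h3, H1R.fn_smul, Pi.smul_apply, Pi.smul_apply, h1]
  zeta_eq := by
    change (zeta (r • y) (r • U.γ)).dx =ᵐ[_] zeroExt (r • z.1.1)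
    rw [zeta_smul, map_smul, zeroExt_smul]
    exact (Lp.coeFn_smul _ _).trans (h.zeta_eq.const_smul r)
  zeta_deriv := by
    change r • F.y = r • z.1.2
    rw [h.zeta_deriv]
  γ_eq := (Lp.coeFn_smul _ _).trans (h.γ_eq.const_smul r)
  γ_zero := by simp [h.γ_zero]
  γ_deriv := by
    refine (h.γ_deriv.smul r).congr (fun _ _ => rfl) ?_
    filter_upwards [ae_memory.1 (Lp.coeFn_smul r γs)] with s hs h's
    exact (hs h's).symm
  γ_value := by
    filter_upwards [h.γ_value, Lp.coeFn_smul r F.γ, Lp.coeFn_smul r γs] with s h1 h3 h4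
    change (r • F.γ : S.W) s = _
    rw [h3, h4, Pi.smul_apply, Pi.smul_apply, h1, smul_add, smul_neg]
  flux_one := by
    change r * q 1 = zeroExt (r • z.1.1) 1
    rw [zeroExt_smul, h.flux_one, Pi.smul_apply, smul_eq_mul]
  v_one := by
    change (r • F.u).fn 1 = _
    rw [H1σL.fn_smul, H1R.fn_smul, Pi.smul_apply, Pi.smul_apply, h.v_one]

theorem IsValue.zero : IsValue (0 : S.Energy) 0 0 0 0 0 0 where
  v_eq := by
    filter_upwards [Lp.coeFn_zero ℂ 2 S.invσMeasure] with x h1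
    change (0 : S.L2σ) x = zeroExt 0 x
    rw [h1, zeroExt_zero]
  flux_eq := by
    filter_upwards [Lp.coeFn_zero ℂ 2 (volume.restrict (Ioo (0 : ℝ) 1))] with x h1
    change 0 = (S.η x : ℂ) * (0 : L2 0 1) x
    rw [h1]
    simp
  flux_deriv := by
    refine IsPrimitiveOn.zero.congr (fun _ _ => rfl) ?_
    apply ae_mem_Ioc_of_ae_restrict
    filter_upwards [ae_invσ.1 (Lp.coeFn_zero ℂ 2 S.invσMeasure)] with x h3
    change 0 = (0 : S.L2σ) x / S.σ x
    rw [h3]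
    simp
  y_eq := by
    filter_upwards [Lp.coeFn_zero ℂ 2 (volume.restrict (Ioo (1 : ℝ) 2))] with x h1
    change (0 : L2 1 2) x = zeroExt 0 x
    rw [h1, zeroExt_zero]
  zeta_eq := by
    change (zeta 0 (0 : S.W)).dx =ᵐ[_] zeroExt 0
    have h : zeta 0 (0 : S.W) = 0 := by simpa using zeta_smul (0 : ℂ) 0 (0 : S.W)
    rw [h, map_zero, zeroExt_zero]
    exact Lp.coeFn_zero _ _ _
  zeta_deriv := rfl
  γ_eq := Lp.coeFn_zero _ _ _
  γ_zero := rfl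
  γ_deriv := by
    refine IsPrimitiveOn.zero.congr (fun _ _ => rfl) ?_
    filter_upwards [ae_memory.1 (Lp.coeFn_zero H1R 2 S.memoryMeasure)] with s hs h's
    exact (hs h's).symm
  γ_value := by
    filter_upwards [Lp.coeFn_zero H1R 2 S.memoryMeasure] with s h1
    change (0 : S.W) s = -(0 : S.W) s + 0
    rw [h1]
    simp
  flux_one := by
    change 0 = zeroExt 0 1
    rw [zeroExt_zero, Pi.zero_apply]
  v_one := by
    change zeroExt 0 1 = zeroExt 0 1
    rw [zeroExt_zero, zeroExt_zero]

variable (S) in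
/-- The graph of the operator. -/
def graph : Submodule ℂ (S.Energy × S.Energy) where
  carrier := {p | ∃ q y z Γ γs, IsValue p.1 p.2 q y z Γ γs}
  zero_mem' := ⟨_, _, _, _, _, IsValue.zero⟩
  add_mem' := by
    rintro p p' ⟨_, _, _, _, _, h⟩ ⟨_, _, _, _, _, h'⟩
    exact ⟨_, _, _, _, _, h.add h'⟩
  smul_mem' := by
    rintro r p ⟨_, _, _, _, _, h⟩
    exact ⟨_, _, _, _, _, h.smul r⟩

theorem graph_single_valued (p : S.Energy × S.Energy) (hp : p ∈ S.graph) (h0 : p.1 = 0) :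
    p.2 = 0 := by
  obtain ⟨U, F⟩ := p
  obtain ⟨q, y, z, Γ, γs, h⟩ := hp
  dsimp only at h0 h ⊢
  subst h0
  have hu : F.u = 0 := by
    apply H1σL.dx_injective
    rw [map_zero]
    have h1 := F.u.isPrimitiveOn.ae_eq_zero (ae_mem_Icc_of_ae_restrict (ae_invσ.1 (by
      filter_upwards [h.v_eq, Lp.coeFn_zero ℂ 2 S.invσMeasure] with x h1 h2
      exact h1.symm.trans h2)))
    refine Lp.ext ?_
    filter_upwards [Lp.coeFn_zero ℂ 2 (volume.restrict (Ioo (0 : ℝ) 1)),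
      ae_restrict_of_ae h1, ae_restrict_mem measurableSet_Ioo] with x h2 h3 h4
    rw [h2, h3 (Ioo_subset_Icc_self h4), Pi.zero_apply]
  have hv : F.v = 0 := by
    have h1 := h.flux_deriv.ae_eq_zero (ae_mem_Ioc_of_ae_restrict (by
      filter_upwards [h.flux_eq, Lp.coeFn_zero ℂ 2 (volume.restrict (Ioo (0 : ℝ) 1))]
        with x h1 h2
      rw [h1]
      change (S.η x : ℂ) * (0 : L2 0 1) x = 0
      rw [h2]
      simp))
    refine Lp.ext ?_
    filter_upwards [Lp.coeFn_zero ℂ 2 S.invσMeasure, ae_invσ.2 (ae_restrict_of_ae h1),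
      ae_invσ.2 (ae_restrict_mem measurableSet_Ioo)] with x h2 h3 h4
    have h5 := h3 (Ioo_subset_Ioc_self h4)
    have h6 := (S.σ_pos (Ioo_subset_Ioc_self h4)).ne'
    rw [h2]
    simpa [h6] using h5
  have hy : y = 0 := by
    apply H1R.dx_injective
    rw [map_zero]
    have h1 := y.isPrimitiveOn.ae_eq_zero (ae_mem_Icc_of_ae_restrict (by
      filter_upwards [h.y_eq, Lp.coeFn_zero ℂ 2 (volume.restrict (Ioo (1 : ℝ) 2))] with x h1 h2
      exact h1.symm.trans h2))
    refine Lp.ext ?_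
    filter_upwards [Lp.coeFn_zero ℂ 2 (volume.restrict (Ioo (1 : ℝ) 2)),
      ae_restrict_of_ae h1, ae_restrict_mem measurableSet_Ioo] with x h2 h3 h4
    rw [h2, h3 (Ioo_subset_Icc_self h4), Pi.zero_apply]
  subst hy
  have hz : F.y = 0 := by
    rw [h.zeta_deriv]
    have hzp : IsPrimitiveOn (Icc 1 2) (zeroExt z.1.1) z.1.2 := z.2
    have h0 : zeta 0 (0 : S.W) = 0 := by simpa using zeta_smul (0 : ℂ) 0 (0 : S.W)
    have h1 := hzp.ae_eq_zero (ae_mem_Icc_of_ae_restrict (by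
      have h2 : (zeta 0 (0 : S.W)).dx =ᵐ[volume.restrict (Ioo 1 2)] zeroExt z.1.1 := h.zeta_eq
      rw [h0, map_zero] at h2
      filter_upwards [h2, Lp.coeFn_zero ℂ 2 (volume.restrict (Ioo (1 : ℝ) 2))] with x h1 h2
      exact h1.symm.trans h2))
    refine Lp.ext ?_
    filter_upwards [Lp.coeFn_zero ℂ 2 (volume.restrict (Ioo (1 : ℝ) 2)),
      ae_restrict_of_ae h1, ae_restrict_mem measurableSet_Ioo] with x h2 h3 h4
    rw [h2, h3 (Ioo_subset_Icc_self h4), Pi.zero_apply]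
  have hγ : F.γ = 0 := by
    have h1 := h.γ_deriv.ae_eq_zero (ae_memory.1 (by
      filter_upwards [h.γ_eq, Lp.coeFn_zero H1R 2 S.memoryMeasure] with s h1 h2
      exact h1.symm.trans h2))
    refine Lp.ext ?_
    filter_upwards [h.γ_value, Lp.coeFn_zero H1R 2 S.memoryMeasure, ae_memory.2 h1]
      with s h2 h3 h4
    rw [h2, h3, h4]
    simp
  exact congrArg (WithLp.toLp 2) (Prod.ext hu (congrArg (WithLp.toLp 2)
    (Prod.ext hv (congrArg (WithLp.toLp 2) (Prod.ext hz hγ)))))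

variable (S) in
/-- The operator `𝒜 (u, v, y, γ) = (v, σ (η u_x)_x, ζ_xx, -γ_s + y)` with its domain. -/
def operator : S.Energy →ₗ.[ℂ] S.Energy := S.graph.toLinearPMap

/-- The operator has the graph from which it was defined. -/
theorem operator_graph : S.operator.graph = S.graph :=
  Submodule.toLinearPMap_graph_eq _ graph_single_valued

end TransmissionData

/-! ### Dissipative operators and semigroups -/

section Semigroup

variable {H : Type*} [NormedAddCommGroup H] [InnerProductSpace ℂ H]

/-- `A` is m-dissipative: `Re ⟨A U, U⟩ ≤ 0` on the domain, and `λ - A` maps the domain onto the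
whole space for all `λ > 0`. -/
def IsMDissipative (A : H →ₗ.[ℂ] H) : Prop :=
  (∀ U : A.domain, (inner ℂ (U : H) (A U)).re ≤ 0) ∧
    ∀ l : ℝ, 0 < l → ∀ F : H, ∃ U : A.domain, (l : ℂ) • (U : H) - A U = F

/-- `T` is a `C₀`-semigroup of contractions (only its values at `t ≥ 0` matter). -/
structure IsContractionSemigroup (T : ℝ → H →L[ℂ] H) : Prop where
  zero : T 0 = ContinuousLinearMap.id ℂ H
  add : ∀ s t, 0 ≤ s → 0 ≤ t → T (s + t) = (T s).comp (T t)
  continuous : ∀ U : H, ContinuousOn (fun t => T t U) (Ici 0)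
  contraction : ∀ t, 0 ≤ t → ‖T t‖ ≤ 1

/-- `A` is the infinitesimal generator of `T`: the limit of `(T t U - U) / t` as `t → 0⁺` exists
exactly for `U` in the domain of `A`, and is `A U`. -/
def IsGenerator (A : H →ₗ.[ℂ] H) (T : ℝ → H →L[ℂ] H) : Prop :=
  ∀ U F : H, (U, F) ∈ A.graph ↔
    Tendsto (fun t : ℝ => ((t⁻¹ : ℝ) : ℂ) • (T t U - U)) (𝓝[>] 0) (𝓝 F)

/-- `U` is a classical solution of `U_t = A U`, `U(0) = U₀`, on `[0, ∞)`. -/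
structure IsClassicalSolution (A : H →ₗ.[ℂ] H) (U₀ : H) (U : ℝ → H) : Prop where
  initial : U 0 = U₀
  equation : ∃ U' : ℝ → H, ContinuousOn U' (Ici 0) ∧
    ∀ t, 0 ≤ t → HasDerivWithinAt U (U' t) (Ici 0) t ∧ (U t, U' t) ∈ A.graph

end Semigroup

end DegenerateWaveHeat

end

/-! The energy norm sees only `u_x` in the first component and need not control `u` in `L²_{1/σ}`.
For `a = x³`, `b = 0`, the function `x` is an energy limit of admissible functions without being
square integrable for `dx/x³`. So the energy space may be incomplete, and the Lumer-Phillips theorem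
cannot be applied to it directly. M-dissipativity is proved by hand in this inner product space, and
generation goes through a finer Hilbert norm.

Dissipativity is integration by parts on each piece. At the degenerate end the boundary term
`Re(conj v · η u_x)` has a limit, since its derivative is integrable. The limit is zero: `|v(x)| ≤
√x ‖v_x‖`, so a nonzero limit would force `|η u_x|² ≥ const / x`, against `η u_x ∈ L²`
(`eq_zero_of_tendsto_of_le_sqrt_mul`). The boundary terms at `1` cancel by transmission, and the
couplings between `y` and the memory cancel in the real part. What remains is `-c(1-m)‖y‖²` and
`-Re⟨γ, γ_s⟩`; the latter is nonpositive because `γ(0) = 0` and `μ` decreases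
(`integral_re_inner_nonneg`).

For the range, `v` and `γ` are eliminated. Variation of constants gives `γ` as a source term plus `y
(1 - e^{-ls})/l`, so `ζ = k y + φ` with an effective conductivity `k > 0`. The remaining problem for
`(u, y)` is variational. It is solved by orthogonal projection onto a subspace that is complete even
though its ambient space need not be (`completeSpace_formDomain`); test functions vanishing near `0`
recover the flux and the strong equation (`exists_strong_of_weak`).

For generation, let `K` be the energy space with `‖u‖²` in `L²_{1/σ}` added to the squared norm. It
is complete because the embedding into `L²_{1/σ}` is closed (`H1σL.exists_tendsto`). The first
component of `𝒜U` is `v`, so the added term contributes at most `‖U‖²` to `Re⟨U, 𝒜U⟩`. Thus `𝒜 - 1`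
is m-dissipative in `K`, and its Yosida approximations produce a contraction semigroup `S(t)` there.
For data in the domain, `e^t S(t) U₀` is also differentiable in the energy norm, so dissipativity in
that norm makes its energy decrease. Density extends this bound to all data, and `e^t S(t)` is the
wanted semigroup. Its generator is no larger than `𝒜` by `IsContractionSemigroup.mem_graph_iff`,
which needs no completeness. -/

namespace DegenerateWaveHeat

/-! ### Contraction semigroups on inner product spaces -/

section AbstractSemigroup

variable {H : Type*} [NormedAddCommGroup H] [InnerProductSpace ℂ H]

/-- The linear relation `G` is the graph of an m-dissipative operator. -/
structure IsMDissipativeGraph (G : Submodule ℂ (H × H)) : Prop where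
  dissipative : ∀ p ∈ G, (inner ℂ p.1 p.2).re ≤ 0
  range : ∀ l : ℝ, 0 < l → ∀ F : H, ∃ p ∈ G, (l : ℂ) • p.1 - p.2 = F
  single_valued : ∀ p ∈ G, p.1 = 0 → p.2 = 0

theorem IsMDissipative.graph {A : H →ₗ.[ℂ] H} (hA : IsMDissipative A) :
    IsMDissipativeGraph A.graph where
  dissipative p hp := by
    obtain ⟨U, h1, h2⟩ := (LinearPMap.mem_graph_iff A).1 hp
    rw [← h1, ← h2]
    exact hA.1 U
  range l hl F := by
    obtain ⟨U, hU⟩ := hA.2 l hl F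
    exact ⟨(U, A U), A.mem_graph U, hU⟩
  single_valued p hp h := A.graph_fst_eq_zero_snd hp h

/-- The derivative of `‖w‖²` is `2 Re⟨w, w'⟩`. This one fact gives contractivity of the
exponentials, contractivity in the energy norm, and uniqueness of solutions. -/
theorem antitoneOn_norm_of_dissipative {w w' : ℝ → H}
    (hw : ∀ t, 0 ≤ t → HasDerivWithinAt w (w' t) (Ici 0) t)
    (hd : ∀ t, 0 ≤ t → (inner ℂ (w t) (w' t)).re ≤ 0) :
    AntitoneOn (fun t => ‖w t‖) (Ici 0) := by
  let _ : InnerProductSpace ℝ H := InnerProductSpace.complexToReal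
  have hsq : AntitoneOn (fun t => ‖w t‖ ^ 2) (Ici 0) := by
    refine antitoneOn_of_hasDerivWithinAt_nonpos (f' := fun t => 2 * (inner ℂ (w t) (w' t)).re)
      (convex_Ici 0) (fun t ht => ?_) (fun t ht => ?_) (fun t ht => ?_)
    · exact (hw t ht).continuousWithinAt.norm.pow 2
    · rw [interior_Ici] at ht ⊢
      exact ((hw t (le_of_lt ht)).norm_sq).mono Ioi_subset_Ici_self
    · rw [interior_Ici] at ht
      have := hd t (le_of_lt ht)
      linarith
  intro s hs t ht hst
  exact (pow_le_pow_iff_left₀ (norm_nonneg _) (norm_nonneg _) two_ne_zero).1 (hsq hs ht hst)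

/-! ### Resolvents and Yosida approximations. -/

namespace IsMDissipativeGraph

variable {G : Submodule ℂ (H × H)}

/-- Dissipativity gives `Re⟨p.1, l p.1 - p.2⟩ ≥ l ‖p.1‖²`, and Cauchy-Schwarz does the rest. For `l
> 0` this yields both injectivity of `l - G` and the resolvent bound, without completeness. -/
theorem norm_le (hG : IsMDissipativeGraph G) {p : H × H} (hp : p ∈ G) (l : ℝ) :
    l * ‖p.1‖ ≤ ‖(l : ℂ) • p.1 - p.2‖ := by
  have h1 := hG.dissipative p hp
  have h2 : (inner ℂ p.1 ((l : ℂ) • p.1 - p.2)).re = l * ‖p.1‖ ^ 2 - (inner ℂ p.1 p.2).re := by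
    rw [inner_sub_right, inner_smul_right, inner_self_eq_norm_sq_to_K]
    simp [← Complex.ofReal_pow]
  have h3 := (Complex.re_le_norm _).trans (norm_inner_le_norm (𝕜 := ℂ) p.1 ((l : ℂ) • p.1 - p.2))
  rcases (norm_nonneg p.1).eq_or_lt with h | h
  · rw [← h]; simp
  · nlinarith

theorem eq_of_resolvent_eq (hG : IsMDissipativeGraph G)
    {p p' : H × H} (hp : p ∈ G) (hp' : p' ∈ G) {l : ℝ} (hl : 0 < l)
    (h : (l : ℂ) • p.1 - p.2 = (l : ℂ) • p'.1 - p'.2) : p.1 = p'.1 := by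
  have h1 := hG.norm_le (G.sub_mem hp hp') l
  have h2 : (l : ℂ) • (p - p').1 - (p - p').2 = 0 := by
    rw [Prod.fst_sub, Prod.snd_sub, smul_sub, sub_sub_sub_comm, h, sub_self]
  rw [h2, norm_zero] at h1
  have h3 : ‖(p - p').1‖ ≤ 0 := by nlinarith [norm_nonneg (p - p').1]
  simpa [sub_eq_zero] using h3

/-- If `x = p.1 - p.2` is orthogonal to the domain, then `‖p.1‖² = ⟨p.1, p.2⟩` has nonpositive real
part, so `p.1 = 0`, and `p.2 = 0` by single-valuedness. Completeness is what turns a trivial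
orthogonal complement into density. -/
theorem dense_domain (hG : IsMDissipativeGraph G)
    [CompleteSpace H] : Dense (G.map (LinearMap.fst ℂ H H) : Set H) := by
  rw [Submodule.dense_iff_topologicalClosure_eq_top, Submodule.topologicalClosure_eq_top_iff,
    Submodule.eq_bot_iff]
  intro x hx
  obtain ⟨p, hp, h⟩ := hG.range 1 one_pos x
  have h1 : inner ℂ p.1 x = 0 :=
    (Submodule.mem_orthogonal _ _).1 hx p.1 (Submodule.mem_map_of_mem (f := LinearMap.fst ℂ H H) hp)
  have h2 := hG.dissipative p hp
  have h3 : p.1 = 0 := by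
    rw [← h, inner_sub_right, Complex.ofReal_one, one_smul, sub_eq_zero] at h1
    rw [← h1] at h2
    rw [inner_self_eq_norm_sq_to_K] at h2
    have h4 : ‖p.1‖ ^ 2 ≤ 0 := by simpa [← Complex.ofReal_pow] using h2
    simpa using h4.antisymm (sq_nonneg _)
  rw [← h, h3, hG.single_valued p hp h3]
  simp

/-- The resolvent `(l - G)⁻¹`. -/
noncomputable def resolvent (hG : IsMDissipativeGraph G) {l : ℝ} (hl : 0 < l) : H →L[ℂ] H :=
  LinearMap.mkContinuous
    { toFun := fun F => (hG.range l hl F).choose.1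
      map_add' := fun F F' => by
        have h := (hG.range l hl F).choose_spec
        have h' := (hG.range l hl F').choose_spec
        have h'' := (hG.range l hl (F + F')).choose_spec
        refine hG.eq_of_resolvent_eq h''.1 (G.add_mem h.1 h'.1) hl ?_
        rw [h''.2, Prod.fst_add, Prod.snd_add, smul_add, add_sub_add_comm, h.2, h'.2]
      map_smul' := fun r F => by
        have h := (hG.range l hl F).choose_spec
        have h'' := (hG.range l hl (r • F)).choose_spec
        refine hG.eq_of_resolvent_eq h''.1 (G.smul_mem r h.1) hl ?_
        rw [h''.2, Prod.smul_fst, Prod.smul_snd, smul_comm, ← smul_sub, h.2] }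
    l⁻¹ (fun F => by
      have h := (hG.range l hl F).choose_spec
      have h1 := hG.norm_le h.1 l
      rw [h.2] at h1
      rw [inv_mul_eq_div, le_div_iff₀ hl, mul_comm]
      exact h1)

theorem resolvent_mem (hG : IsMDissipativeGraph G) {l : ℝ} (hl : 0 < l) (F : H) :
    (hG.resolvent hl F, (l : ℂ) • hG.resolvent hl F - F) ∈ G := by
  have h := (hG.range l hl F).choose_spec
  have h1 : (l : ℂ) • hG.resolvent hl F - F = (hG.range l hl F).choose.2 := by
    rw [sub_eq_iff_eq_add, ← sub_eq_iff_eq_add']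
    exact h.2
  rw [h1]
  exact h.1

theorem norm_resolvent_le (hG : IsMDissipativeGraph G)
    {l : ℝ} (hl : 0 < l) (F : H) : l * ‖hG.resolvent hl F‖ ≤ ‖F‖ := by
  simpa using hG.norm_le (hG.resolvent_mem hl F) l

theorem resolvent_eq (hG : IsMDissipativeGraph G) {l : ℝ} (hl : 0 < l) {p : H × H} (hp : p ∈ G) :
    hG.resolvent hl ((l : ℂ) • p.1 - p.2) = p.1 :=
  hG.eq_of_resolvent_eq (p := (_, _)) (hG.resolvent_mem hl _) hp hl (sub_sub_cancel _ _)

theorem resolvent_apply_snd (hG : IsMDissipativeGraph G)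
    {l : ℝ} (hl : 0 < l) {p : H × H} (hp : p ∈ G) :
    hG.resolvent hl p.2 = (l : ℂ) • hG.resolvent hl p.1 - p.1 := by
  have h := hG.resolvent_eq hl hp
  rw [map_sub, map_smul] at h
  exact (sub_eq_iff_eq_add.2 (sub_eq_iff_eq_add'.1 h)).symm

/-- The resolvent at `l` maps the graph into itself. Applied to the graph point of the resolvent at
`k`, this gives a point whose image under `k - G` is the resolvent at `l` of `x`. -/
theorem resolvent_comm (hG : IsMDissipativeGraph G) {l k : ℝ} (hl : 0 < l) (hk : 0 < k) :
    Commute (hG.resolvent hl) (hG.resolvent hk) := by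
  ext x
  have h1 := hG.resolvent_mem hk x
  have h2 := hG.resolvent_apply_snd hl h1
  have h3 := hG.resolvent_mem hl (hG.resolvent hk x)
  rw [← h2] at h3
  have h4 := hG.resolvent_eq hk h3
  simp only [map_sub, map_smul, sub_sub_cancel] at h4
  exact h4.symm

/-- The Yosida approximation of `G`. -/
noncomputable def yosida (hG : IsMDissipativeGraph G) {l : ℝ} (hl : 0 < l) : H →L[ℂ] H :=
  (l : ℂ) • ((l : ℂ) • hG.resolvent hl - 1)

theorem yosida_apply (hG : IsMDissipativeGraph G) {l : ℝ} (hl : 0 < l) (x : H) :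
    hG.yosida hl x = (l : ℂ) • ((l : ℂ) • hG.resolvent hl x - x) := rfl

theorem yosida_comm (hG : IsMDissipativeGraph G) {l k : ℝ} (hl : 0 < l) (hk : 0 < k) :
    Commute (hG.yosida hl) (hG.yosida hk) := by
  have h := hG.resolvent_comm hl hk
  unfold yosida
  exact ((((h.smul_left _).smul_right _).sub_left (Commute.one_left _)).sub_right
    (Commute.one_right _)).smul_left _ |>.smul_right _

theorem yosida_dissipative (hG : IsMDissipativeGraph G) {l : ℝ} (hl : 0 < l) (x : H) :
    (inner ℂ x (hG.yosida hl x)).re ≤ 0 := by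
  rw [yosida_apply, inner_smul_right, inner_sub_right, inner_smul_right,
    inner_self_eq_norm_sq_to_K]
  have h1 : (inner ℂ x (hG.resolvent hl x)).re ≤ ‖x‖ * ‖hG.resolvent hl x‖ :=
    (Complex.re_le_norm _).trans (norm_inner_le_norm _ _)
  have h2 := hG.norm_resolvent_le hl x
  have h3 : ((l : ℂ) * ((l : ℂ) * inner ℂ x (hG.resolvent hl x) - ((‖x‖ : ℝ) : ℂ) ^ 2)).re =
      l * (l * (inner ℂ x (hG.resolvent hl x)).re - ‖x‖ ^ 2) := by
    simp [← Complex.ofReal_pow]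
  refine h3.trans_le ?_
  refine mul_nonpos_of_nonneg_of_nonpos hl.le ?_
  nlinarith [norm_nonneg x]

theorem yosida_eq (hG : IsMDissipativeGraph G) {l : ℝ} (hl : 0 < l) {p : H × H} (hp : p ∈ G) :
    hG.yosida hl p.1 = (l : ℂ) • hG.resolvent hl p.2 := by
  rw [yosida_apply, hG.resolvent_apply_snd hl hp]

/-- On the domain, `l R_l p.1 - p.1 = R_l p.2` has norm at most `‖p.2‖ / l`. The maps `l R_l` are
contractions, so density extends the convergence to every vector. -/
theorem tendsto_smul_resolvent (hG : IsMDissipativeGraph G) [CompleteSpace H] (x : H) :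
    Tendsto (fun n : ℕ => ((n + 1 : ℝ) : ℂ) • hG.resolvent (Nat.cast_add_one_pos n) x) atTop
      (𝓝 x) := by
  rw [Metric.tendsto_atTop]
  intro ε hε
  obtain ⟨U, hU, hUx⟩ := hG.dense_domain.exists_dist_lt x (show 0 < ε / 3 by positivity)
  obtain ⟨p, hp, rfl⟩ := hU
  have h0 : Tendsto (fun n : ℕ => ‖p.2‖ / ((n : ℝ) + 1)) atTop (𝓝 0) :=
    by simpa [div_eq_mul_inv] using (tendsto_one_div_add_atTop_nhds_zero_nat (𝕜 := ℝ)).const_mul ‖p.2‖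
  obtain ⟨N, hN⟩ := eventually_atTop.1 (h0.eventually (gt_mem_nhds (show 0 < ε / 3 by positivity)))
  refine ⟨N, fun n hn => ?_⟩
  have hl : (0 : ℝ) < n + 1 := Nat.cast_add_one_pos n
  have h1 := hG.resolvent_apply_snd hl hp
  have h2 : ‖hG.resolvent hl p.2‖ ≤ ‖p.2‖ / (n + 1) := by
    rw [le_div_iff₀ hl, mul_comm]
    exact hG.norm_resolvent_le hl p.2
  have h3 : ‖((n + 1 : ℝ) : ℂ) • hG.resolvent hl (x - p.1)‖ ≤ ‖x - p.1‖ := by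
    rw [norm_smul, Complex.norm_real, Real.norm_of_nonneg hl.le]
    exact hG.norm_resolvent_le hl _
  have h4 : ((n + 1 : ℝ) : ℂ) • hG.resolvent hl x - x =
      ((n + 1 : ℝ) : ℂ) • hG.resolvent hl (x - p.1) + (hG.resolvent hl p.2 - (x - p.1)) := by
    rw [h1, map_sub, smul_sub]
    abel
  have h5 : ‖x - p.1‖ < ε / 3 := by
    rw [← dist_eq_norm]
    exact hUx
  rw [dist_eq_norm, h4]
  have h6 := norm_add_le (((n + 1 : ℝ) : ℂ) • hG.resolvent hl (x - p.1))
    (hG.resolvent hl p.2 - (x - p.1))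
  have h7 := norm_sub_le (hG.resolvent hl p.2) (x - p.1)
  have h8 := hN n hn
  linarith

theorem tendsto_yosida (hG : IsMDissipativeGraph G) [CompleteSpace H] {p : H × H} (hp : p ∈ G) :
    Tendsto (fun n : ℕ => hG.yosida (Nat.cast_add_one_pos n) p.1) atTop (𝓝 p.2) := by
  simp_rw [hG.yosida_eq _ hp]
  exact hG.tendsto_smul_resolvent p.2

end IsMDissipativeGraph

/-! ### Exponentials of bounded dissipative operators. -/

section Exp

variable [CompleteSpace H]

theorem hasDerivAt_exp_smul_apply (A : H →L[ℂ] H) (x : H) (t : ℝ) :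
    HasDerivAt (fun s : ℝ => NormedSpace.exp (s • A) x) (A (NormedSpace.exp (t • A) x)) t :=
  HasFDerivAt.comp_hasDerivAt (l := (ContinuousLinearMap.apply ℂ H x).restrictScalars ℝ)
    (l' := (ContinuousLinearMap.apply ℂ H x).restrictScalars ℝ) t
    (ContinuousLinearMap.hasFDerivAt _) (hasDerivAt_exp_smul_const' (𝕂 := ℝ) A t)

theorem norm_exp_smul_apply_le {A : H →L[ℂ] H} (hA : ∀ x, (inner ℂ x (A x)).re ≤ 0) {t : ℝ}
    (ht : 0 ≤ t) (x : H) : ‖NormedSpace.exp (t • A) x‖ ≤ ‖x‖ := by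
  have h := antitoneOn_norm_of_dissipative (w := fun s : ℝ => NormedSpace.exp (s • A) x)
    (fun s _ => (hasDerivAt_exp_smul_apply A x s).hasDerivWithinAt) (fun s _ => hA _)
    self_mem_Ici ht ht
  simpa using h

/-- Interpolate by `s ↦ e^{sA} e^{(t-s)B} x`. Since `A` and `B` commute, its derivative is `e^{sA}
e^{(t-s)B} (A - B) x`, two contractions applied to `(A - B) x`. -/
theorem norm_exp_sub_exp_le {A B : H →L[ℂ] H} (hA : ∀ x, (inner ℂ x (A x)).re ≤ 0)
    (hB : ∀ x, (inner ℂ x (B x)).re ≤ 0) (hAB : Commute A B) {t : ℝ} (ht : 0 ≤ t) (x : H) :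
    ‖NormedSpace.exp (t • A) x - NormedSpace.exp (t • B) x‖ ≤ ‖A x - B x‖ * t := by
  have hd : ∀ s : ℝ, HasDerivAt
      (fun s : ℝ => (NormedSpace.exp (s • A) * NormedSpace.exp ((t - s) • B)) x)
      (NormedSpace.exp (s • A) (NormedSpace.exp ((t - s) • B) ((A - B) x))) s := by
    intro s
    have h1 := hasDerivAt_exp_smul_const (𝕂 := ℝ) A s
    have h2 : HasDerivAt (fun s : ℝ => NormedSpace.exp ((t - s) • B))
        (-(B * NormedSpace.exp ((t - s) • B))) s := by
      have := (hasDerivAt_exp_smul_const' (𝕂 := ℝ) B (t - s)).scomp s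
        ((hasDerivAt_id s).const_sub t)
      rw [neg_one_smul] at this
      exact this
    have h3 := (((ContinuousLinearMap.apply ℂ H x).restrictScalars ℝ).hasFDerivAt
      (x := NormedSpace.exp (s • A) * NormedSpace.exp ((t - s) • B))).comp_hasDerivAt s (h1.mul h2)
    refine h3.congr_deriv ?_
    have hA' : Commute A (NormedSpace.exp ((t - s) • B)) :=
      (hAB.smul_right _).exp_right
    have hB' : Commute B (NormedSpace.exp ((t - s) • B)) :=
      ((Commute.refl B).smul_right _).exp_right
    have h4 : NormedSpace.exp (s • A) * A * NormedSpace.exp ((t - s) • B) +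
        NormedSpace.exp (s • A) * -(B * NormedSpace.exp ((t - s) • B)) =
        NormedSpace.exp (s • A) * (NormedSpace.exp ((t - s) • B) * (A - B)) := by
      rw [mul_assoc, hA'.eq, hB'.eq, mul_sub, mul_sub, mul_neg, ← sub_eq_add_neg]
    rw [h4]
    rfl
  have h := Convex.norm_image_sub_le_of_norm_hasDerivWithin_le (𝕜 := ℝ) (s := Icc 0 t)
    (C := ‖A x - B x‖) (x := 0) (y := t) (fun s _ => (hd s).hasDerivWithinAt) (fun s hs => ?_)
    (convex_Icc 0 t) (left_mem_Icc.2 ht) (right_mem_Icc.2 ht)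
  · simpa [abs_of_nonneg ht] using h
  · refine (norm_exp_smul_apply_le hA hs.1 _).trans ?_
    exact norm_exp_smul_apply_le hB (by linarith [hs.2]) _

/-- A first-order expansion at `t = 0` whose error can be made uniform along Yosida approximations.
There `y` is the limit of `A x` and need not lie in the domain, so a nearby domain element `z`, on
which `A z` stays bounded, controls `e^{sA} y - y`. -/
theorem norm_exp_apply_sub_sub_le {A : H →L[ℂ] H} (hA : ∀ x, (inner ℂ x (A x)).re ≤ 0) {t : ℝ}
    (ht : 0 ≤ t) (x y z : H) : ‖NormedSpace.exp (t • A) x - x - t • y‖ ≤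
      (‖A x - y‖ + 2 * ‖y - z‖ + t * ‖A z‖) * t := by
  have hz : ∀ s, 0 ≤ s → ‖NormedSpace.exp (s • A) z - z‖ ≤ s * ‖A z‖ := by
    intro s hs
    have := norm_exp_sub_exp_le (B := 0) hA (by simp) (Commute.zero_right A) hs z
    simpa [mul_comm] using this
  have hd : ∀ s : ℝ, HasDerivAt (fun s : ℝ => NormedSpace.exp (s • A) x - s • y)
      (NormedSpace.exp (s • A) (A x) - y) s := by
    intro s
    have h1 := (hasDerivAt_exp_smul_apply A x s).sub ((hasDerivAt_id s).smul_const y)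
    have hA' : Commute A (NormedSpace.exp (s • A)) := ((Commute.refl A).smul_right _).exp_right
    refine h1.congr_deriv ?_
    have h2 := DFunLike.congr_fun hA'.eq x
    simp only [mul_apply_eq_comp] at h2
    rw [h2, one_smul]
  have h := Convex.norm_image_sub_le_of_norm_hasDerivWithin_le (𝕜 := ℝ) (s := Icc 0 t)
    (C := ‖A x - y‖ + 2 * ‖y - z‖ + t * ‖A z‖) (x := 0) (y := t)
    (fun s _ => (hd s).hasDerivWithinAt) (fun s hs => ?_)
    (convex_Icc 0 t) (left_mem_Icc.2 ht) (right_mem_Icc.2 ht)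
  · have h2 : NormedSpace.exp (t • A) x - x - t • y = NormedSpace.exp (t • A) x - t • y - x := by
      abel
    rw [h2]
    simpa [abs_of_nonneg ht] using h
  · have h1 : NormedSpace.exp (s • A) (A x) - y = NormedSpace.exp (s • A) (A x - y) +
        (NormedSpace.exp (s • A) (y - z) + ((NormedSpace.exp (s • A) z - z) + (z - y))) := by
      simp only [map_sub]
      abel
    rw [h1]
    have h2 := norm_exp_smul_apply_le hA hs.1 (A x - y)
    have h3 := norm_exp_smul_apply_le hA hs.1 (y - z)
    have h4 := hz s hs.1
    have h5 : s * ‖A z‖ ≤ t * ‖A z‖ := mul_le_mul_of_nonneg_right hs.2 (norm_nonneg _)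
    rw [norm_sub_rev y z] at h3 ⊢
    refine (norm_add_le _ _).trans ?_
    refine (add_le_add_right ((norm_add_le _ _).trans
      (add_le_add_right (norm_add_le _ _) _)) _).trans ?_
    linarith

end Exp

end AbstractSemigroup

/-! ### Contraction semigroups, their generators and classical solutions. -/

section Generation

variable {H : Type*} [NormedAddCommGroup H] [InnerProductSpace ℂ H]

theorem IsContractionSemigroup.norm_apply_le {T : ℝ → H →L[ℂ] H} (hT : IsContractionSemigroup T)
    {t : ℝ} (ht : 0 ≤ t) (x : H) : ‖T t x‖ ≤ ‖x‖ := by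
  simpa using (T t).le_of_opNorm_le (hT.contraction t ht) x

/-- A contraction semigroup whose generator extends an m-dissipative operator is generated by
it. -/
theorem IsContractionSemigroup.mem_graph_iff {T : ℝ → H →L[ℂ] H} (hT : IsContractionSemigroup T)
    {G : Submodule ℂ (H × H)} (hG : IsMDissipativeGraph G)
    (h : ∀ p ∈ G, Tendsto (fun t : ℝ => ((t⁻¹ : ℝ) : ℂ) • (T t p.1 - p.1)) (𝓝[>] 0) (𝓝 p.2))
    (U F : H) : (U, F) ∈ G ↔
      Tendsto (fun t : ℝ => ((t⁻¹ : ℝ) : ℂ) • (T t U - U)) (𝓝[>] 0) (𝓝 F) := by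
  refine ⟨fun hp => h _ hp, fun hF => ?_⟩
  -- With `p.1 - p.2 = U - F`, the vector `U - p.1` is sent to itself by the generator of `T`. That
  -- generator is dissipative because `T` contracts, so `‖U - p.1‖² ≤ 0`.
  obtain ⟨p, hp, hpe⟩ := hG.range 1 one_pos (U - F)
  rw [Complex.ofReal_one, one_smul] at hpe
  have h1 : Tendsto (fun t : ℝ => ((t⁻¹ : ℝ) : ℂ) • (T t (U - p.1) - (U - p.1))) (𝓝[>] 0)
      (𝓝 (U - p.1)) := by
    have h2 := hF.sub (h p hp)
    have h3 : F - p.2 = U - p.1 := by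
      rw [sub_eq_sub_iff_add_eq_add] at hpe ⊢
      rw [add_comm, hpe, add_comm]
    rw [h3] at h2
    refine h2.congr fun t => ?_
    rw [map_sub, ← smul_sub]
    congr 1
    abel
  have h4 : (inner ℂ (U - p.1) (U - p.1)).re ≤ 0 := by
    have h5 : Tendsto (fun t : ℝ => (inner ℂ (U - p.1)
        (((t⁻¹ : ℝ) : ℂ) • (T t (U - p.1) - (U - p.1)))).re) (𝓝[>] 0)
        (𝓝 (inner ℂ (U - p.1) (U - p.1)).re) :=
      (Complex.continuous_re.tendsto _).comp (tendsto_const_nhds.inner h1)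
    refine le_of_tendsto h5 ?_
    filter_upwards [self_mem_nhdsWithin] with t ht
    rw [inner_smul_right, inner_sub_right, inner_self_eq_norm_sq_to_K, Complex.re_ofReal_mul]
    refine mul_nonpos_of_nonneg_of_nonpos (inv_nonneg.2 (le_of_lt ht)) ?_
    have h6 : (inner ℂ (U - p.1) (T t (U - p.1))).re ≤ ‖U - p.1‖ * ‖T t (U - p.1)‖ :=
      (Complex.re_le_norm _).trans (norm_inner_le_norm _ _)
    have h7 := hT.norm_apply_le (le_of_lt ht) (U - p.1)
    have h8 : (inner ℂ (U - p.1) (T t (U - p.1)) - ((‖U - p.1‖ : ℝ) : ℂ) ^ 2).re =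
        (inner ℂ (U - p.1) (T t (U - p.1))).re - ‖U - p.1‖ ^ 2 := by
      simp [← Complex.ofReal_pow]
    refine h8.trans_le ?_
    nlinarith [norm_nonneg (U - p.1)]
  have h9 : U = p.1 := by
    rw [inner_self_eq_norm_sq_to_K] at h4
    have h5 : ‖U - p.1‖ ^ 2 ≤ 0 := by simpa [← Complex.ofReal_pow] using h4
    simpa [sub_eq_zero] using h5.antisymm (sq_nonneg _)
  have h10 : F = p.2 := by rw [h9] at hpe; simpa using hpe.symm
  rw [h9, h10]
  exact hp

/-- Orbits that start in the domain of the generator are differentiable. -/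
theorem IsContractionSemigroup.hasDerivWithinAt {T : ℝ → H →L[ℂ] H}
    (hT : IsContractionSemigroup T) {U F : H}
    (h : Tendsto (fun t : ℝ => ((t⁻¹ : ℝ) : ℂ) • (T t U - U)) (𝓝[>] 0) (𝓝 F)) {t : ℝ}
    (ht : 0 ≤ t) : HasDerivWithinAt (fun s => T s U) (T t F) (Ici 0) t := by
  rw [hasDerivWithinAt_iff_tendsto_slope]
  have hsplit : Ici (0 : ℝ) \ {t} = Ico 0 t ∪ Ioi t := by
    ext s
    simp only [Set.mem_sdiff, mem_Ici, mem_singleton_iff, mem_union, mem_Ico, mem_Ioi]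
    constructor
    · rintro ⟨h1, h2⟩
      rcases lt_or_gt_of_ne h2 with h3 | h3
      exacts [Or.inl ⟨h1, h3⟩, Or.inr h3]
    · rintro (⟨h1, h2⟩ | h2)
      exacts [⟨h1, h2.ne⟩, ⟨ht.trans h2.le, h2.ne'⟩]
  rw [hsplit, nhdsWithin_union, tendsto_sup]
  constructor
  -- Left derivative: the slope is `T s` applied to the difference quotient of `U` over the time `t
  -- - s`. Contractivity of `T s` replaces that quotient by `F`, and `T s F → T t F` by strong
  -- continuity.
  · have hr : Tendsto (fun s => t - s) (𝓝[Ico 0 t] t) (𝓝[>] 0) := by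
      refine tendsto_nhdsWithin_iff.2 ⟨?_, ?_⟩
      · have : Tendsto (fun s : ℝ => t - s) (𝓝 t) (𝓝 (t - t)) :=
          (continuous_const.sub continuous_id).tendsto t
        rw [sub_self] at this
        exact this.mono_left nhdsWithin_le_nhds
      · filter_upwards [self_mem_nhdsWithin] with s hs
        exact sub_pos.2 hs.2
    have h1 := h.comp hr
    have h2 : Tendsto (fun s => T s F) (𝓝[Ico 0 t] t) (𝓝 (T t F)) :=
      (hT.continuous F t ht).mono_left (nhdsWithin_mono _ Ico_subset_Ici_self)
    refine tendsto_of_tendsto_of_dist h2 ?_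
    have h3 : Tendsto (fun s => ‖((((t - s)⁻¹ : ℝ) : ℂ) • (T (t - s) U - U)) - F‖)
        (𝓝[Ico 0 t] t) (𝓝 0) := by
      simpa using (h1.sub_const F).norm
    refine squeeze_zero' (Eventually.of_forall fun _ => dist_nonneg) ?_ h3
    filter_upwards [self_mem_nhdsWithin] with s hs
    have h4 : T t U = T s (T (t - s) U) := by
      rw [← ContinuousLinearMap.comp_apply, ← hT.add s (t - s) hs.1 (by linarith [hs.2])]
      congr 2
      ring
    have h5 : slope (fun s => T s U) t s =
        T s ((((t - s)⁻¹ : ℝ) : ℂ) • (T (t - s) U - U)) := by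
      rw [slope_def_module, map_smul, map_sub, ← h4, Complex.coe_smul, ← neg_sub t s, inv_neg,
        neg_smul, ← smul_neg, neg_sub]
    rw [h5, dist_eq_norm, norm_sub_rev, ← map_sub]
    exact hT.norm_apply_le hs.1 _
  · have hr : Tendsto (fun s => s - t) (𝓝[>] t) (𝓝[>] 0) := by
      refine tendsto_nhdsWithin_iff.2 ⟨?_, ?_⟩
      · have : Tendsto (fun s : ℝ => s - t) (𝓝 t) (𝓝 (t - t)) :=
          (continuous_id.sub continuous_const).tendsto t
        rw [sub_self] at this
        exact this.mono_left nhdsWithin_le_nhds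
      · filter_upwards [self_mem_nhdsWithin] with s hs
        exact sub_pos.2 (mem_Ioi.1 hs)
    have h1 := ((T t).continuous.tendsto F).comp (h.comp hr)
    refine h1.congr' ?_
    filter_upwards [self_mem_nhdsWithin] with s hs
    have h4 : T s U = T t (T (s - t) U) := by
      rw [← ContinuousLinearMap.comp_apply, ← hT.add t (s - t) ht (sub_nonneg.2 (le_of_lt hs))]
      congr 2
      ring
    simp only [Function.comp_apply]
    rw [slope_def_module, map_smul, map_sub, ← h4, Complex.coe_smul]

/-- The domain of the generator is invariant, and the generator commutes with the semigroup. -/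
theorem IsContractionSemigroup.tendsto_apply {T : ℝ → H →L[ℂ] H}
    (hT : IsContractionSemigroup T) {U F : H}
    (h : Tendsto (fun t : ℝ => ((t⁻¹ : ℝ) : ℂ) • (T t U - U)) (𝓝[>] 0) (𝓝 F)) {t : ℝ}
    (ht : 0 ≤ t) :
    Tendsto (fun s : ℝ => ((s⁻¹ : ℝ) : ℂ) • (T s (T t U) - T t U)) (𝓝[>] 0) (𝓝 (T t F)) := by
  refine (((T t).continuous.tendsto F).comp h).congr' ?_
  filter_upwards [self_mem_nhdsWithin] with s hs
  have h1 : T s (T t U) = T t (T s U) := by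
    rw [← ContinuousLinearMap.comp_apply, ← ContinuousLinearMap.comp_apply,
      ← hT.add s t (le_of_lt hs) ht, ← hT.add t s ht (le_of_lt hs), add_comm]
  simp only [Function.comp_apply]
  rw [map_smul, map_sub, h1]

/-- Existence and uniqueness of classical solutions. -/
theorem IsGenerator.isClassicalSolution {A : H →ₗ.[ℂ] H} {T : ℝ → H →L[ℂ] H}
    (hA : IsMDissipative A) (hT : IsContractionSemigroup T) (hAT : IsGenerator A T) {U₀ : H}
    (hU₀ : U₀ ∈ A.domain) :
    IsClassicalSolution A U₀ (fun t => T t U₀) ∧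
      ∀ U : ℝ → H, IsClassicalSolution A U₀ U → EqOn U (fun t => T t U₀) (Ici 0) := by
  have hmem : (U₀, A ⟨U₀, hU₀⟩) ∈ A.graph := A.mem_graph ⟨U₀, hU₀⟩
  have hlim := (hAT _ _).1 hmem
  have hsol : ∀ t, 0 ≤ t → HasDerivWithinAt (fun s => T s U₀) (T t (A ⟨U₀, hU₀⟩)) (Ici 0) t ∧
      (T t U₀, T t (A ⟨U₀, hU₀⟩)) ∈ A.graph := fun t ht =>
    ⟨hT.hasDerivWithinAt hlim ht, (hAT _ _).2 (hT.tendsto_apply hlim ht)⟩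
  refine ⟨⟨by simp [hT.zero], fun t => T t (A ⟨U₀, hU₀⟩), hT.continuous _, hsol⟩, ?_⟩
  rintro U ⟨hU0, U', -, hU⟩ t ht
  -- The difference of two solutions solves the equation with initial value zero, and its norm
  -- cannot grow.
  have h := antitoneOn_norm_of_dissipative (w := fun s => U s - T s U₀)
    (fun s hs => (hU s hs).1.sub (hsol s hs).1)
    (fun s hs => hA.graph.dissipative _ (A.graph.sub_mem (hU s hs).2 (hsol s hs).2))
    self_mem_Ici ht ht
  simpa [hU0, hT.zero, sub_eq_zero] using h

/-! ### The semigroup as the limit of the Yosida exponentials. -/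

namespace IsMDissipativeGraph

variable {G : Submodule ℂ (H × H)} [CompleteSpace H]

/-- The semigroups generated by the Yosida approximations. -/
noncomputable def approx (hG : IsMDissipativeGraph G) (n : ℕ) (t : ℝ) : H →L[ℂ] H :=
  NormedSpace.exp (t • hG.yosida (Nat.cast_add_one_pos (α := ℝ) n))

theorem norm_approx_le (hG : IsMDissipativeGraph G)
    (n : ℕ) {t : ℝ} (ht : 0 ≤ t) (x : H) : ‖hG.approx n t x‖ ≤ ‖x‖ :=
  norm_exp_smul_apply_le (hG.yosida_dissipative _) ht x

/-- For `p` in the graph, two exponentials differ at `p.1` by at most `t` times the difference of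
the Yosida approximations at `p.1`, which converge. Contractivity and density pass to arbitrary `x`.
-/
theorem cauchySeq_approx (hG : IsMDissipativeGraph G) {t : ℝ} (ht : 0 ≤ t) (x : H) :
    CauchySeq (fun n => hG.approx n t x) := by
  rw [Metric.cauchySeq_iff]
  intro ε hε
  obtain ⟨_, ⟨p, hp, rfl⟩, hpx⟩ := hG.dense_domain.exists_dist_lt x (show 0 < ε / 4 by positivity)
  have hpx' : ‖x - p.1‖ < ε / 4 := by rw [← dist_eq_norm]; exact hpx
  obtain ⟨N, hN⟩ := Metric.cauchySeq_iff.1 (hG.tendsto_yosida hp).cauchySeq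
    (ε / (4 * (t + 1))) (by positivity)
  refine ⟨N, fun n hn k hk => ?_⟩
  have h1 := norm_exp_sub_exp_le (hG.yosida_dissipative (Nat.cast_add_one_pos n))
    (hG.yosida_dissipative (Nat.cast_add_one_pos k)) (hG.yosida_comm _ _) ht p.1
  have h2 := hN n hn k hk
  rw [dist_eq_norm] at h2
  have h3 : ‖hG.yosida (Nat.cast_add_one_pos (α := ℝ) n) p.1 -
      hG.yosida (Nat.cast_add_one_pos (α := ℝ) k) p.1‖ * t ≤ ε / 4 := by
    refine (mul_le_mul_of_nonneg_right h2.le ht).trans ?_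
    rw [div_mul_eq_mul_div, div_le_div_iff₀ (by positivity) (by positivity)]
    nlinarith
  have h4 := hG.norm_approx_le n ht (x - p.1)
  have h5 := hG.norm_approx_le k ht (x - p.1)
  have h6 : hG.approx n t x - hG.approx k t x = hG.approx n t (x - p.1) +
      ((hG.approx n t p.1 - hG.approx k t p.1) - hG.approx k t (x - p.1)) := by
    simp only [map_sub]
    abel
  rw [dist_eq_norm, h6]
  refine (norm_add_le _ _).trans_lt ?_
  have h7 := norm_sub_le (hG.approx n t p.1 - hG.approx k t p.1) (hG.approx k t (x - p.1))
  have h8 : ‖hG.approx n t p.1 - hG.approx k t p.1‖ ≤ ε / 4 := h1.trans h3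
  linarith

/-- The approximants are uniformly bounded only for nonnegative times; `max t 0` makes the limit
available for every real `t`. -/
theorem exists_tendsto_approx (hG : IsMDissipativeGraph G) (t : ℝ) (x : H) :
    ∃ y, Tendsto (fun n => hG.approx n (max t 0) x) atTop (𝓝 y) :=
  cauchySeq_tendsto_of_complete (hG.cauchySeq_approx (le_max_right _ _) x)

/-- The semigroup generated by `G` (constant for negative times). -/
noncomputable def semigroup (hG : IsMDissipativeGraph G) (t : ℝ) : H →L[ℂ] H :=
  continuousLinearMapOfTendsto (fun n => hG.approx n (max t 0))
    (f := fun x => (hG.exists_tendsto_approx t x).choose)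
    (l := atTop) (tendsto_pi_nhds.2 fun x => (hG.exists_tendsto_approx t x).choose_spec)

theorem tendsto_approx (hG : IsMDissipativeGraph G) {t : ℝ} (ht : 0 ≤ t) (x : H) :
    Tendsto (fun n => hG.approx n t x) atTop (𝓝 (hG.semigroup t x)) := by
  have h : Tendsto (fun n => hG.approx n (max t 0) x) atTop (𝓝 (hG.semigroup t x)) :=
    (hG.exists_tendsto_approx t x).choose_spec
  rwa [max_eq_left ht] at h

theorem norm_semigroup_le (hG : IsMDissipativeGraph G)
    {t : ℝ} (ht : 0 ≤ t) (x : H) : ‖hG.semigroup t x‖ ≤ ‖x‖ :=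
  le_of_tendsto (hG.tendsto_approx ht x).norm
    (Eventually.of_forall fun n => hG.norm_approx_le n ht x)

theorem semigroup_zero (hG : IsMDissipativeGraph G)
    : hG.semigroup 0 = ContinuousLinearMap.id ℂ H := by
  ext x
  refine tendsto_nhds_unique (hG.tendsto_approx le_rfl x) ?_
  simp [approx]

theorem semigroup_add (hG : IsMDissipativeGraph G) {s t : ℝ} (hs : 0 ≤ s) (ht : 0 ≤ t) :
    hG.semigroup (s + t) = (hG.semigroup s).comp (hG.semigroup t) := by
  ext x
  refine tendsto_nhds_unique (hG.tendsto_approx (add_nonneg hs ht) x) ?_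
  rw [ContinuousLinearMap.comp_apply]
  refine tendsto_of_tendsto_of_dist (hG.tendsto_approx hs _) ?_
  have h1 : Tendsto (fun n => ‖hG.semigroup t x - hG.approx n t x‖) atTop (𝓝 0) := by
    simpa using ((hG.tendsto_approx ht x).const_sub (hG.semigroup t x)).norm
  refine squeeze_zero (fun _ => dist_nonneg) (fun n => ?_) h1
  have h2 : hG.approx n (s + t) = hG.approx n s * hG.approx n t := by
    unfold approx
    let _ : NormedAlgebra ℚ (H →L[ℂ] H) := NormedAlgebra.restrictScalars ℚ ℝ _
    rw [add_smul, NormedSpace.exp_add_of_commute]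
    exact ((Commute.refl _).smul_left _).smul_right _
  rw [h2, dist_eq_norm, mul_apply_eq_comp, ← map_sub]
  exact hG.norm_approx_le n hs _

/-- The limit of `norm_exp_apply_sub_sub_le` along the Yosida approximations. Choosing `r.1` close
to `p.2` and afterwards `t` small shows that the orbit has derivative `p.2` at `0`. -/
theorem norm_semigroup_sub_sub_le (hG : IsMDissipativeGraph G)
    {p r : H × H} (hp : p ∈ G) (hr : r ∈ G) {t : ℝ} (ht : 0 ≤ t) :
    ‖hG.semigroup t p.1 - p.1 - t • p.2‖ ≤ (2 * ‖p.2 - r.1‖ + t * ‖r.2‖) * t := by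
  have h1 : Tendsto (fun n => ‖hG.approx n t p.1 - p.1 - t • p.2‖) atTop
      (𝓝 ‖hG.semigroup t p.1 - p.1 - t • p.2‖) :=
    (((hG.tendsto_approx ht p.1).sub_const _).sub_const _).norm
  have h2 : Tendsto (fun n : ℕ => (‖hG.yosida (Nat.cast_add_one_pos (α := ℝ) n) p.1 - p.2‖ +
      2 * ‖p.2 - r.1‖ + t * ‖hG.yosida (Nat.cast_add_one_pos (α := ℝ) n) r.1‖) * t) atTop
      (𝓝 ((0 + 2 * ‖p.2 - r.1‖ + t * ‖r.2‖) * t)) := by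
    have h3 : Tendsto (fun n : ℕ => ‖hG.yosida (Nat.cast_add_one_pos (α := ℝ) n) p.1 - p.2‖)
        atTop (𝓝 0) := by
      simpa using ((hG.tendsto_yosida hp).sub_const p.2).norm
    exact ((h3.add_const _).add ((hG.tendsto_yosida hr).norm.const_mul t)).mul_const t
  rw [zero_add] at h2
  exact le_of_tendsto_of_tendsto' h1 h2 fun n =>
    norm_exp_apply_sub_sub_le (hG.yosida_dissipative _) ht _ _ _

theorem tendsto_semigroup (hG : IsMDissipativeGraph G) {p : H × H} (hp : p ∈ G) :
    Tendsto (fun t : ℝ => ((t⁻¹ : ℝ) : ℂ) • (hG.semigroup t p.1 - p.1)) (𝓝[>] 0) (𝓝 p.2) := by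
  rw [Metric.tendsto_nhdsWithin_nhds]
  intro ε hε
  obtain ⟨_, ⟨r, hr, rfl⟩, hrx⟩ := hG.dense_domain.exists_dist_lt p.2 (show 0 < ε / 4 by positivity)
  have hrx' : ‖p.2 - r.1‖ < ε / 4 := by rw [← dist_eq_norm]; exact hrx
  refine ⟨ε / (2 * (‖r.2‖ + 1)), by positivity, fun t ht htd => ?_⟩
  have ht' : 0 < t := ht
  have h1 := hG.norm_semigroup_sub_sub_le hp hr ht'.le
  have h2 : ((t⁻¹ : ℝ) : ℂ) • (hG.semigroup t p.1 - p.1) - p.2 =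
      ((t⁻¹ : ℝ) : ℂ) • (hG.semigroup t p.1 - p.1 - t • p.2) := by
    rw [smul_sub _ _ (t • p.2), Complex.coe_smul, Complex.coe_smul, smul_smul,
      inv_mul_cancel₀ ht'.ne', one_smul]
  rw [dist_eq_norm, h2, norm_smul, Complex.norm_real, norm_inv, Real.norm_of_nonneg ht'.le,
    inv_mul_lt_iff₀ ht']
  refine h1.trans_lt ?_
  rw [mul_comm]
  refine mul_lt_mul_of_pos_left ?_ ht'
  rw [Real.dist_eq, sub_zero, abs_of_pos ht', lt_div_iff₀ (by positivity)] at htd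
  nlinarith [norm_nonneg r.2]

theorem continuousOn_semigroup (hG : IsMDissipativeGraph G)
    (x : H) : ContinuousOn (fun t => hG.semigroup t x) (Ici 0) := by
  -- Lipschitz continuity of the orbits that start in the domain
  have hlip : ∀ p ∈ G, ∀ s, 0 ≤ s → ∀ t, 0 ≤ t →
      ‖hG.semigroup s p.1 - hG.semigroup t p.1‖ ≤ ‖p.2‖ * |s - t| := by
    intro p hp
    have hbase : ∀ h, 0 ≤ h → ‖hG.semigroup h p.1 - p.1‖ ≤ ‖p.2‖ * h := by
      intro h hh
      have h1 : Tendsto (fun n => ‖hG.approx n h p.1 - p.1‖) atTop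
        (𝓝 ‖hG.semigroup h p.1 - p.1‖) := ((hG.tendsto_approx hh p.1).sub_const _).norm
      refine le_of_tendsto_of_tendsto' h1 ((hG.tendsto_yosida hp).norm.mul_const h) fun n => ?_
      -- Comparison with the constant semigroup, the exponential of `B = 0`.
      have := norm_exp_sub_exp_le (B := 0) (hG.yosida_dissipative (Nat.cast_add_one_pos n))
        (by simp) (Commute.zero_right _) hh p.1
      simpa [approx] using this
    have hmono : ∀ s, 0 ≤ s → ∀ t, s ≤ t →
        ‖hG.semigroup s p.1 - hG.semigroup t p.1‖ ≤ ‖p.2‖ * (t - s) := by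
      intro s hs t hst
      have h1 : hG.semigroup t p.1 = hG.semigroup s (hG.semigroup (t - s) p.1) := by
        rw [← ContinuousLinearMap.comp_apply, ← hG.semigroup_add hs (sub_nonneg.2 hst)]
        congr 2
        ring
      rw [h1, ← map_sub]
      refine (hG.norm_semigroup_le hs _).trans ?_
      rw [norm_sub_rev]
      exact hbase _ (sub_nonneg.2 hst)
    intro s hs t ht
    rcases le_total s t with h | h
    · rw [abs_sub_comm, abs_of_nonneg (sub_nonneg.2 h)]
      exact hmono s hs t h
    · rw [abs_of_nonneg (sub_nonneg.2 h), norm_sub_rev]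
      exact hmono t ht s h
  intro t ht
  rw [Metric.continuousWithinAt_iff]
  intro ε hε
  obtain ⟨_, ⟨p, hp, rfl⟩, hpx⟩ := hG.dense_domain.exists_dist_lt x (show 0 < ε / 4 by positivity)
  have hpx' : ‖x - p.1‖ < ε / 4 := by rw [← dist_eq_norm]; exact hpx
  refine ⟨ε / (2 * (‖p.2‖ + 1)), by positivity, fun s hs hst => ?_⟩
  have h1 := hlip p hp s hs t ht
  have h2 := hG.norm_semigroup_le hs (x - p.1)
  have h3 := hG.norm_semigroup_le ht (x - p.1)
  have h4 : hG.semigroup s x - hG.semigroup t x = hG.semigroup s (x - p.1) +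
      ((hG.semigroup s p.1 - hG.semigroup t p.1) - hG.semigroup t (x - p.1)) := by
    simp only [map_sub]
    abel
  rw [Real.dist_eq, lt_div_iff₀ (by positivity)] at hst
  rw [dist_eq_norm, h4]
  refine (norm_add_le _ _).trans_lt ?_
  have h5 := norm_sub_le (hG.semigroup s p.1 - hG.semigroup t p.1) (hG.semigroup t (x - p.1))
  nlinarith [abs_nonneg (s - t)]

theorem isContractionSemigroup (hG : IsMDissipativeGraph G)
    : IsContractionSemigroup hG.semigroup where
  zero := hG.semigroup_zero
  add _ _ hs ht := hG.semigroup_add hs ht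
  continuous := hG.continuousOn_semigroup
  contraction t ht := ContinuousLinearMap.opNorm_le_bound _ zero_le_one fun x => by
    simpa using hG.norm_semigroup_le ht x

end IsMDissipativeGraph

end Generation

/-! ### Generation through a finer Hilbert norm. -/

section FinerNorm

variable {H K : Type*} [NormedAddCommGroup H] [InnerProductSpace ℂ H]
  [NormedAddCommGroup K] [InnerProductSpace ℂ K]

/-- The graph of `A - ω`, transported along `π`. -/
def shiftedGraph (A : H →ₗ.[ℂ] H) (π : K →L[ℂ] H) (ω : ℝ) : Submodule ℂ (K × K) where
  carrier := {p | (π p.1, π (p.2 + (ω : ℂ) • p.1)) ∈ A.graph}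
  zero_mem' := by
    have h := A.graph.zero_mem
    rw [mem_ofPred_eq, Prod.fst_zero, Prod.snd_zero, smul_zero, add_zero, map_zero]
    exact h
  add_mem' := by
    intro p p' hp hp'
    have := A.graph.add_mem hp hp'
    simp only [mem_ofPred_eq, Prod.fst_add, Prod.snd_add, smul_add, map_add, map_smul,
      Prod.mk_add_mk] at this ⊢
    convert! this using 2
    abel
  smul_mem' := by
    intro r p hp
    have := A.graph.smul_mem r hp
    simp only [mem_ofPred_eq, Prod.smul_fst, Prod.smul_snd, smul_add, map_add, map_smul,
      Prod.smul_mk] at this ⊢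
    convert! this using 3
    rw [smul_comm]

theorem mem_shiftedGraph {A : H →ₗ.[ℂ] H} {π : K →L[ℂ] H} {ω : ℝ} {p : K × K} :
    p ∈ shiftedGraph A π ω ↔ (π p.1, π (p.2 + (ω : ℂ) • p.1)) ∈ A.graph := Iff.rfl

/-- The range of `l - (A - ω)` is that of `(l + ω) - A`, a purely algebraic property that the change
of norm does not affect. Only dissipativity depends on the norm, and `hq` supplies it after the
shift. -/
theorem isMDissipativeGraph_shiftedGraph {A : H →ₗ.[ℂ] H} (hA : IsMDissipative A)
    {π : K →L[ℂ] H} (hπ : Function.Bijective π) {ω : ℝ} (hω : 0 ≤ ω)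
    (hq : ∀ x y : K, (π x, π y) ∈ A.graph → (inner ℂ x y).re ≤ ω * ‖x‖ ^ 2) :
    IsMDissipativeGraph (shiftedGraph A π ω) where
  dissipative p hp := by
    have h := hq _ _ hp
    rw [inner_add_right, inner_smul_right, inner_self_eq_norm_sq_to_K, Complex.add_re,
      Complex.re_ofReal_mul] at h
    have h1 : ((((‖p.1‖ : ℝ) : ℂ) ^ 2).re : ℝ) = ‖p.1‖ ^ 2 := by simp [← Complex.ofReal_pow]
    have h2 : (inner ℂ p.1 p.2).re + ω * ((((‖p.1‖ : ℝ) : ℂ) ^ 2).re) ≤ ω * ‖p.1‖ ^ 2 := h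
    rw [h1] at h2
    linarith
  range l hl F := by
    obtain ⟨p, hp, hpF⟩ := hA.graph.range (l + ω) (by positivity) (π F)
    obtain ⟨x, hx⟩ := hπ.2 p.1
    obtain ⟨y, hy⟩ := hπ.2 p.2
    refine ⟨(x, y - (ω : ℂ) • x), ?_, ?_⟩
    · rw [mem_shiftedGraph, sub_add_cancel, hx, hy]
      exact hp
    · apply hπ.1
      rw [← hpF, map_sub, map_sub, map_smul, map_smul, hx, hy]
      push_cast
      rw [add_smul]
      abel
  single_valued p hp h := by
    apply hπ.1
    have h1 := A.graph_fst_eq_zero_snd hp (by rw [h, map_zero])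
    simpa [h] using h1

/-- An m-dissipative operator on an inner product space `H` that is quasi-dissipative for a finer
Hilbert norm generates a contraction semigroup on `H`. -/
theorem IsMDissipative.exists_semigroup [CompleteSpace K] {A : H →ₗ.[ℂ] H}
    (hA : IsMDissipative A) {π : K →L[ℂ] H} (hπ : Function.Bijective π) {ω : ℝ} (hω : 0 ≤ ω)
    (hq : ∀ x y : K, (π x, π y) ∈ A.graph → (inner ℂ x y).re ≤ ω * ‖x‖ ^ 2) :
    Dense (A.domain : Set H) ∧ ∃ T : ℝ → H →L[ℂ] H, IsContractionSemigroup T ∧ IsGenerator A T := by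
  have hG := isMDissipativeGraph_shiftedGraph hA hπ hω hq
  have hS := hG.isContractionSemigroup
  have hSlim : ∀ p ∈ shiftedGraph A π ω, _ := fun p hp => hG.tendsto_semigroup hp
  have hSiff := hS.mem_graph_iff hG hSlim
  set S := hG.semigroup
  -- the orbits that start in the domain
  have hderiv : ∀ p ∈ shiftedGraph A π ω, ∀ t, 0 ≤ t →
      HasDerivWithinAt (fun s => π (Real.exp (ω * s) • S s p.1))
        (π (Real.exp (ω * t) • (S t p.2 + (ω : ℂ) • S t p.1))) (Ici 0) t := by
    intro p hp t ht
    have h1 := hS.hasDerivWithinAt (hSlim p hp) ht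
    have h2 : HasDerivAt (fun s : ℝ => Real.exp (ω * s)) (Real.exp (ω * t) * ω) t := by
      simpa using ((hasDerivAt_id t).const_mul ω).exp
    have h3 := h2.hasDerivWithinAt.smul h1 (s := Ici 0)
    have h4 := (((π.restrictScalars ℝ).hasFDerivAt
      (x := Real.exp (ω * t) • S t p.1))).comp_hasDerivWithinAt t h3
    refine h4.congr_deriv ?_
    rw [smul_add, Complex.coe_smul, smul_smul]
    rfl
  -- The factor `e^{ωt}` undoes the shift, so orbits from the domain solve `w' = A w` in `H`, where
  -- `A` itself is dissipative. The inequality is closed in the finer norm, and the domain is dense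
  -- there.
  have hbound : ∀ t, 0 ≤ t → ∀ x : K, ‖π (Real.exp (ω * t) • S t x)‖ ≤ ‖π x‖ := by
    intro t ht
    have hclosed : IsClosed {x : K | ‖π (Real.exp (ω * t) • S t x)‖ ≤ ‖π x‖} :=
      isClosed_le (by fun_prop) (by fun_prop)
    have hsub : (Submodule.map (LinearMap.fst ℂ K K) (shiftedGraph A π ω) : Set K) ⊆
        {x : K | ‖π (Real.exp (ω * t) • S t x)‖ ≤ ‖π x‖} := by
      rintro _ ⟨p, hp, rfl⟩
      have h := antitoneOn_norm_of_dissipative (hderiv p hp) (fun s hs => ?_) self_mem_Ici ht ht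
      · simpa [hS.zero] using h
      · have h1 := (hSiff _ _).2 (hS.tendsto_apply (hSlim p hp) hs)
        have h2 := A.graph.smul_mem ((Real.exp (ω * s) : ℝ) : ℂ) (mem_shiftedGraph.1 h1)
        have h3 := hA.graph.dissipative _ h2
        rw [Prod.smul_fst, Prod.smul_snd, ← map_smul π, ← map_smul π, Complex.coe_smul,
          Complex.coe_smul] at h3
        exact h3
    intro x
    exact hclosed.closure_subset_iff.2 hsub (hG.dense_domain x)
  have hdense : Dense (A.domain : Set H) := by
    have h1 : Dense (π '' (Submodule.map (LinearMap.fst ℂ K K) (shiftedGraph A π ω) : Set K)) :=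
      hπ.2.denseRange.dense_image π.continuous hG.dense_domain
    refine h1.mono ?_
    rintro _ ⟨_, ⟨p, hp, rfl⟩, rfl⟩
    exact A.mem_domain_of_mem_graph hp
  let e : K ≃ₗ[ℂ] H := LinearEquiv.ofBijective π.toLinearMap hπ
  have he : ∀ x, π (e.symm x) = x := fun x => e.apply_symm_apply x
  have hse : ∀ x, e.symm (π x) = x := fun x => e.symm_apply_apply x
  let T : ℝ → H →L[ℂ] H := fun t => LinearMap.mkContinuous
    (π.toLinearMap.comp (((Real.exp (ω * max t 0) : ℂ) • (S (max t 0)).toLinearMap).comp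
      e.symm.toLinearMap)) 1 (fun x => by
        have := hbound (max t 0) (le_max_right _ _) (e.symm x)
        rw [he, ← Complex.coe_smul] at this
        simpa using this)
  have hTx : ∀ t, 0 ≤ t → ∀ x, T t x = π (Real.exp (ω * t) • S t (e.symm x)) := by
    intro t ht x
    change π ((Real.exp (ω * max t 0) : ℂ) • S (max t 0) (e.symm x)) = _
    rw [max_eq_left ht, Complex.coe_smul]
  have hT : IsContractionSemigroup T := by
    refine ⟨?_, ?_, ?_, ?_⟩
    · ext x
      rw [hTx 0 le_rfl, hS.zero]
      simp [he]
    · intro s t hs ht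
      ext x
      rw [ContinuousLinearMap.comp_apply, hTx _ (add_nonneg hs ht), hTx t ht, hTx s hs, hse,
        hS.add s t hs ht, ContinuousLinearMap.comp_apply, mul_add, Real.exp_add, ← smul_smul]
      congr 2
      rw [← Complex.coe_smul, ← Complex.coe_smul, map_smul]
    · intro x
      have h1 : ContinuousOn (fun t => π (Real.exp (ω * t) • S t (e.symm x))) (Ici 0) := by
        have h2 : ContinuousOn (fun t : ℝ => Real.exp (ω * t)) (Ici 0) := by fun_prop
        exact π.continuous.comp_continuousOn (h2.smul (hS.continuous _))
      exact h1.congr fun t ht => hTx t ht x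
    · intro t ht
      exact LinearMap.mkContinuous_norm_le _ zero_le_one _
  -- It is enough that the generator of `T` extends `A`: the derivative at `0` of the orbits above
  -- gives this, and m-dissipativity of `A` in `H` excludes a proper extension.
  refine ⟨hdense, T, hT, hT.mem_graph_iff hA.graph fun p hp => ?_⟩
  have hp' : (e.symm p.1, e.symm p.2 - (ω : ℂ) • e.symm p.1) ∈ shiftedGraph A π ω := by
    rw [mem_shiftedGraph, sub_add_cancel, he, he]
    exact hp
  have h1 := hderiv _ hp' 0 le_rfl
  rw [hasDerivWithinAt_iff_tendsto_slope, Ici_sdiff_left] at h1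
  have h2 : π (Real.exp (ω * 0) • (S 0 (e.symm p.2 - (ω : ℂ) • e.symm p.1) +
      (ω : ℂ) • S 0 (e.symm p.1))) = p.2 := by
    rw [hS.zero]
    simp [he]
  rw [h2] at h1
  refine h1.congr' ?_
  filter_upwards [self_mem_nhdsWithin] with t ht
  rw [slope_def_module, hTx t (le_of_lt ht), hS.zero, Complex.coe_smul]
  simp [he]

end FinerNorm

/-! ### Calculus of locally absolutely continuous functions -/

section Calculus

variable {E : Type*} [NormedAddCommGroup E] [NormedSpace ℝ E]
  {E' : Type*} [NormedAddCommGroup E'] [NormedSpace ℝ E']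
  {E'' : Type*} [NormedAddCommGroup E''] [NormedSpace ℝ E'']
  {I J : Set ℝ} {F f : ℝ → E} {G g : ℝ → E'}

theorem _root_.IntervalIntegrable.mono_set_Icc {E : Type*} [NormedAddCommGroup E] {f : ℝ → E}
    {p q x y : ℝ} (hf : IntervalIntegrable f volume p q) (hpq : p ≤ q) (hx : x ∈ Icc p q)
    (hy : y ∈ Icc p q) : IntervalIntegrable f volume x y := by
  refine hf.mono_set ?_
  rw [uIcc_of_le hpq]
  exact OrdConnected.uIcc_subset inferInstance hx hy

theorem isPrimitiveOn_integral (hf : ∀ x ∈ I, ∀ y ∈ I, IntervalIntegrable f volume x y) {c : ℝ}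
    (hc : c ∈ I) (e : E) : IsPrimitiveOn I (fun x => e + ∫ t in c..x, f t) f := fun x hx y hy =>
  ⟨hf x hx y hy, by
    rw [add_sub_add_left_eq_sub,
      intervalIntegral.integral_interval_sub_left (hf c hc y hy) (hf c hc x hx)]⟩

/-- The increments of `F` are dominated by those of the indefinite integral of `n`, which is
absolutely continuous. -/
theorem absolutelyContinuousOnInterval_of_norm_sub_le {E : Type*} [NormedAddCommGroup E]
    {F : ℝ → E} {p q : ℝ} {n : ℝ → ℝ} (hpq : p ≤ q)
    (hn : IntervalIntegrable n volume p q)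
    (h : ∀ x ∈ Icc p q, ∀ y ∈ Icc p q, x ≤ y → ‖F y - F x‖ ≤ ∫ t in x..y, n t) :
    AbsolutelyContinuousOnInterval F p q := by
  have hN := hn.absolutelyContinuousOnInterval_intervalIntegral (c := p) left_mem_uIcc
  have hsub : ∀ x ∈ Icc p q, ∀ y ∈ Icc p q, IntervalIntegrable n volume x y :=
    fun x hx y hy => hn.mono_set_Icc hpq hx hy
  have hle : ∀ x ∈ Icc p q, ∀ y ∈ Icc p q, x ≤ y →
      dist (F x) (F y) ≤ dist (∫ t in p..x, n t) (∫ t in p..y, n t) := by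
    intro x hx y hy hxy
    have hp : p ∈ Icc p q := left_mem_Icc.2 hpq
    rw [dist_comm, dist_eq_norm, dist_comm, Real.dist_eq,
      intervalIntegral.integral_interval_sub_left (hsub p hp y hy) (hsub p hp x hx)]
    exact (h x hx y hy hxy).trans (le_abs_self _)
  refine squeeze_zero' (Eventually.of_forall fun _ => Finset.sum_nonneg fun _ _ => dist_nonneg)
    ?_ hN
  refine Eventually.filter_mono inf_le_right (eventually_principal.2 fun e he => ?_)
  refine Finset.sum_le_sum fun i hi => ?_
  obtain ⟨h1, h2⟩ := he.1 i hi
  rw [uIcc_of_le hpq] at h1 h2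
  rcases le_total (e.2 i).1 (e.2 i).2 with h3 | h3
  · exact hle _ h1 _ h2 h3
  · rw [dist_comm, dist_comm (∫ t in p..(e.2 i).1, n t)]
    exact hle _ h2 _ h1 h3

theorem isPrimitiveOn_of_le (h : ∀ x ∈ I, ∀ y ∈ I, x ≤ y →
    IntervalIntegrable f volume x y ∧ F y - F x = ∫ t in x..y, f t) : IsPrimitiveOn I F f := by
  intro x hx y hy
  rcases le_total x y with hxy | hxy
  · exact h x hx y hy hxy
  · obtain ⟨h1, h2⟩ := h y hy x hx hxy
    refine ⟨h1.symm, ?_⟩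
    rw [intervalIntegral.integral_symm, ← h2, neg_sub]

theorem IsPrimitiveOn.mono (h : IsPrimitiveOn I F f) (hJ : J ⊆ I) : IsPrimitiveOn J F f :=
  fun x hx y hy => h x (hJ hx) y (hJ hy)

theorem IsPrimitiveOn.eqOn_Icc {p q : ℝ} (h : IsPrimitiveOn (Icc p q) F f) (hpq : p ≤ q) :
    EqOn F (fun x => F p + ∫ t in p..x, f t) (Icc p q) := fun x hx => by
  simp only
  rw [← (h p (left_mem_Icc.2 hpq) x hx).2, add_sub_cancel]

theorem IsPrimitiveOn.continuousOn_Icc {p q : ℝ} (h : IsPrimitiveOn (Icc p q) F f) :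
    ContinuousOn F (Icc p q) := by
  rcases le_or_gt p q with hpq | hpq
  · have h1 := intervalIntegral.continuousOn_primitive_interval'
      (h p (left_mem_Icc.2 hpq) q (right_mem_Icc.2 hpq)).1 left_mem_uIcc
    rw [uIcc_of_le hpq] at h1
    exact (continuousOn_const.add h1).congr (h.eqOn_Icc hpq)
  · simp [Icc_eq_empty_of_lt hpq]

theorem IsPrimitiveOn.ae_hasDerivAt [CompleteSpace E] {p q : ℝ} (h : IsPrimitiveOn (Icc p q) F f)
    (hpq : p ≤ q) : ∀ᵐ x, x ∈ Icc p q → HasDerivAt F (f x) x := by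
  have hint := (h p (left_mem_Icc.2 hpq) q (right_mem_Icc.2 hpq)).1
  have hp : ∀ᵐ x : ℝ, x ≠ p := by simp [ae_iff]
  have hq : ∀ᵐ x : ℝ, x ≠ q := by simp [ae_iff]
  filter_upwards [hint.ae_hasDerivAt_integral, hp, hq] with x hx h1 h2 hxI
  have h3 := hx (by rwa [uIcc_of_le hpq]) p left_mem_uIcc
  have h4 : x ∈ Ioo p q := ⟨lt_of_le_of_ne hxI.1 (Ne.symm h1), lt_of_le_of_ne hxI.2 h2⟩
  refine (h3.const_add (F p)).congr_of_eventuallyEq ?_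
  filter_upwards [isOpen_Ioo.mem_nhds h4] with z hz
  exact h.eqOn_Icc hpq (Ioo_subset_Icc_self hz)

theorem IsPrimitiveOn.norm_sub_le (h : IsPrimitiveOn I F f) {x y : ℝ} (hx : x ∈ I) (hy : y ∈ I)
    (hxy : x ≤ y) : ‖F y - F x‖ ≤ ∫ t in x..y, ‖f t‖ := by
  rw [(h x hx y hy).2]
  exact intervalIntegral.norm_integral_le_integral_norm hxy

theorem intervalIntegrable_bilin {b : E × E' → E''} (hb : IsBoundedBilinearMap ℝ b) {p q : ℝ}
    (hpq : p ≤ q) (hf : IntervalIntegrable f volume p q) (hG : ContinuousOn G (Icc p q)) :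
    IntervalIntegrable (fun x => b (f x, G x)) volume p q := by
  obtain ⟨C, hC, hbC⟩ := hb.bound
  obtain ⟨M, hM⟩ := isCompact_Icc.exists_bound_of_continuousOn hG
  rw [intervalIntegrable_iff_integrableOn_Ioc_of_le hpq] at hf ⊢
  have hGm : AEStronglyMeasurable G (volume.restrict (Ioc p q)) :=
    (hG.aestronglyMeasurable measurableSet_Icc).mono_measure
      (Measure.restrict_mono Ioc_subset_Icc_self le_rfl)
  refine (hf.norm.const_mul (C * M)).mono'
    (hb.continuous.comp_aestronglyMeasurable (hf.aestronglyMeasurable.prodMk hGm)) ?_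
  refine (ae_restrict_iff' measurableSet_Ioc).2 (Eventually.of_forall fun x hx => ?_)
  have h1 := hM x (Ioc_subset_Icc_self hx)
  calc ‖b (f x, G x)‖ ≤ C * ‖f x‖ * ‖G x‖ := hbC _ _
    _ ≤ C * ‖f x‖ * M := by gcongr
    _ = C * M * ‖f x‖ := by ring

theorem IsBoundedBilinearMap.swap {b : E × E' → E''} (hb : IsBoundedBilinearMap ℝ b) :
    IsBoundedBilinearMap ℝ (fun p : E' × E => b (p.2, p.1)) where
  add_left _ _ _ := hb.add_right _ _ _
  smul_left _ _ _ := hb.smul_right _ _ _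
  add_right _ _ _ := hb.add_left _ _ _
  smul_right _ _ _ := hb.smul_left _ _ _
  bound := by
    obtain ⟨C, hC, h⟩ := hb.bound
    exact ⟨C, hC, fun x y => (h y x).trans_eq (by ring)⟩

/-- The product rule. -/
theorem IsPrimitiveOn.bilin [CompleteSpace E] [CompleteSpace E'] [CompleteSpace E'']
    [I.OrdConnected] {b : E × E' → E''} (hb : IsBoundedBilinearMap ℝ b)
    (hF : IsPrimitiveOn I F f) (hG : IsPrimitiveOn I G g) :
    IsPrimitiveOn I (fun x => b (F x, G x)) (fun x => b (f x, G x) + b (F x, g x)) := by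
  refine isPrimitiveOn_of_le fun p hp q hq hpq => ?_
  have hsub : Icc p q ⊆ I := OrdConnected.out ‹_› hp hq
  replace hF := hF.mono hsub
  replace hG := hG.mono hsub
  have hpI := left_mem_Icc.2 hpq
  have hqI := right_mem_Icc.2 hpq
  have hint : IntervalIntegrable (fun x => b (f x, G x) + b (F x, g x)) volume p q :=
    (intervalIntegrable_bilin hb hpq (hF p hpI q hqI).1 hG.continuousOn_Icc).add
      (intervalIntegrable_bilin (IsBoundedBilinearMap.swap hb) hpq (hG p hpI q hqI).1
        hF.continuousOn_Icc)
  refine ⟨hint, ?_⟩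
  have hΨ : IsPrimitiveOn (Icc p q) (fun x => ∫ t in p..x, (b (f t, G t) + b (F t, g t)))
      (fun x => b (f x, G x) + b (F x, g x)) := by
    simpa using isPrimitiveOn_integral (fun x hx y hy => hint.mono_set_Icc hpq hx hy) hpI 0
  obtain ⟨C, hC, hbC⟩ := hb.bound
  obtain ⟨M, hM⟩ := isCompact_Icc.exists_bound_of_continuousOn hF.continuousOn_Icc
  obtain ⟨N, hN⟩ := isCompact_Icc.exists_bound_of_continuousOn hG.continuousOn_Icc
  -- The difference of the two sides is absolutely continuous and has derivative zero almost
  -- everywhere, hence is constant. Absolute continuity of the product comes from telescoping its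
  -- increments and bounding the other factor.
  have hac : AbsolutelyContinuousOnInterval
      ((fun x => b (F x, G x)) - fun x => ∫ t in p..x, (b (f t, G t) + b (F t, g t))) p q := by
    refine AbsolutelyContinuousOnInterval.sub ?_ ?_
    · refine absolutelyContinuousOnInterval_of_norm_sub_le
        (n := fun t => C * N * ‖f t‖ + C * M * ‖g t‖) hpq
        (((hF p hpI q hqI).1.norm.const_mul _).add ((hG p hpI q hqI).1.norm.const_mul _))
        fun x hx y hy hxy => ?_
      rw [intervalIntegral.integral_add ((hF x hx y hy).1.norm.const_mul _)
        ((hG x hx y hy).1.norm.const_mul _), intervalIntegral.integral_const_mul,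
        intervalIntegral.integral_const_mul]
      have h1 : b (F y, G y) - b (F x, G x) = b (F y - F x, G y) + b (F x, G y - G x) := by
        rw [hb.map_sub_left, hb.map_sub_right]
        abel
      rw [h1]
      refine (norm_add_le _ _).trans (add_le_add ?_ ?_)
      · refine (hbC _ _).trans ?_
        have h2 := hF.norm_sub_le hx hy hxy
        have h3 := hN y hy
        have h4 : 0 ≤ N := (norm_nonneg _).trans h3
        have h5 := (norm_nonneg _).trans h2
        calc C * ‖F y - F x‖ * ‖G y‖ ≤ C * (∫ t in x..y, ‖f t‖) * N := by gcongr
          _ = C * N * ∫ t in x..y, ‖f t‖ := by ring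
      · refine (hbC _ _).trans ?_
        have h2 := hG.norm_sub_le hx hy hxy
        have h3 := hM x hx
        have h4 : 0 ≤ M := (norm_nonneg _).trans h3
        gcongr
    · exact absolutelyContinuousOnInterval_of_norm_sub_le hpq
        (n := fun t => ‖b (f t, G t) + b (F t, g t)‖) hint.norm
        fun x hx y hy hxy => hΨ.norm_sub_le hx hy hxy
  obtain ⟨c, hc⟩ := hac.const_of_ae_hasDerivAt_zero (by
    rw [uIcc_of_le hpq]
    filter_upwards [hF.ae_hasDerivAt hpq, hG.ae_hasDerivAt hpq, hΨ.ae_hasDerivAt hpq]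
      with x h1 h2 h3 hx
    have h4 := ((hb.hasFDerivAt (F x, G x)).comp_hasDerivAt x ((h1 hx).prodMk (h2 hx))).sub
      (h3 hx)
    refine h4.congr_deriv ?_
    rw [IsBoundedBilinearMap.deriv_apply, add_comm, sub_self])
  rw [uIcc_of_le hpq] at hc
  have h1 := hc p hpI
  have h2 := hc q hqI
  simp only [Pi.sub_apply, intervalIntegral.integral_same, sub_zero] at h1 h2
  rw [h1, ← h2]
  abel

end Calculus

/-! ### Estimates in the Sobolev spaces -/

section L2Interval

variable {p q : ℝ}

theorem intervalIntegrable_L2 (g : L2 p q) {x y : ℝ} (hx : x ∈ Icc p q) (hy : y ∈ Icc p q) :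
    IntervalIntegrable g volume x y := by
  have hpq : p ≤ q := hx.1.trans hx.2
  have hI : IntervalIntegrable g volume p q := by
    rw [intervalIntegrable_iff_integrableOn_Ioo_of_le hpq]
    exact (Lp.memLp g).integrable (by norm_num)
  exact hI.mono_set_Icc hpq hx hy

/-- Cauchy-Schwarz against the indicator of `(x, y)`. The factor `√(y - x)` is what later makes the
boundary term at the degenerate point vanish. -/
theorem norm_integral_L2_le (g : L2 p q) {x y : ℝ} (hx : x ∈ Icc p q) (hy : y ∈ Icc p q)
    (hxy : x ≤ y) : ‖∫ t in x..y, g t‖ ≤ √(y - x) * ‖g‖ := by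
  have hs : MeasurableSet (Ioo x y) := measurableSet_Ioo
  have hsub : Ioo x y ⊆ Ioo p q := Ioo_subset_Ioo hx.1 hy.2
  have hμ : (volume.restrict (Ioo p q)) (Ioo x y) ≠ ∞ :=
    ((Measure.restrict_apply_le _ _).trans_lt measure_Ioo_lt_top).ne
  have h1 := L2.inner_indicatorConstLp_one (𝕜 := ℂ) hs hμ g
  rw [Measure.restrict_restrict hs, inter_eq_self_of_subset_left hsub,
    ← integral_Ioc_eq_integral_Ioo, ← intervalIntegral.integral_of_le hxy] at h1
  rw [← h1]
  refine (norm_inner_le_norm _ _).trans (mul_le_mul_of_nonneg_right ?_ (norm_nonneg _))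
  rw [norm_indicatorConstLp (by norm_num) (by norm_num), norm_one, one_mul, Measure.real,
    Measure.restrict_apply hs, inter_eq_self_of_subset_left hsub, Real.volume_Ioo,
    ENNReal.toReal_ofReal (sub_nonneg.2 hxy), Real.sqrt_eq_rpow]
  norm_num

theorem norm_sq_L2 {α : Type*} [MeasurableSpace α] {μ : Measure α} {E : Type*}
    [NormedAddCommGroup E] [InnerProductSpace ℂ E] (f : Lp E 2 μ) :
    ‖f‖ ^ 2 = ∫ x, ‖f x‖ ^ 2 ∂μ := by
  have h : (inner ℂ f f).re = ∫ x, ‖f x‖ ^ 2 ∂μ := by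
    rw [L2.inner_def]
    have h1 : ∀ x, inner ℂ (f x) (f x) = ((‖f x‖ ^ 2 : ℝ) : ℂ) := fun x => by
      rw [inner_self_eq_norm_sq_to_K]
      push_cast
      rfl
    simp_rw [h1]
    rw [integral_complex_ofReal]
    rfl
  rw [← h]
  exact (inner_self_eq_norm_sq (𝕜 := ℂ) f).symm

end L2Interval

/-! ### Pointwise bounds, embedding and trace for `H¹_R(1, 2)`. -/

namespace H1R

theorem fn_eq_integral (y : H1R) {x : ℝ} (hx : x ∈ Icc (1 : ℝ) 2) :
    y.fn x = - ∫ t in x..2, y.dx t := by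
  rw [← (y.isPrimitiveOn x hx 2 (by norm_num)).2, fn_two]
  simp

theorem norm_eq (y : H1R) : ‖y‖ = ‖y.dx‖ := (dxIso.norm_map y).symm

theorem inner_eq (y z : H1R) : inner ℂ y z = inner ℂ y.dx z.dx := rfl

theorem norm_fn_le (y : H1R) {x : ℝ} (hx : x ∈ Icc (1 : ℝ) 2) : ‖y.fn x‖ ≤ ‖y‖ := by
  rw [fn_eq_integral y hx, norm_neg, norm_eq]
  refine (norm_integral_L2_le _ hx (by norm_num) hx.2).trans ?_
  have h : √(2 - x) ≤ 1 := by
    rw [Real.sqrt_le_one]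
    linarith [hx.1]
  simpa using mul_le_mul_of_nonneg_right h (norm_nonneg y.dx)

theorem continuousOn_fn (y : H1R) : ContinuousOn y.fn (Icc 1 2) :=
  y.isPrimitiveOn.continuousOn_Icc

theorem memLp_fn (y : H1R) : MemLp y.fn 2 (volume.restrict (Ioo 1 2)) := by
  refine MemLp.of_bound ?_ ‖y‖ ?_
  · exact (y.continuousOn_fn.mono Ioo_subset_Icc_self).aestronglyMeasurable measurableSet_Ioo
  · exact (ae_restrict_iff' measurableSet_Ioo).2
      (Eventually.of_forall fun x hx => y.norm_fn_le (Ioo_subset_Icc_self hx))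

/-- The embedding of `H¹_R(1, 2)` into `L²(1, 2)`. -/
noncomputable def toL2 : H1R →L[ℂ] L2 1 2 :=
  LinearMap.mkContinuous
    { toFun := fun y => y.memLp_fn.toLp
      map_add' := fun y z => by
        rw [← MemLp.toLp_add]
        exact MemLp.toLp_congr _ _ (Eventually.of_forall fun x => by rw [fn_add])
      map_smul' := fun r y => by
        rw [RingHom.id_apply, ← MemLp.toLp_const_smul]
        exact MemLp.toLp_congr _ _ (Eventually.of_forall fun x => by rw [fn_smul]) }
    1 (fun y => by
      have h := Lp.norm_le_of_ae_bound (f := y.memLp_fn.toLp) (norm_nonneg y) (by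
        filter_upwards [y.memLp_fn.coeFn_toLp, ae_restrict_mem measurableSet_Ioo] with x h1 h2
        rw [h1]
        exact y.norm_fn_le (Ioo_subset_Icc_self h2))
      refine h.trans ?_
      have hm : measureUnivNNReal (volume.restrict (Ioo (1 : ℝ) 2)) = 1 := by
        rw [measureUnivNNReal, Measure.restrict_apply_univ, Real.volume_Ioo]
        norm_num
      rw [hm, NNReal.coe_one, Real.one_rpow])

theorem coeFn_toL2 (y : H1R) : toL2 y =ᵐ[volume.restrict (Ioo 1 2)] y.fn :=
  y.memLp_fn.coeFn_toLp

/-- The trace at `1`. -/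
noncomputable def trace : H1R →L[ℂ] ℂ :=
  LinearMap.mkContinuous
    { toFun := fun y => y.fn 1
      map_add' := fun y z => by rw [fn_add]; rfl
      map_smul' := fun r y => by rw [fn_smul]; rfl }
    1 (fun y => by simpa using y.norm_fn_le (by norm_num))

end H1R

namespace TransmissionData

variable {S : TransmissionData}

/-- The weight `η` is continuous and positive on a compact interval. Only `1/σ` degenerates, so the
energy norm of `u` is equivalent to the `L²` norm of `u_x`. -/
theorem exists_η_bounds (S : TransmissionData) :
    ∃ k > 0, ∃ K > 0, ∀ x ∈ Icc (0 : ℝ) 1, k ≤ S.η x ∧ S.η x ≤ K := by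
  obtain ⟨x, hx, hxm⟩ := isCompact_Icc.exists_isMinOn (nonempty_Icc.2 zero_le_one) S.η_cont
  obtain ⟨y, hy, hym⟩ := isCompact_Icc.exists_isMaxOn (nonempty_Icc.2 zero_le_one) S.η_cont
  exact ⟨S.η x, S.η_pos x, S.η y, S.η_pos y, fun z hz => ⟨hxm hz, hym hz⟩⟩

/-! ### Energy norm, embedding and trace for `H¹_{1/σ,L}(0, 1)`. -/

namespace H1σL

theorem inner_eq (u v : S.H1σL) : inner ℂ u v =
    ∫ x in Ioo (0 : ℝ) 1, (S.η x : ℂ) * (starRingEnd ℂ (u.dx x) * v.dx x) := rfl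

theorem norm_sq_eq (u : S.H1σL) : ‖u‖ ^ 2 = ∫ x in Ioo (0 : ℝ) 1, S.η x * ‖u.dx x‖ ^ 2 := by
  have h0 : ∀ x, (S.η x : ℂ) * (starRingEnd ℂ (u.dx x) * u.dx x)
      = ((S.η x * ‖u.dx x‖ ^ 2 : ℝ) : ℂ) := fun x => by
    rw [Complex.conj_mul']
    push_cast
    ring
  have h : (inner ℂ u u).re = ∫ x in Ioo (0 : ℝ) 1, S.η x * ‖u.dx x‖ ^ 2 := by
    rw [inner_eq]
    simp_rw [h0]
    rw [integral_complex_ofReal]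
    rfl
  rw [← h]
  exact (inner_self_eq_norm_sq (𝕜 := ℂ) u).symm

theorem integrable_η_norm_sq (f : L2 0 1) :
    Integrable (fun x => S.η x * ‖f x‖ ^ 2) (volume.restrict (Ioo 0 1)) := by
  have h := (integrable_η_mul (S := S) f f).re
  refine h.congr (Eventually.of_forall fun x => ?_)
  have h0 : (S.η x : ℂ) * (starRingEnd ℂ (f x) * f x) = ((S.η x * ‖f x‖ ^ 2 : ℝ) : ℂ) := by
    rw [Complex.conj_mul']
    push_cast
    ring
  simp only [h0]
  rfl

theorem integrable_norm_sq (f : L2 0 1) :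
    Integrable (fun x => ‖f x‖ ^ 2) (volume.restrict (Ioo 0 1)) :=
  (memLp_two_iff_integrable_sq_norm (Lp.aestronglyMeasurable f)).1 (Lp.memLp f)

variable (S) in
theorem exists_norm_dx_le : ∃ C > 0, ∀ u : S.H1σL, ‖u.dx‖ ≤ C * ‖u‖ ∧ ‖u‖ ≤ C * ‖u.dx‖ := by
  obtain ⟨k, hk, K, hK, h⟩ := S.exists_η_bounds
  have key : ∀ u : S.H1σL, k * ‖u.dx‖ ^ 2 ≤ ‖u‖ ^ 2 ∧ ‖u‖ ^ 2 ≤ K * ‖u.dx‖ ^ 2 := by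
    intro u
    rw [norm_sq_eq, norm_sq_L2, ← integral_const_mul, ← integral_const_mul]
    constructor
    · refine setIntegral_mono_on ((integrable_norm_sq _).const_mul _) (integrable_η_norm_sq _)
        measurableSet_Ioo fun x hx => ?_
      exact mul_le_mul_of_nonneg_right (h x (Ioo_subset_Icc_self hx)).1 (sq_nonneg _)
    · refine setIntegral_mono_on (integrable_η_norm_sq _) ((integrable_norm_sq _).const_mul _)
        measurableSet_Ioo fun x hx => ?_
      exact mul_le_mul_of_nonneg_right (h x (Ioo_subset_Icc_self hx)).2 (sq_nonneg _)
  refine ⟨√k⁻¹ + √K, by positivity, fun u => ⟨?_, ?_⟩⟩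
  · have h1 : ‖u.dx‖ ≤ √k⁻¹ * ‖u‖ := by
      refine abs_le_of_sq_le_sq' ?_ (by positivity) |>.2
      rw [mul_pow, Real.sq_sqrt (by positivity), inv_mul_eq_div, le_div_iff₀ hk, mul_comm]
      exact (key u).1
    refine h1.trans (mul_le_mul_of_nonneg_right ?_ (norm_nonneg _))
    linarith [Real.sqrt_nonneg K]
  · have h1 : ‖u‖ ≤ √K * ‖u.dx‖ := by
      refine abs_le_of_sq_le_sq' ?_ (by positivity) |>.2
      rw [mul_pow, Real.sq_sqrt hK.le]
      exact (key u).2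
    refine h1.trans (mul_le_mul_of_nonneg_right ?_ (norm_nonneg _))
    linarith [Real.sqrt_nonneg k⁻¹]

theorem fn_eq_integral (u : S.H1σL) {x : ℝ} (hx : x ∈ Icc (0 : ℝ) 1) :
    u.fn x = ∫ t in 0..x, u.dx t := by
  rw [← (u.isPrimitiveOn 0 (by norm_num) x hx).2, fn_zero, sub_zero]

theorem norm_fn_le (u : S.H1σL) {x : ℝ} (hx : x ∈ Icc (0 : ℝ) 1) :
    ‖u.fn x‖ ≤ √x * ‖u.dx‖ := by
  rw [fn_eq_integral u hx]
  simpa using norm_integral_L2_le u.dx (by norm_num) hx hx.1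

theorem memLp_fn (u : S.H1σL) : MemLp u.fn 2 S.invσMeasure := u.2.2.2

/-- The embedding of `H¹_{1/σ,L}(0, 1)` into `L²_{1/σ}(0, 1)`; in general it is not continuous for
the energy norm. -/
noncomputable def toL2σ : S.H1σL →ₗ[ℂ] S.L2σ where
  toFun u := u.memLp_fn.toLp
  map_add' u v := by
    rw [← MemLp.toLp_add]
    exact MemLp.toLp_congr _ _ (Eventually.of_forall fun x => by rw [fn_add])
  map_smul' r u := by
    rw [RingHom.id_apply, ← MemLp.toLp_const_smul]
    exact MemLp.toLp_congr _ _ (Eventually.of_forall fun x => by rw [fn_smul])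

theorem coeFn_toL2σ (u : S.H1σL) : toL2σ u =ᵐ[S.invσMeasure] u.fn := u.memLp_fn.coeFn_toLp

/-- The trace at `1`. -/
noncomputable def trace : S.H1σL →L[ℂ] ℂ :=
  LinearMap.mkContinuousOfExistsBound
    { toFun := fun u => u.fn 1
      map_add' := fun y z => by rw [fn_add]; rfl
      map_smul' := fun r y => by rw [fn_smul]; rfl }
    (by
      obtain ⟨C, hC, h⟩ := exists_norm_dx_le S
      refine ⟨C, fun u => ?_⟩
      have h1 := u.norm_fn_le (x := 1) (by norm_num)
      rw [Real.sqrt_one, one_mul] at h1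
      exact h1.trans (h u).1)

theorem exists_dx_eq (g : L2 0 1)
    (hg : MemLp (fun x => ∫ t in (0 : ℝ)..x, g t) 2 S.invσMeasure) :
    ∃ u : S.H1σL, u.dx = g ∧ ∀ x ∈ Icc (0 : ℝ) 1, u.fn x = ∫ t in (0 : ℝ)..x, g t := by
  have h0 : (0 : ℝ) ∈ Icc (0 : ℝ) 1 := by norm_num
  have hp : IsPrimitiveOn (Icc 0 1) (fun x => ∫ t in (0 : ℝ)..x, g t) g := by
    simpa using isPrimitiveOn_integral (fun x hx y hy => intervalIntegrable_L2 g hx hy) h0 0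
  let w : C(Icc (0 : ℝ) 1, ℂ) := ⟨fun x => ∫ t in (0 : ℝ)..x, g t, hp.continuousOn_Icc.domRestrict⟩
  have hw : ∀ x ∈ Icc (0 : ℝ) 1, zeroExt w x = ∫ t in (0 : ℝ)..x, g t := fun x hx =>
    zeroExt_apply w hx
  refine ⟨⟨(w, g), ?_, ?_, ?_⟩, rfl, hw⟩
  · exact hp.congr (fun x hx => (hw x hx).symm) (Eventually.of_forall fun _ _ => rfl)
  · simp [hw 0 h0]
  · refine hg.ae_eq (ae_invσ.2 ?_)
    filter_upwards [ae_restrict_mem measurableSet_Ioo] with x hx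
    exact (hw x (Ioo_subset_Icc_self hx)).symm

/-- `H¹_{1/σ,L}(0, 1)` is complete for the graph norm of its embedding into `L²_{1/σ}(0, 1)`. -/
theorem exists_tendsto {u : ℕ → S.H1σL} (hu : CauchySeq u) {w : S.L2σ}
    (hw : Tendsto (fun n => toL2σ (u n)) atTop (𝓝 w)) :
    ∃ v : S.H1σL, Tendsto u atTop (𝓝 v) ∧ toL2σ v = w := by
  obtain ⟨C, hC, hbd⟩ := exists_norm_dx_le S
  have hdx : CauchySeq fun n => (u n).dx := by
    have hL : LipschitzWith ⟨C, hC.le⟩ (H1σL.dx (S := S)) := by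
      refine LipschitzWith.of_dist_le_mul fun a b => ?_
      rw [dist_eq_norm, dist_eq_norm, ← map_sub]
      exact (hbd (a - b)).1
    exact hL.uniformContinuous.comp_cauchySeq hu
  obtain ⟨g, hg⟩ := cauchySeq_tendsto_of_complete hdx
  -- Energy convergence determines the pointwise limit, namely the primitive of `g`.
  have hpt : ∀ x ∈ Icc (0 : ℝ) 1,
      Tendsto (fun n => (u n).fn x) atTop (𝓝 (∫ t in (0 : ℝ)..x, g t)) := by
    intro x hx
    have h0 : Tendsto (fun n => √x * ‖(u n).dx - g‖) atTop (𝓝 0) := by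
      simpa using (hg.sub_const g).norm.const_mul √x
    refine tendsto_iff_norm_sub_tendsto_zero.2 (squeeze_zero (fun _ => norm_nonneg _)
      (fun n => ?_) h0)
    have h0I : (0 : ℝ) ∈ Icc (0 : ℝ) 1 := by norm_num
    have h1 : (u n).fn x - ∫ t in (0 : ℝ)..x, g t = ∫ t in (0 : ℝ)..x, ((u n).dx - g) t := by
      rw [fn_eq_integral _ hx, ← intervalIntegral.integral_sub
        (intervalIntegrable_L2 _ h0I hx) (intervalIntegrable_L2 _ h0I hx)]
      refine intervalIntegral.integral_congr_ae ?_
      filter_upwards [ae_mem_Icc_of_ae_restrict (Lp.coeFn_sub (u n).dx g)] with t ht htI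
      rw [uIoc_of_le hx.1] at htI
      exact (ht ⟨htI.1.le, htI.2.trans hx.2⟩).symm
    rw [h1]
    simpa using norm_integral_L2_le ((u n).dx - g) h0I hx hx.1
  -- A subsequence also converges almost everywhere to `w`, so `w` is the primitive of `g`. This
  -- supplies the weighted integrability that energy convergence alone does not give.
  obtain ⟨ns, hns, hae⟩ := (tendstoInMeasure_of_tendsto_Lp hw).exists_seq_tendsto_ae
  have hwae : w =ᵐ[S.invσMeasure] fun x => ∫ t in (0 : ℝ)..x, g t := by
    have h1 : ∀ᵐ x ∂S.invσMeasure, ∀ n, toL2σ (u n) x = (u n).fn x :=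
      ae_all_iff.2 fun n => coeFn_toL2σ (u n)
    filter_upwards [hae, h1, ae_invσ.2 (ae_restrict_mem measurableSet_Ioo)] with x h2 h3 h4
    simp_rw [h3] at h2
    exact tendsto_nhds_unique h2 ((hpt x (Ioo_subset_Icc_self h4)).comp hns.tendsto_atTop)
  obtain ⟨v, hv, hvx⟩ := exists_dx_eq (S := S) g ((Lp.memLp w).ae_eq hwae)
  refine ⟨v, ?_, ?_⟩
  · have h0 : Tendsto (fun n => C * ‖(u n).dx - g‖) atTop (𝓝 0) := by
      simpa using (hg.sub_const g).norm.const_mul C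
    refine tendsto_iff_norm_sub_tendsto_zero.2 (squeeze_zero (fun _ => norm_nonneg _)
      (fun n => ?_) h0)
    have := (hbd (u n - v)).2
    rwa [map_sub, hv] at this
  · refine Lp.ext ((coeFn_toL2σ v).trans (EventuallyEq.trans ?_ hwae.symm))
    filter_upwards [ae_invσ.2 (ae_restrict_mem measurableSet_Ioo)] with x hx
    exact hvx x (Ioo_subset_Icc_self hx)

end H1σL

/-! ### Generation -/

variable (S) in
/-- The energy space with the graph norm of the embedding of its first component into
`L²_{1/σ}(0, 1)`. -/
def graphSpace : Submodule ℂ (WithLp 2 (S.Energy × S.L2σ)) where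
  carrier := {p | p.snd = H1σL.toL2σ p.fst.u}
  zero_mem' := (map_zero (H1σL.toL2σ (S := S))).symm
  add_mem' := by
    intro p p' hp hp'
    change p.snd + p'.snd = H1σL.toL2σ (p.fst.u + p'.fst.u)
    rw [map_add, ← hp, ← hp']
  smul_mem' := by
    intro r p hp
    change r • p.snd = H1σL.toL2σ (r • p.fst.u)
    rw [map_smul, ← hp]

instance : CompleteSpace S.graphSpace := by
  refine Metric.complete_of_cauchySeq_tendsto fun x hx => ?_
  have hx' : CauchySeq fun n => (x n : WithLp 2 (S.Energy × S.L2σ)) :=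
    uniformContinuous_subtype_val.comp_cauchySeq hx
  have hU : CauchySeq fun n => (x n : WithLp 2 (S.Energy × S.L2σ)).fst :=
    (WithLp.fstL 2 ℂ S.Energy S.L2σ).uniformContinuous.comp_cauchySeq hx'
  have hw : CauchySeq fun n => (x n : WithLp 2 (S.Energy × S.L2σ)).snd :=
    (WithLp.sndL 2 ℂ S.Energy S.L2σ).uniformContinuous.comp_cauchySeq hx'
  have hu : CauchySeq fun n => (x n : WithLp 2 (S.Energy × S.L2σ)).fst.u :=
    (WithLp.fstL 2 ℂ S.H1σL (WithLp 2 (S.L2σ × WithLp 2 (L2 1 2 × S.W)))).uniformContinuous.comp_cauchySeq hU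
  have hr : CauchySeq fun n => (x n : WithLp 2 (S.Energy × S.L2σ)).fst.snd :=
    (WithLp.sndL 2 ℂ S.H1σL (WithLp 2 (S.L2σ × WithLp 2 (L2 1 2 × S.W)))).uniformContinuous.comp_cauchySeq hU
  obtain ⟨w, hw⟩ := cauchySeq_tendsto_of_complete hw
  obtain ⟨r, hr⟩ := cauchySeq_tendsto_of_complete hr
  have hw' : Tendsto (fun n => H1σL.toL2σ (x n : WithLp 2 (S.Energy × S.L2σ)).fst.u) atTop
      (𝓝 w) := hw.congr fun n => (x n).2
  obtain ⟨v, hv, hvw⟩ := H1σL.exists_tendsto hu hw'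
  refine ⟨⟨WithLp.toLp 2 (WithLp.toLp 2 (v, r), w), hvw.symm⟩, ?_⟩
  rw [tendsto_subtype_rng]
  exact ((WithLp.prod_continuous_toLp 2 S.Energy S.L2σ).tendsto _).comp
    (Tendsto.prodMk_nhds (((WithLp.prod_continuous_toLp 2 S.H1σL _).tendsto _).comp
      (hv.prodMk_nhds hr)) hw)

variable (S) in
/-- The projection of the graph space onto the energy space. -/
noncomputable def graphProj : S.graphSpace →L[ℂ] S.Energy :=
  (WithLp.fstL 2 ℂ S.Energy S.L2σ).comp S.graphSpace.subtypeL

theorem graphProj_bijective : Function.Bijective S.graphProj := by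
  constructor
  · intro x x' h
    have h1 : (x : WithLp 2 (S.Energy × S.L2σ)).fst = (x' : WithLp 2 (S.Energy × S.L2σ)).fst := h
    have h2 : (x : WithLp 2 (S.Energy × S.L2σ)).snd = (x' : WithLp 2 (S.Energy × S.L2σ)).snd := by
      rw [x.2, x'.2, h1]
    exact Subtype.ext (congrArg (WithLp.toLp 2) (Prod.ext h1 h2))
  · intro U
    exact ⟨⟨WithLp.toLp 2 (U, H1σL.toL2σ U.u), rfl⟩, rfl⟩

theorem Energy.norm_v_le (U : S.Energy) : ‖U.v‖ ≤ ‖U‖ :=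
  (WithLp.norm_fst_le _ U.snd).trans (WithLp.norm_snd_le _ U)

theorem IsValue.toL2σ_eq {U F : S.Energy} {q : ℝ → ℂ} {y : H1R} {z : H1 1 2} {Γ : ℝ → H1R}
    {γs : S.W} (h : IsValue U F q y z Γ γs) : H1σL.toL2σ F.u = U.v :=
  Lp.ext ((H1σL.coeFn_toL2σ F.u).trans h.v_eq.symm)

/-- The first component of the value of the operator is `v`, so the extra term of the finer inner
product is `⟨u, v⟩` in `L²_{1/σ}`. Both factors are bounded by the finer norm, hence `ω = 1`. -/
theorem inner_graphSpace_le (hA : IsMDissipative S.operator) (x y : S.graphSpace)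
    (h : (S.graphProj x, S.graphProj y) ∈ S.operator.graph) :
    (inner ℂ x y).re ≤ 1 * ‖x‖ ^ 2 := by
  have h1 := hA.graph.dissipative _ h
  rw [operator_graph] at h
  obtain ⟨q, y', z, Γ, γs, hv⟩ := h
  have h2 : inner ℂ x y = inner ℂ (S.graphProj x) (S.graphProj y) +
      inner ℂ (x : WithLp 2 (S.Energy × S.L2σ)).snd (S.graphProj x).v := by
    rw [← hv.toL2σ_eq]
    have h3 : (y : WithLp 2 (S.Energy × S.L2σ)).snd = H1σL.toL2σ (S.graphProj y).u := y.2
    rw [← h3]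
    rfl
  have h4 : ‖(x : WithLp 2 (S.Energy × S.L2σ)).snd‖ ≤ ‖x‖ := WithLp.norm_snd_le _ _
  have h5 : ‖(S.graphProj x).v‖ ≤ ‖x‖ :=
    (Energy.norm_v_le _).trans (WithLp.norm_fst_le _ (x : WithLp 2 (S.Energy × S.L2σ)))
  have h6 := (Complex.re_le_norm _).trans (norm_inner_le_norm (𝕜 := ℂ)
    (x : WithLp 2 (S.Energy × S.L2σ)).snd (S.graphProj x).v)
  rw [h2, Complex.add_re, one_mul, sq]
  have h7 := mul_le_mul h4 h5 (norm_nonneg _) (norm_nonneg x)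
  have h8 : (inner ℂ (S.graphProj x) (S.graphProj y)).re ≤ 0 := h1
  linarith

theorem generation_of_isMDissipative (hA : IsMDissipative S.operator) :
    Dense (S.operator.domain : Set S.Energy) ∧
      ∃ T : ℝ → S.Energy →L[ℂ] S.Energy, IsContractionSemigroup T ∧ IsGenerator S.operator T :=
  IsMDissipative.exists_semigroup (K := S.graphSpace) hA (π := S.graphProj)
    graphProj_bijective (ω := 1) zero_le_one (inner_graphSpace_le hA)

end TransmissionData

/-! ### Dissipativity: the wave and the heat part -/

/-- A boundary term that converges at `0` and is dominated by `√x` times a square integrable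
function converges to zero. -/
theorem eq_zero_of_tendsto_of_le_sqrt_mul {h : ℝ → ℝ} {q : ℝ → ℂ} {K L : ℝ}
    (hq : IntegrableOn (fun x => ‖q x‖ ^ 2) (Ioo 0 1))
    (hh : ∀ x ∈ Ioo (0 : ℝ) 1, |h x| ≤ √x * K * ‖q x‖) (hL : Tendsto h (𝓝[>] 0) (𝓝 L)) : L = 0 := by
  by_contra hne
  have hpos : 0 < |L| / 2 := by positivity
  have hev : ∀ᶠ x in 𝓝[>] (0 : ℝ), |L| / 2 < |h x| :=
    hL.abs.eventually (lt_mem_nhds (by linarith))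
  obtain ⟨δ, hδ, hδsub⟩ := mem_nhdsGT_iff_exists_Ioo_subset.1 hev
  set d := min δ 1 with hd
  have hd0 : 0 < d := lt_min hδ one_pos
  have hsub : Ioo 0 d ⊆ Ioo 0 1 := Ioo_subset_Ioo_right (min_le_right _ _)
  -- On `(0, d)`, `|L|/2 < |h| ≤ √x K |q|` gives `1/x ≤ K² |q|² / (|L|/2)²`. This would make `1/x`
  -- integrable at `0`.
  have hint : IntegrableOn (fun x : ℝ => x⁻¹) (Ioo 0 d) := by
    refine Integrable.mono' ((hq.mono_set hsub).const_mul (K ^ 2 / (|L| / 2) ^ 2)) ?_ ?_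
    · exact measurable_inv.aestronglyMeasurable
    · refine (ae_restrict_iff' measurableSet_Ioo).2 (Eventually.of_forall fun x hx => ?_)
      have h1 : |L| / 2 < |h x| := hδsub ⟨hx.1, hx.2.trans_le (min_le_left _ _)⟩
      have h2 := hh x (hsub hx)
      have h3 : (|L| / 2) ^ 2 ≤ x * (K ^ 2 * ‖q x‖ ^ 2) := by
        calc (|L| / 2) ^ 2 ≤ (√x * K * ‖q x‖) ^ 2 :=
              pow_le_pow_left₀ hpos.le (h1.le.trans h2) 2
          _ = √x ^ 2 * (K ^ 2 * ‖q x‖ ^ 2) := by ring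
          _ = x * (K ^ 2 * ‖q x‖ ^ 2) := by rw [Real.sq_sqrt hx.1.le]
      rw [norm_inv, Real.norm_of_nonneg hx.1.le, inv_le_iff_one_le_mul₀ hx.1, div_mul_eq_mul_div,
        div_mul_eq_mul_div, le_div_iff₀ (by positivity)]
      linarith
  have h4 : IntervalIntegrable (fun x : ℝ => x⁻¹) volume 0 d := by
    rwa [intervalIntegrable_iff_integrableOn_Ioo_of_le hd0.le]
  rcases intervalIntegrable_inv_iff.1 h4 with h5 | h5
  · exact hd0.ne h5
  · exact h5 left_mem_uIcc

/-- Integration by parts on `(1, 2)`. -/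
theorem H1R.integral_inner_eq (y : H1R) (z : H1 1 2) :
    ∫ x in Ioo (1 : ℝ) 2, inner ℂ (y.fn x) (z.1.2 x) =
      - inner ℂ (y.fn 1) (zeroExt z.1.1 1) -
        ∫ x in Ioo (1 : ℝ) 2, inner ℂ (y.dx x) (zeroExt z.1.1 x) := by
  have hz : IsPrimitiveOn (Icc 1 2) (zeroExt z.1.1) z.1.2 := z.2
  have h1 : (1 : ℝ) ∈ Icc (1 : ℝ) 2 := by norm_num
  have h2 : (2 : ℝ) ∈ Icc (1 : ℝ) 2 := by norm_num
  have hb : IsBoundedBilinearMap ℝ (fun p : ℂ × ℂ => inner ℂ p.1 p.2) :=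
    isBoundedBilinearMap_inner
  have h := (y.isPrimitiveOn.bilin hb hz 1 h1 2 h2).2
  have hi1 := intervalIntegrable_bilin hb one_le_two (y.isPrimitiveOn 1 h1 2 h2).1
    hz.continuousOn_Icc
  have hi2 := intervalIntegrable_bilin (IsBoundedBilinearMap.swap hb) one_le_two
    (hz 1 h1 2 h2).1 y.continuousOn_fn
  simp only at h hi1 hi2
  rw [intervalIntegral.integral_add hi1 hi2, y.fn_two, inner_zero_left, zero_sub,
    intervalIntegral.integral_of_le one_le_two, intervalIntegral.integral_of_le one_le_two,
    integral_Ioc_eq_integral_Ioo, integral_Ioc_eq_integral_Ioo] at h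
  rw [h]
  ring

namespace TransmissionData

variable {S : TransmissionData}

theorem aemeasurable_inv_σ :
    AEMeasurable (fun x => ENNReal.ofReal (1 / S.σ x)) (volume.restrict (Ioo 0 1)) := by
  refine AEMeasurable.ennreal_ofReal (ContinuousOn.aemeasurable ?_ measurableSet_Ioo)
  exact continuousOn_const.div (S.σ_cont.mono Ioo_subset_Icc_self)
    fun x hx => (S.σ_pos (Ioo_subset_Ioc_self hx)).ne'

theorem integral_invσ {E : Type*} [NormedAddCommGroup E] [NormedSpace ℝ E] (f : ℝ → E) :
    ∫ x, f x ∂S.invσMeasure = ∫ x in Ioo 0 1, (S.σ x)⁻¹ • f x := by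
  rw [invσMeasure, integral_withDensity_eq_integral_toReal_smul₀ aemeasurable_inv_σ
    (Eventually.of_forall fun _ => ENNReal.ofReal_lt_top)]
  refine setIntegral_congr_fun measurableSet_Ioo fun x hx => ?_
  rw [one_div, ENNReal.toReal_ofReal (inv_nonneg.2 (S.σ_pos (Ioo_subset_Ioc_self hx)).le)]

theorem integrable_invσ_iff {E : Type*} [NormedAddCommGroup E] [NormedSpace ℝ E] {f : ℝ → E} :
    Integrable f S.invσMeasure ↔ IntegrableOn (fun x => (S.σ x)⁻¹ • f x) (Ioo 0 1) := by
  rw [invσMeasure, integrable_withDensity_iff_integrable_smul₀' aemeasurable_inv_σ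
    (Eventually.of_forall fun _ => ENNReal.ofReal_lt_top)]
  refine integrable_congr ((ae_restrict_iff' measurableSet_Ioo).2
    (Eventually.of_forall fun x hx => ?_))
  simp only
  rw [one_div, ENNReal.toReal_ofReal (inv_nonneg.2 (S.σ_pos (Ioo_subset_Ioc_self hx)).le)]

theorem integrableOn_norm_sq_flux {u : S.H1σL} {q : ℝ → ℂ}
    (hq : q =ᵐ[volume.restrict (Ioo 0 1)] fun x => (S.η x : ℂ) * u.dx x) :
    IntegrableOn (fun x => ‖q x‖ ^ 2) (Ioo 0 1) := by
  obtain ⟨k, hk, K, hK, hη⟩ := S.exists_η_bounds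
  have hm : AEStronglyMeasurable (fun x => ‖q x‖ ^ 2) (volume.restrict (Ioo 0 1)) := by
    have h1 : AEStronglyMeasurable (fun x => (S.η x : ℂ) * u.dx x)
        (volume.restrict (Ioo 0 1)) := by
      refine AEStronglyMeasurable.mul ?_ (Lp.aestronglyMeasurable _)
      exact (Complex.continuous_ofReal.comp_continuousOn
        (S.η_cont.mono Ioo_subset_Icc_self)).aestronglyMeasurable measurableSet_Ioo
    exact (h1.congr hq.symm).norm.pow 2
  refine Integrable.mono' ((H1σL.integrable_η_norm_sq (S := S) u.dx).const_mul K) hm ?_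
  filter_upwards [hq, ae_restrict_mem measurableSet_Ioo] with x h1 h2
  rw [h1, norm_pow, norm_norm, norm_mul, Complex.norm_real, Real.norm_of_nonneg (S.η_pos x).le,
    mul_pow, sq (S.η x), mul_assoc]
  have h3 := (hη x (Ioo_subset_Icc_self h2)).2
  have h4 := (S.η_pos x).le
  exact mul_le_mul_of_nonneg_right h3 (by positivity)

/-- Integration by parts on `(0, 1)`. -/
theorem IsValue.re_wave_eq {U F : S.Energy} {q : ℝ → ℂ} {y : H1R} {z : H1 1 2} {Γ : ℝ → H1R}
    {γs : S.W} (h : IsValue U F q y z Γ γs) :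
    ((∫ x in Ioo (0 : ℝ) 1, (S.η x : ℂ) * (starRingEnd ℂ (U.u.dx x) * F.u.dx x)) +
      ∫ x, inner ℂ (U.v x) (F.v x) ∂S.invσMeasure).re = inner ℝ (F.u.fn 1) (q 1) := by
  -- `D` is the derivative of `Re(conj v · q)` on `(0, 1]`, where `v` is `F.u`, and also the real
  -- integrand of the left-hand side. Its integrability up to `0` gives `Re(conj v · q)` a limit
  -- there.
  set D : ℝ → ℝ := fun x => inner ℝ (F.u.dx x) (q x) + inner ℝ (F.u.fn x) (F.v x / (S.σ x : ℂ))
    with hD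
  have hi1 := integrable_η_mul (S := S) U.u.dx F.u.dx
  have hi2 : Integrable (fun x => inner ℂ (U.v x) (F.v x)) S.invσMeasure :=
    L2.integrable_inner _ _
  have he1 : (fun x => ((S.η x : ℂ) * (starRingEnd ℂ (U.u.dx x) * F.u.dx x)).re)
      =ᵐ[volume.restrict (Ioo 0 1)] fun x => inner ℝ (F.u.dx x) (q x) := by
    filter_upwards [h.flux_eq] with x hx
    rw [hx, Complex.inner]
    simp only [Complex.mul_re, Complex.mul_im, Complex.conj_re, Complex.conj_im,
      Complex.ofReal_re, Complex.ofReal_im]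
    ring
  have he2 : (fun x => ((S.σ x)⁻¹ • inner ℂ (U.v x) (F.v x)).re)
      =ᵐ[volume.restrict (Ioo 0 1)] fun x => inner ℝ (F.u.fn x) (F.v x / (S.σ x : ℂ)) := by
    filter_upwards [ae_invσ.1 h.v_eq] with x hx
    rw [hx, Complex.inner, RCLike.inner_apply, div_eq_mul_inv, ← Complex.ofReal_inv,
      Complex.real_smul]
    congr 1
    ring
  have hi2' := integrable_invσ_iff.1 hi2
  have hD1 : Integrable (fun x => inner ℝ (F.u.dx x) (q x)) (volume.restrict (Ioo 0 1)) :=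
    hi1.re.congr he1
  have hD2 : Integrable (fun x => inner ℝ (F.u.fn x) (F.v x / (S.σ x : ℂ)))
      (volume.restrict (Ioo 0 1)) := (Integrable.re hi2').congr he2
  have hDi : Integrable D (volume.restrict (Ioo 0 1)) := hD1.add hD2
  have hlhs : ((∫ x in Ioo (0 : ℝ) 1, (S.η x : ℂ) * (starRingEnd ℂ (U.u.dx x) * F.u.dx x)) +
      ∫ x, inner ℂ (U.v x) (F.v x) ∂S.invσMeasure).re = ∫ x in Ioo (0 : ℝ) 1, D x := by
    rw [integral_invσ, Complex.add_re, hD, integral_add hD1 hD2, ← integral_congr_ae he1,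
      ← integral_congr_ae he2]
    congr 1
    · exact (integral_re hi1).symm
    · exact (integral_re hi2').symm
  have hb : IsBoundedBilinearMap ℝ (fun p : ℂ × ℂ => inner ℝ p.1 p.2) :=
    isBoundedBilinearMap_inner
  have hprim : IsPrimitiveOn (Ioc 0 1) (fun x => inner ℝ (F.u.fn x) (q x)) D :=
    (F.u.isPrimitiveOn.mono Ioc_subset_Icc_self).bilin hb h.flux_deriv
  have hDI : IntervalIntegrable D volume 0 1 := by
    rwa [intervalIntegrable_iff_integrableOn_Ioo_of_le zero_le_one]
  have hcont : ContinuousOn (fun x => ∫ t in x..1, D t) (Icc 0 1) := by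
    have h1 := intervalIntegral.continuousOn_primitive_interval' hDI right_mem_uIcc
    rw [uIcc_of_le zero_le_one] at h1
    refine h1.neg.congr fun x _ => ?_
    rw [intervalIntegral.integral_symm]
    rfl
  have hlim : Tendsto (fun x => inner ℝ (F.u.fn x) (q x)) (𝓝[>] 0)
      (𝓝 (inner ℝ (F.u.fn 1) (q 1) - ∫ t in (0 : ℝ)..1, D t)) := by
    have h1 : Tendsto (fun x => ∫ t in x..1, D t) (𝓝[>] 0) (𝓝 (∫ t in (0 : ℝ)..1, D t)) := by
      have := (hcont 0 (by norm_num)).mono_left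
        (nhdsWithin_mono _ (Ioc_subset_Icc_self (a := (0 : ℝ)) (b := 1)))
      rwa [nhdsWithin_Ioc_eq_nhdsGT one_pos] at this
    refine (h1.const_sub (inner ℝ (F.u.fn 1) (q 1))).congr' ?_
    filter_upwards [Ioc_mem_nhdsGT one_pos] with x hx
    rw [← (hprim x hx 1 (by norm_num)).2]
    ring
  have hzero := eq_zero_of_tendsto_of_le_sqrt_mul (K := ‖F.u.dx‖)
    (integrableOn_norm_sq_flux h.flux_eq) (fun x hx => by
      refine (abs_real_inner_le_norm _ _).trans ?_
      exact mul_le_mul_of_nonneg_right (F.u.norm_fn_le (Ioo_subset_Icc_self hx)) (norm_nonneg _))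
    hlim
  rw [hlhs, ← integral_Ioc_eq_integral_Ioo, ← intervalIntegral.integral_of_le zero_le_one]
  linarith

/-- Integration by parts on `(1, 2)`, for elements of the domain. -/
theorem IsValue.heat_eq {U F : S.Energy} {q : ℝ → ℂ} {y : H1R} {z : H1 1 2} {Γ : ℝ → H1R}
    {γs : S.W} (h : IsValue U F q y z Γ γs) :
    ∫ x in Ioo (1 : ℝ) 2, inner ℂ (U.y x) (F.y x) =
      - inner ℂ (F.u.fn 1) (q 1) - inner ℂ y (zeta y U.γ) := by
  have h1 : ∫ x in Ioo (1 : ℝ) 2, inner ℂ (U.y x) (F.y x) =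
      ∫ x in Ioo (1 : ℝ) 2, inner ℂ (y.fn x) (z.1.2 x) := by
    rw [h.zeta_deriv]
    refine integral_congr_ae ?_
    filter_upwards [h.y_eq] with x hx
    rw [hx]
  rw [h1, y.integral_inner_eq z, h.v_one, h.flux_one, H1R.inner_eq, L2.inner_def]
  congr 1
  refine integral_congr_ae ?_
  filter_upwards [h.zeta_eq] with x hx
  rw [hx]

/-! ### Dissipativity: the memory part -/

variable (S) in
/-- The weight `c m μ`. -/
def memoryWeight (s : ℝ) : ℝ := S.c * S.m * S.μ s

theorem c_mul_m_nonneg : 0 ≤ S.c * S.m := mul_nonneg S.c_pos.le S.m_mem.1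

theorem memoryWeight_nonneg {s : ℝ} (hs : 0 < s) : 0 ≤ S.memoryWeight s :=
  mul_nonneg c_mul_m_nonneg (S.μ_nonneg s hs)

theorem memoryWeight_antitone {s t : ℝ} (hs : 0 < s) (hst : s ≤ t) :
    S.memoryWeight t ≤ S.memoryWeight s :=
  mul_le_mul_of_nonneg_left (S.μ_antitone hs (hs.trans_le hst) hst) c_mul_m_nonneg

/-- The value at `0` stands for the limit there, which bounds the decreasing weight. -/
theorem memoryWeight_le {s : ℝ} (hs : 0 < s) : S.memoryWeight s ≤ S.memoryWeight 0 := by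
  refine mul_le_mul_of_nonneg_left ?_ c_mul_m_nonneg
  refine ge_of_tendsto S.μ_tendsto ?_
  filter_upwards [Ioc_mem_nhdsGT hs] with t ht
  exact S.μ_antitone ht.1 hs ht.2

theorem continuousOn_memoryWeight : ContinuousOn S.memoryWeight (Ioi 0) :=
  continuousOn_const.mul S.μ_contDiff.continuousOn

theorem nonneg_of_mem_memoryInterval {T : ℝ} (hT : T ∈ S.memoryInterval) : 0 ≤ T := by
  rcases hT with rfl | hT
  exacts [le_rfl, hT.1.le]

theorem zero_mem_memoryInterval : (0 : ℝ) ∈ S.memoryInterval := Or.inl rfl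

theorem Icc_subset_memoryInterval {T : ℝ} (hT : T ∈ S.memoryInterval) :
    Icc 0 T ⊆ S.memoryInterval := OrdConnected.out inferInstance zero_mem_memoryInterval hT

instance : Nonempty S.memoryInterval := ⟨⟨0, zero_mem_memoryInterval⟩⟩

variable (S) in
-- The kernel may vanish beyond some point, where an element of `W` carries no information.
-- Integrals are therefore exhausted by `(0, T]` with `T` in the memory interval, on which the
-- weight is bounded below by its value at `T` when `T > 0`.
theorem aecover_memory : AECover S.memoryMeasure atTop
    (fun T : S.memoryInterval => Ioc (0 : ℝ) T) where
  ae_eventually_mem := by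
    have h0 : ∀ᵐ s : ℝ, s ≠ 0 := by simp [ae_iff]
    refine ae_memory.2 ?_
    filter_upwards [h0] with s hs hsI
    filter_upwards [eventually_ge_atTop (⟨s, hsI⟩ : S.memoryInterval)] with T hT
    exact ⟨lt_of_le_of_ne (nonneg_of_mem_memoryInterval hsI) (Ne.symm hs), hT⟩
  measurableSet _ := measurableSet_Ioc

theorem restrict_memoryMeasure (T : ℝ) : S.memoryMeasure.restrict (Ioc 0 T) =
    (volume.restrict (Ioc 0 T)).withDensity fun s => ENNReal.ofReal (S.memoryWeight s) := by
  rw [memoryMeasure, restrict_withDensity measurableSet_Ioc,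
    Measure.restrict_restrict measurableSet_Ioc,
    inter_eq_self_of_subset_left Ioc_subset_Ioi_self]
  rfl

theorem aemeasurable_memoryWeight (T : ℝ) :
    AEMeasurable (fun s => ENNReal.ofReal (S.memoryWeight s)) (volume.restrict (Ioc 0 T)) :=
  ((continuousOn_memoryWeight.mono Ioc_subset_Ioi_self).aemeasurable
    measurableSet_Ioc).ennreal_ofReal

theorem setIntegral_memory {E : Type*} [NormedAddCommGroup E] [NormedSpace ℝ E] (f : ℝ → E)
    {T : ℝ} (hT : 0 ≤ T) :
    ∫ s in Ioc 0 T, f s ∂S.memoryMeasure = ∫ s in 0..T, S.memoryWeight s • f s := by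
  rw [restrict_memoryMeasure, integral_withDensity_eq_integral_toReal_smul₀
    (aemeasurable_memoryWeight T) (Eventually.of_forall fun _ => ENNReal.ofReal_lt_top),
    intervalIntegral.integral_of_le hT]
  refine setIntegral_congr_fun measurableSet_Ioc fun s hs => ?_
  rw [ENNReal.toReal_ofReal (memoryWeight_nonneg hs.1)]

theorem integrableOn_memory_iff {E : Type*} [NormedAddCommGroup E] [NormedSpace ℝ E] {f : ℝ → E}
    {T : ℝ} : IntegrableOn f (Ioc 0 T) S.memoryMeasure ↔
      IntegrableOn (fun s => S.memoryWeight s • f s) (Ioc 0 T) := by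
  rw [IntegrableOn, restrict_memoryMeasure, integrable_withDensity_iff_integrable_smul₀'
    (aemeasurable_memoryWeight T) (Eventually.of_forall fun _ => ENNReal.ofReal_lt_top)]
  refine integrable_congr ((ae_restrict_iff' measurableSet_Ioc).2
    (Eventually.of_forall fun s hs => ?_))
  simp only
  rw [ENNReal.toReal_ofReal (memoryWeight_nonneg hs.1)]

theorem restrict_absolutelyContinuous_memory {T : ℝ} (hT : T ∈ S.memoryInterval) :
    volume.restrict (Ioc 0 T) ≪ S.memoryMeasure := by
  rw [← Measure.ae_le_iff_absolutelyContinuous]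
  intro s hs
  refine (ae_restrict_iff' measurableSet_Ioc).2 ?_
  filter_upwards [ae_memory.1 (show ∀ᵐ x ∂S.memoryMeasure, x ∈ s from hs)] with x hx hxT
  exact hx (Icc_subset_memoryInterval hT (Ioc_subset_Icc_self hxT))

/-- Elements of the memory space are integrable on compact subintervals. -/
theorem integrableOn_of_integrable_memory {E : Type*} [NormedAddCommGroup E] [NormedSpace ℝ E]
    {f : ℝ → E} (hf : Integrable f S.memoryMeasure) {T : ℝ} (hT : T ∈ S.memoryInterval) :
    IntegrableOn f (Ioc 0 T) := by
  rcases hT with rfl | hT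
  · simp
  have hw : 0 < S.memoryWeight T := hT.2
  have h1 := integrableOn_memory_iff.1 (hf.integrableOn (s := Ioc 0 T))
  refine Integrable.mono' (h1.norm.const_mul (S.memoryWeight T)⁻¹)
    (hf.aestronglyMeasurable.mono_ac (restrict_absolutelyContinuous_memory (Or.inr hT))) ?_
  refine (ae_restrict_iff' measurableSet_Ioc).2 (Eventually.of_forall fun s hs => ?_)
  have h2 := memoryWeight_antitone (S := S) hs.1 hs.2
  rw [norm_smul, Real.norm_of_nonneg (memoryWeight_nonneg hs.1), inv_mul_eq_div,
    le_div_iff₀ hw, mul_comm]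
  exact mul_le_mul_of_nonneg_right h2 (norm_nonneg _)

theorem intervalIntegrable_memory (γ : S.W) {s t : ℝ} (hs : s ∈ S.memoryInterval)
    (ht : t ∈ S.memoryInterval) : IntervalIntegrable γ volume s t := by
  have h : ∀ T ∈ S.memoryInterval, IntervalIntegrable γ volume 0 T := fun T hT => by
    rw [intervalIntegrable_iff_integrableOn_Ioc_of_le (nonneg_of_mem_memoryInterval hT)]
    exact integrableOn_of_integrable_memory (integrable_memory γ) hT
  exact (h s hs).symm.trans (h t ht)

theorem intervalIntegrable_memoryWeight_mul {g : ℝ → ℝ} {T : ℝ} (hT : 0 ≤ T)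
    (hg : IntervalIntegrable g volume 0 T) :
    IntervalIntegrable (fun s => S.memoryWeight s * g s) volume 0 T := by
  rw [intervalIntegrable_iff_integrableOn_Ioc_of_le hT] at hg ⊢
  refine Integrable.bdd_mul (c := S.memoryWeight 0) hg ?_ ?_
  · exact (continuousOn_memoryWeight.mono Ioc_subset_Ioi_self).aestronglyMeasurable
      measurableSet_Ioc
  · refine (ae_restrict_iff' measurableSet_Ioc).2 (Eventually.of_forall fun s hs => ?_)
    rw [Real.norm_of_nonneg (memoryWeight_nonneg hs.1)]
    exact memoryWeight_le hs.1

theorem isPrimitiveOn_memoryWeight :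
    IsPrimitiveOn (Ioi 0) S.memoryWeight (fun s => S.c * S.m * deriv S.μ s) := by
  refine isPrimitiveOn_of_le fun x hx y hy hxy => ?_
  have hsub : uIcc x y ⊆ Ioi 0 := by
    rw [uIcc_of_le hxy]
    exact fun s hs => lt_of_lt_of_le hx hs.1
  have hc : ContinuousOn (fun s => S.c * S.m * deriv S.μ s) (Ioi 0) :=
    continuousOn_const.mul (S.μ_contDiff.continuousOn_deriv_of_isOpen isOpen_Ioi le_rfl)
  refine ⟨(hc.mono hsub).intervalIntegrable, ?_⟩
  rw [intervalIntegral.integral_eq_sub_of_hasDerivAt (f := S.memoryWeight) (fun s hs => ?_)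
    (hc.mono hsub).intervalIntegrable]
  have h1 : DifferentiableAt ℝ S.μ s :=
    (S.μ_contDiff.differentiableOn one_ne_zero).differentiableAt (isOpen_Ioi.mem_nhds (hsub hs))
  exact h1.hasDerivAt.const_mul _

theorem deriv_memoryWeight_nonpos {s : ℝ} (hs : 0 < s) : S.c * S.m * deriv S.μ s ≤ 0 := by
  obtain ⟨K, hK, h⟩ := S.μ_dafermos
  have h1 := h s hs
  have h2 := mul_nonneg hK.le (S.μ_nonneg s hs)
  exact mul_nonpos_of_nonneg_of_nonpos c_mul_m_nonneg (by linarith)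

theorem isBoundedBilinearMap_re_inner (E : Type*) [NormedAddCommGroup E] [InnerProductSpace ℂ E] :
    IsBoundedBilinearMap ℝ (fun p : E × E => (inner ℂ p.1 p.2).re) := by
  let _ : InnerProductSpace ℝ E := InnerProductSpace.complexToReal
  exact isBoundedBilinearMap_inner (𝕜 := ℝ)

/-- The memory damps: `∫₀ᵀ c m μ(s) Re ⟨Γ, Γ_s⟩ ds ≥ 0` if `Γ(0) = 0`. -/
theorem integral_re_inner_nonneg {Γ γs : ℝ → H1R} (hΓ : IsPrimitiveOn S.memoryInterval Γ γs)
    (h0 : Γ 0 = 0) {T : ℝ} (hT : T ∈ S.memoryInterval) :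
    IntervalIntegrable (fun s => S.memoryWeight s * (inner ℂ (Γ s) (γs s)).re) volume 0 T ∧
      0 ≤ ∫ s in 0..T, S.memoryWeight s * (inner ℂ (Γ s) (γs s)).re := by
  have hT0 := nonneg_of_mem_memoryInterval hT
  have hsub := Icc_subset_memoryInterval hT
  set g : ℝ → ℝ := fun s => (inner ℂ (Γ s) (Γ s)).re with hg
  set g' : ℝ → ℝ := fun s => 2 * (inner ℂ (Γ s) (γs s)).re with hg'
  have hgp : IsPrimitiveOn (Icc 0 T) g g' := by
    have h1 := (hΓ.mono hsub).bilin (isBoundedBilinearMap_re_inner H1R) (hΓ.mono hsub)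
    refine h1.congr (fun _ _ => rfl) (Eventually.of_forall fun s _ => ?_)
    have h2 : (inner ℂ (γs s) (Γ s)).re = (inner ℂ (Γ s) (γs s)).re := inner_re_symm (𝕜 := ℂ) _ _
    simp only [hg']
    rw [h2]
    ring
  have hgi : IntervalIntegrable g' volume 0 T :=
    (hgp 0 (left_mem_Icc.2 hT0) T (right_mem_Icc.2 hT0)).1
  have hi : IntervalIntegrable (fun s => S.memoryWeight s * g' s) volume 0 T :=
    intervalIntegrable_memoryWeight_mul hT0 hgi
  have hgn : ∀ s, 0 ≤ g s := fun s => inner_self_nonneg (𝕜 := ℂ)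
  have hg0 : g 0 = 0 := by simp [hg, h0]
  have key : 0 ≤ ∫ s in 0..T, S.memoryWeight s * g' s := by
    rcases hT0.eq_or_lt with h | hTpos
    · simp [← h]
    have hcont : ContinuousOn (fun e => ∫ s in e..T, S.memoryWeight s * g' s) (Icc 0 T) := by
      have h1 := intervalIntegral.continuousOn_primitive_interval' hi right_mem_uIcc
      rw [uIcc_of_le hT0] at h1
      refine h1.neg.congr fun x _ => ?_
      rw [intervalIntegral.integral_symm]
      rfl
    have hfilter : ∀ {φ : ℝ → ℝ}, ContinuousOn φ (Icc 0 T) → Tendsto φ (𝓝[>] 0) (𝓝 (φ 0)) := by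
      intro φ hφ
      have := (hφ 0 (left_mem_Icc.2 hT0)).mono_left
        (nhdsWithin_mono _ (Ioc_subset_Icc_self (a := (0 : ℝ)) (b := T)))
      rwa [nhdsWithin_Ioc_eq_nhdsGT hTpos] at this
    have hlim := hfilter hcont
    have hlimg : Tendsto (fun e => -(S.memoryWeight 0 * g e)) (𝓝[>] 0) (𝓝 0) := by
      have := ((hfilter hgp.continuousOn_Icc).const_mul (S.memoryWeight 0)).neg
      simpa [hg0] using this
    refine le_of_tendsto_of_tendsto hlimg hlim ?_
    -- The weight is known to be `C¹` only on the open half-line, so parts are taken on `[e, T]`.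
    -- Writing `w` for the weight, the terms `w(T) g(T)` and `-∫ w' g` are nonnegative, and `w(e)
    -- g(e) ≤ w(0) g(e)` tends to `0` with `e`.
    filter_upwards [Ioc_mem_nhdsGT hTpos] with e he
    have hsub1 : Icc e T ⊆ Ioi 0 := fun s hs => lt_of_lt_of_le he.1 hs.1
    have hsub2 : Icc e T ⊆ Icc 0 T := Icc_subset_Icc_left he.1.le
    have hwp := isPrimitiveOn_memoryWeight (S := S) |>.mono hsub1
    have hgp' := hgp.mono hsub2
    have heI := left_mem_Icc.2 he.2
    have hTI := right_mem_Icc.2 he.2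
    have hb : IsBoundedBilinearMap ℝ (fun p : ℝ × ℝ => p.1 * p.2) := isBoundedBilinearMap_mul
    have h1 := (hwp.bilin hb hgp' e heI T hTI).2
    have hi1 := intervalIntegrable_bilin hb he.2 (hwp e heI T hTI).1 hgp'.continuousOn_Icc
    have hi2 := intervalIntegrable_bilin (IsBoundedBilinearMap.swap hb) he.2 (hgp' e heI T hTI).1
      hwp.continuousOn_Icc
    simp only at h1 hi1 hi2
    rw [intervalIntegral.integral_add hi1 hi2] at h1
    have h2 : ∫ s in e..T, S.c * S.m * deriv S.μ s * g s ≤ 0 := by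
      rw [← neg_nonneg, ← intervalIntegral.integral_neg]
      refine intervalIntegral.integral_nonneg he.2 fun s hs => neg_nonneg.2 ?_
      exact mul_nonpos_of_nonpos_of_nonneg (deriv_memoryWeight_nonpos (hsub1 hs)) (hgn s)
    have h3 := mul_nonneg (memoryWeight_nonneg (S := S) hTpos) (hgn T)
    have h4 := mul_le_mul_of_nonneg_right (memoryWeight_le (S := S) he.1) (hgn e)
    linarith
  have heq : ∀ s, S.memoryWeight s * g' s =
      2 * (S.memoryWeight s * (inner ℂ (Γ s) (γs s)).re) := fun s => by
    simp only [hg']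
    ring
  simp_rw [heq] at hi key
  rw [intervalIntegral.integral_const_mul] at key
  refine ⟨?_, by linarith⟩
  have := hi.const_mul (1 / 2)
  refine this.congr fun s _ => ?_
  ring

theorem IsValue.re_inner_memory_nonneg {U F : S.Energy} {q : ℝ → ℂ} {y : H1R} {z : H1 1 2}
    {Γ : ℝ → H1R} {γs : S.W} (h : IsValue U F q y z Γ γs) : 0 ≤ (inner ℂ U.γ γs).re := by
  have hi : Integrable (fun s => inner ℂ (U.γ s) (γs s)) S.memoryMeasure :=
    L2.integrable_inner _ _
  have h1 : (inner ℂ U.γ γs).re = ∫ s, (inner ℂ (Γ s) (γs s)).re ∂S.memoryMeasure := by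
    rw [L2.inner_def]
    refine (integral_re hi).symm.trans (integral_congr_ae ?_)
    filter_upwards [h.γ_eq] with s hs
    rw [hs]
    rfl
  have hi' : Integrable (fun s => (inner ℂ (Γ s) (γs s)).re) S.memoryMeasure := by
    refine hi.re.congr ?_
    filter_upwards [h.γ_eq] with s hs
    rw [hs]
    rfl
  rw [h1]
  refine ge_of_tendsto ((aecover_memory S).integral_tendsto_of_countably_generated hi')
    (Eventually.of_forall fun T => ?_)
  rw [setIntegral_memory _ (nonneg_of_mem_memoryInterval T.2)]
  exact (integral_re_inner_nonneg h.γ_deriv h.γ_zero T.2).2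

theorem integral_inner_memory_const (γ : S.W) (y : H1R) :
    ∫ s, inner ℂ (γ s) y ∂S.memoryMeasure = inner ℂ (∫ s, γ s ∂S.memoryMeasure) y := by
  rw [← inner_conj_symm, ← integral_inner (integrable_memory γ), ← integral_conj]
  simp

theorem IsValue.memory_eq {U F : S.Energy} {q : ℝ → ℂ} {y : H1R} {z : H1 1 2}
    {Γ : ℝ → H1R} {γs : S.W} (h : IsValue U F q y z Γ γs) :
    ∫ s, inner ℂ (U.γ s) (F.γ s) ∂S.memoryMeasure =
      inner ℂ (∫ s, U.γ s ∂S.memoryMeasure) y - inner ℂ U.γ γs := by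
  have hi1 : Integrable (fun s => inner ℂ (U.γ s) (γs s)) S.memoryMeasure :=
    L2.integrable_inner _ _
  have hi2 : Integrable (fun s => inner ℂ (U.γ s) y) S.memoryMeasure := by
    have := (integrable_memory U.γ).const_inner (𝕜 := ℂ) y
    refine ((RCLike.conjCLE (K := ℂ)).toContinuousLinearMap.integrable_comp this).congr
      (Eventually.of_forall fun s => ?_)
    simp
  rw [← integral_inner_memory_const, L2.inner_def, ← integral_sub hi2 hi1]
  refine integral_congr_ae ?_
  filter_upwards [h.γ_value] with s hs
  rw [hs, inner_add_right, inner_neg_right]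
  ring

/-- The boundary terms at `1` from wave and heat cancel. The pairing of `y` with the memory integral
occurs once from `ζ` and once, conjugated and with opposite sign, from the equation for `γ`. What is
left is `-c(1-m)‖y‖² - Re⟨γ, γ_s⟩`. -/
theorem IsValue.dissipative {U F : S.Energy} {q : ℝ → ℂ} {y : H1R} {z : H1 1 2}
    {Γ : ℝ → H1R} {γs : S.W} (h : IsValue U F q y z Γ γs) : (inner ℂ U F).re ≤ 0 := by
  rw [energy_inner, ← add_assoc, Complex.add_re, h.re_wave_eq, h.heat_eq, h.memory_eq,
    zeta_eq_integral]
  have h1 : (inner ℂ y (((S.c * (1 - S.m) : ℝ) : ℂ) • y + ∫ s, U.γ s ∂S.memoryMeasure)).re =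
      S.c * (1 - S.m) * ‖y‖ ^ 2 + (inner ℂ (∫ s, U.γ s ∂S.memoryMeasure) y).re := by
    have h2 : (inner ℂ y (∫ s, U.γ s ∂S.memoryMeasure)).re =
        (inner ℂ (∫ s, U.γ s ∂S.memoryMeasure) y).re := inner_re_symm (𝕜 := ℂ) _ _
    have h3 : (inner ℂ y y).re = ‖y‖ ^ 2 := inner_self_eq_norm_sq (𝕜 := ℂ) y
    rw [inner_add_right, inner_smul_right, Complex.add_re, Complex.re_ofReal_mul, h2, h3]
  have h4 : (inner ℂ (F.u.fn 1) (q 1)).re = inner ℝ (F.u.fn 1) (q 1) := by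
    rw [Complex.inner, RCLike.inner_apply, mul_comm]
  have h5 := h.re_inner_memory_nonneg
  have h6 : 0 ≤ S.c * (1 - S.m) * ‖y‖ ^ 2 :=
    mul_nonneg (mul_nonneg S.c_pos.le (sub_nonneg.2 S.m_mem.2)) (sq_nonneg _)
  simp only [Complex.add_re, Complex.sub_re, Complex.neg_re] at h1 ⊢
  rw [h1, h4]
  linarith

/-! ### The resolvent equation: the memory part -/

theorem isPrimitiveOn_exp (I : Set ℝ) (r : ℝ) :
    IsPrimitiveOn I (fun s => Real.exp (r * s)) (fun s => r * Real.exp (r * s)) := by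
  intro x _ y _
  have hc : Continuous fun s => r * Real.exp (r * s) := by fun_prop
  refine ⟨hc.intervalIntegrable _ _, ?_⟩
  rw [intervalIntegral.integral_eq_sub_of_hasDerivAt (f := fun s => Real.exp (r * s))
    (fun s _ => ?_) (hc.intervalIntegrable _ _)]
  have := ((hasDerivAt_id s).const_mul r).exp
  simpa [mul_comm] using this

/-- Variation of constants: `Φ(s) = e^{-ls} ∫₀ˢ e^{lt} f(t) dt`. -/
theorem exists_memory_primitive (f : S.W) (l : ℝ) :
    ∃ Φ : ℝ → H1R, Φ 0 = 0 ∧ IsPrimitiveOn S.memoryInterval Φ (fun s => f s - l • Φ s) := by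
  set J : ℝ → H1R := fun s => ∫ t in 0..s, Real.exp (l * t) • f t with hJ
  have hint : ∀ x ∈ S.memoryInterval, ∀ y ∈ S.memoryInterval,
      IntervalIntegrable (fun t => Real.exp (l * t) • f t) volume x y := by
    intro x hx y hy
    have hc : ContinuousOn (fun t => Real.exp (l * t)) (uIcc x y) := by fun_prop
    exact (intervalIntegrable_memory f hx hy).continuousOn_smul hc
  have hJp : IsPrimitiveOn S.memoryInterval J (fun t => Real.exp (l * t) • f t) := by
    simpa using isPrimitiveOn_integral hint zero_mem_memoryInterval 0
  refine ⟨fun s => Real.exp (-l * s) • J s, by simp [hJ], ?_⟩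
  have hb : IsBoundedBilinearMap ℝ (fun p : ℝ × H1R => p.1 • p.2) := isBoundedBilinearMap_smul
  refine ((isPrimitiveOn_exp S.memoryInterval (-l)).bilin hb hJp).congr (fun _ _ => rfl)
    (Eventually.of_forall fun s _ => ?_)
  have h1 : Real.exp (-l * s) * Real.exp (l * s) = 1 := by
    rw [← Real.exp_add]
    simp
  simp only
  rw [smul_smul, h1, one_smul, mul_smul, neg_smul]
  abel

/-- The damping inequality applied to `Φ_s = f - lΦ` gives `0 ≤ ∫ Re⟨Φ, f - lΦ⟩` over `(0, T]` for
the memory measure. Young's inequality absorbs half of `l‖Φ‖²`, leaving `l² ∫ ‖Φ‖² ≤ ∫ ‖f‖²`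
uniformly in `T`. -/
theorem memLp_of_isPrimitiveOn {l : ℝ} (hl : 0 < l) (f : S.W) {Φ : ℝ → H1R} (h0 : Φ 0 = 0)
    (hΦ : IsPrimitiveOn S.memoryInterval Φ (fun s => f s - l • Φ s)) :
    MemLp Φ 2 S.memoryMeasure := by
  have hcont : ∀ T : S.memoryInterval, ContinuousOn Φ (Icc 0 T) := fun T =>
    (hΦ.mono (Icc_subset_memoryInterval T.2)).continuousOn_Icc
  have hmeas : AEStronglyMeasurable Φ S.memoryMeasure :=
    (aecover_memory S).aestronglyMeasurable fun T =>
      ((hcont T).mono Ioc_subset_Icc_self).aestronglyMeasurable measurableSet_Ioc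
  have hf2 : Integrable (fun s => ‖f s‖ ^ 2) S.memoryMeasure :=
    (memLp_two_iff_integrable_sq_norm (Lp.aestronglyMeasurable f)).1 (Lp.memLp f)
  have hΦ2 : ∀ T : S.memoryInterval, IntegrableOn (fun s => ‖Φ s‖ ^ 2) (Ioc 0 T)
      S.memoryMeasure := by
    intro T
    obtain ⟨M, hM⟩ := isCompact_Icc.exists_bound_of_continuousOn (hcont T)
    refine Integrable.of_bound ((hmeas.norm.pow 2).restrict) (M ^ 2) ?_
    refine (ae_restrict_iff' measurableSet_Ioc).2 (Eventually.of_forall fun s hs => ?_)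
    rw [norm_pow, norm_norm]
    exact pow_le_pow_left₀ (norm_nonneg _) (hM s (Ioc_subset_Icc_self hs)) 2
  rw [memLp_two_iff_integrable_sq_norm hmeas]
  refine (aecover_memory S).integrable_of_integral_norm_bounded
    ((l ^ 2)⁻¹ * ∫ s, ‖f s‖ ^ 2 ∂S.memoryMeasure) hΦ2 (Eventually.of_forall fun T => ?_)
  have hT0 := nonneg_of_mem_memoryInterval T.2
  obtain ⟨hi, hpos⟩ := integral_re_inner_nonneg hΦ h0 T.2
  have hi' : IntegrableOn (fun s => (inner ℂ (Φ s) (f s - l • Φ s)).re) (Ioc 0 T)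
      S.memoryMeasure := by
    rw [integrableOn_memory_iff]
    rwa [intervalIntegrable_iff_integrableOn_Ioc_of_le hT0] at hi
  have hpos' : 0 ≤ ∫ s in Ioc (0 : ℝ) T, (inner ℂ (Φ s) (f s - l • Φ s)).re ∂S.memoryMeasure := by
    rw [setIntegral_memory _ hT0]
    exact hpos
  have hmono : ∫ s in Ioc (0 : ℝ) T, (inner ℂ (Φ s) (f s - l • Φ s)).re ∂S.memoryMeasure ≤
      ∫ s in Ioc (0 : ℝ) T, ((2 * l)⁻¹ * ‖f s‖ ^ 2 - l / 2 * ‖Φ s‖ ^ 2) ∂S.memoryMeasure := by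
    refine setIntegral_mono hi'
      ((hf2.integrableOn.const_mul _).sub ((hΦ2 T).const_mul _)) fun s => ?_
    have h1 : (inner ℂ (Φ s) (f s - l • Φ s)).re =
        (inner ℂ (Φ s) (f s)).re - l * ‖Φ s‖ ^ 2 := by
      have h2 : (inner ℂ (Φ s) (Φ s)).re = ‖Φ s‖ ^ 2 := inner_self_eq_norm_sq (𝕜 := ℂ) _
      rw [inner_sub_right, ← Complex.coe_smul, inner_smul_right, Complex.sub_re,
        Complex.re_ofReal_mul, h2]
    have h3 : (inner ℂ (Φ s) (f s)).re ≤ ‖Φ s‖ * ‖f s‖ :=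
      (Complex.re_le_norm _).trans (norm_inner_le_norm _ _)
    have h4 : ‖Φ s‖ * ‖f s‖ ≤ (2 * l)⁻¹ * ‖f s‖ ^ 2 + l / 2 * ‖Φ s‖ ^ 2 := by
      have h5 : (2 * l)⁻¹ * ‖f s‖ ^ 2 + l / 2 * ‖Φ s‖ ^ 2 - ‖Φ s‖ * ‖f s‖ =
          (2 * l)⁻¹ * (‖f s‖ - l * ‖Φ s‖) ^ 2 := by
        field_simp
        ring
      have h6 : 0 ≤ (2 * l)⁻¹ * (‖f s‖ - l * ‖Φ s‖) ^ 2 := by positivity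
      linarith
    rw [h1]
    linarith
  rw [integral_sub (hf2.integrableOn.const_mul _) ((hΦ2 T).const_mul _), integral_const_mul,
    integral_const_mul] at hmono
  have hle : ∫ s in Ioc (0 : ℝ) T, ‖f s‖ ^ 2 ∂S.memoryMeasure ≤
      ∫ s, ‖f s‖ ^ 2 ∂S.memoryMeasure :=
    setIntegral_le_integral hf2 (Eventually.of_forall fun s => sq_nonneg _)
  have heq : ∫ s in Ioc (0 : ℝ) T, ‖‖Φ s‖ ^ 2‖ ∂S.memoryMeasure =
      ∫ s in Ioc (0 : ℝ) T, ‖Φ s‖ ^ 2 ∂S.memoryMeasure := by simp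
  rw [heq, inv_mul_eq_div, le_div_iff₀ (by positivity)]
  have h7 := hpos'.trans hmono
  have h8 : l / 2 * ∫ s in Ioc (0 : ℝ) T, ‖Φ s‖ ^ 2 ∂S.memoryMeasure ≤
      (2 * l)⁻¹ * ∫ s in Ioc (0 : ℝ) T, ‖f s‖ ^ 2 ∂S.memoryMeasure := by linarith
  rw [inv_mul_eq_div, le_div_iff₀ (by positivity)] at h8
  nlinarith

/-- The solution `(1 - e^{-ls}) / l` of `p_s + l p = 1`, `p(0) = 0`. -/
noncomputable def unitResponse (l s : ℝ) : ℝ := l⁻¹ * (1 - Real.exp (-l * s))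

theorem isPrimitiveOn_unitResponse {l : ℝ} (hl : 0 < l) (I : Set ℝ) (y : H1R) :
    IsPrimitiveOn I (fun s => unitResponse l s • y)
      (fun s => y - l • (unitResponse l s • y)) := by
  intro x hx z hz
  obtain ⟨h1, h2⟩ := isPrimitiveOn_exp I (-l) x hx z hz
  have h3 : ∀ s, y - l • (unitResponse l s • y) =
      (-l⁻¹ * (-l * Real.exp (-l * s))) • y := fun s => by
    rw [smul_smul, unitResponse, mul_inv_cancel_left₀ hl.ne', sub_smul, one_smul, sub_sub_cancel]
    congr 1
    field_simp
  simp_rw [h3]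
  have h4 := h1.const_mul (-l⁻¹)
  refine ⟨⟨h4.1.smul_const y, h4.2.smul_const y⟩, ?_⟩
  rw [intervalIntegral.integral_smul_const, intervalIntegral.integral_const_mul, ← h2, ← sub_smul]
  congr 1
  simp only [unitResponse]
  ring

theorem unitResponse_mem {l s : ℝ} (hl : 0 < l) (hs : 0 < s) :
    0 < unitResponse l s ∧ unitResponse l s ≤ l⁻¹ := by
  have h1 : Real.exp (-l * s) < 1 := by
    rw [Real.exp_lt_one_iff]
    nlinarith
  have h2 := Real.exp_pos (-l * s)
  have h3 : 0 < l⁻¹ := inv_pos.2 hl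
  exact ⟨mul_pos h3 (by linarith), by unfold unitResponse; nlinarith⟩

theorem ae_pos_memory : ∀ᵐ s ∂S.memoryMeasure, 0 < s := by
  have h0 : ∀ᵐ s : ℝ, s ≠ 0 := by simp [ae_iff]
  refine ae_memory.2 ?_
  filter_upwards [h0] with s hs hsI
  exact lt_of_le_of_ne (nonneg_of_mem_memoryInterval hsI) (Ne.symm hs)

theorem continuous_unitResponse (l : ℝ) : Continuous (unitResponse l) := by
  unfold unitResponse
  fun_prop

theorem integrable_unitResponse {l : ℝ} (hl : 0 < l) :
    Integrable (unitResponse l) S.memoryMeasure := by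
  refine Integrable.of_bound (continuous_unitResponse l).aestronglyMeasurable l⁻¹ ?_
  filter_upwards [ae_pos_memory] with s hs
  obtain ⟨h1, h2⟩ := unitResponse_mem hl hs
  rwa [Real.norm_of_nonneg h1.le]

variable (S) in
/-- The effective conductivity `c (1 - m) + c m ∫₀^∞ μ(s) (1 - e^{-ls}) / l ds`. -/
noncomputable def conductivity (l : ℝ) : ℝ :=
  S.c * (1 - S.m) + ∫ s, unitResponse l s ∂S.memoryMeasure

/-- For `m < 1` the Fourier part is positive. For `m = 1` the memory part is positive:
`unitResponse` is strictly positive for `s > 0`, and the memory measure is nonzero because `∫ μ >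
0`. -/
theorem conductivity_pos {l : ℝ} (hl : 0 < l) : 0 < S.conductivity l := by
  have hnn : 0 ≤ᵐ[S.memoryMeasure] unitResponse l := by
    filter_upwards [ae_pos_memory] with s hs using (unitResponse_mem hl hs).1.le
  have h1 : 0 ≤ ∫ s, unitResponse l s ∂S.memoryMeasure := integral_nonneg_of_ae hnn
  rcases S.m_mem.2.lt_or_eq with hm | hm
  · have := mul_pos S.c_pos (sub_pos.2 hm)
    unfold conductivity
    linarith
  have h2 : 0 < ∫ s, unitResponse l s ∂S.memoryMeasure := by
    refine lt_of_le_of_ne h1 fun h => ?_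
    have h3 := (integral_eq_zero_iff_of_nonneg_ae hnn (integrable_unitResponse hl)).1 h.symm
    have h4 : ∀ᵐ s ∂S.memoryMeasure, False := by
      filter_upwards [h3, ae_pos_memory] with s h5 h6
      exact (unitResponse_mem hl h6).1.ne' h5
    have h5 : S.memoryMeasure univ = 0 := by simpa [ae_iff] using h4
    rw [memoryMeasure, withDensity_apply _ MeasurableSet.univ, Measure.restrict_univ,
      ← ofReal_integral_eq_lintegral_ofReal S.integrable_μ
        ((ae_restrict_iff' measurableSet_Ioi).2 (Eventually.of_forall fun s hs =>
          memoryWeight_nonneg (S := S) hs)), integral_const_mul, ENNReal.ofReal_eq_zero] at h5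
    have h6 := mul_pos (mul_pos S.c_pos (show 0 < S.m by rw [hm]; exact one_pos)) S.μ_integral_pos
    linarith
  have h3 := mul_nonneg S.c_pos.le (sub_nonneg.2 S.m_mem.2)
  unfold conductivity
  linarith

/-- The memory component of the resolvent equation, for a given third component. -/
theorem exists_memory_solution {l : ℝ} (hl : 0 < l) (f : S.W) :
    ∃ φ : H1R, ∀ y : H1R, ∃ (γ γs : S.W) (Γ : ℝ → H1R), γ =ᵐ[S.memoryMeasure] Γ ∧ Γ 0 = 0 ∧
      IsPrimitiveOn S.memoryInterval Γ γs ∧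
      ((l : ℂ) • γ - f : S.W) =ᵐ[S.memoryMeasure] (fun s => -γs s + y) ∧
      zeta y γ = (S.conductivity l : ℂ) • y + φ := by
  obtain ⟨Φ, h0, hΦ⟩ := exists_memory_primitive f l
  have hΦm := memLp_of_isPrimitiveOn hl f h0 hΦ
  -- By linearity `γ = Φ + unitResponse · y`, where `Φ` depends on `f` alone. Hence `φ` is chosen
  -- before `y`, and `ζ` is affine in `y`.
  refine ⟨∫ s, Φ s ∂S.memoryMeasure, fun y => ?_⟩
  set Γ : ℝ → H1R := fun s => Φ s + unitResponse l s • y with hΓ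
  have hym : MemLp (fun _ : ℝ => y) 2 S.memoryMeasure := memLp_const y
  have hum : MemLp (fun s => unitResponse l s • y) 2 S.memoryMeasure := by
    refine MemLp.of_bound ?_ (l⁻¹ * ‖y‖) ?_
    · exact ((continuous_unitResponse l).smul continuous_const).aestronglyMeasurable
    · filter_upwards [ae_pos_memory] with s hs
      obtain ⟨h1, h2⟩ := unitResponse_mem hl hs
      rw [norm_smul, Real.norm_of_nonneg h1.le]
      exact mul_le_mul_of_nonneg_right h2 (norm_nonneg _)
  have hΓm : MemLp Γ 2 S.memoryMeasure := hΦm.add hum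
  set γ : S.W := hΓm.toLp with hγ
  have hγe : γ =ᵐ[S.memoryMeasure] Γ := hΓm.coeFn_toLp
  set γs : S.W := f + hym.toLp - (l : ℂ) • γ with hγs
  have hγse : γs =ᵐ[S.memoryMeasure] fun s => f s + y - l • Γ s := by
    filter_upwards [Lp.coeFn_sub (f + hym.toLp) ((l : ℂ) • γ), Lp.coeFn_add f hym.toLp,
      Lp.coeFn_smul (l : ℂ) γ, hym.coeFn_toLp, hγe] with s h1 h2 h3 h4 h5
    rw [hγs, h1, Pi.sub_apply, h2, Pi.add_apply, h3, Pi.smul_apply, h4, h5, Complex.coe_smul]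
  refine ⟨γ, γs, Γ, hγe, ?_, ?_, ?_, ?_⟩
  · simp [hΓ, h0, unitResponse]
  · refine (hΦ.add (isPrimitiveOn_unitResponse hl S.memoryInterval y)).congr (fun _ _ => rfl) ?_
    filter_upwards [ae_memory.1 hγse] with s hs hsI
    rw [hs hsI]
    simp only [Pi.add_apply, hΓ, smul_add]
    abel
  · filter_upwards [hγse, Lp.coeFn_sub ((l : ℂ) • γ) f, Lp.coeFn_smul (l : ℂ) γ, hγe]
      with s h1 h2 h3 h4
    rw [h1, h2, Pi.sub_apply, h3, Pi.smul_apply, h4, Complex.coe_smul]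
    abel
  · rw [zeta_eq_integral, integral_congr_ae hγe]
    simp only [hΓ]
    rw [integral_add (hΦm.integrable (by norm_num)) (hum.integrable (by norm_num)),
      integral_smul_const, conductivity]
    push_cast
    rw [add_smul, Complex.coe_smul (∫ s, unitResponse l s ∂S.memoryMeasure)]
    abel

end TransmissionData

/-- The function `2 - x`, with derivative `-1`. It lifts boundary values at `1`. -/
theorem H1R.exists_fn_one_eq_one : ∃ e : H1R, e.fn 1 = 1 := by
  have hm : MemLp (fun _ : ℝ => (-1 : ℂ)) 2 (volume.restrict (Ioo (1 : ℝ) 2)) := memLp_const _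
  obtain ⟨e, he⟩ := H1R.dx_surjective hm.toLp
  refine ⟨e, ?_⟩
  rw [e.fn_eq_integral (by norm_num), he]
  have h : ∫ t in (1 : ℝ)..2, (hm.toLp : L2 1 2) t = ∫ t in (1 : ℝ)..2, (-1 : ℂ) := by
    refine intervalIntegral.integral_congr_ae ?_
    filter_upwards [ae_mem_Icc_of_ae_restrict hm.coeFn_toLp] with t ht htI
    rw [uIoc_of_le one_le_two] at htI
    exact ht (Ioc_subset_Icc_self htI)
  rw [h]
  norm_num

namespace TransmissionData

variable {S : TransmissionData}

/-! ### The resolvent equation: weak solutions -/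

variable (S) in
/-- The ambient inner product space of the variational problem. -/
abbrev FormSpace : Type := WithLp 2 (S.H1σL × WithLp 2 (S.L2σ × WithLp 2 (L2 1 2 × H1R)))

variable (S) in
/-- The vectors `(u, l u, l y, r y)` with `u(1) = y(1)`. -/
noncomputable def formDomain (l r : ℂ) : Submodule ℂ S.FormSpace :=
  Submodule.map
    ({ toFun := fun w => WithLp.toLp 2 (w.1, WithLp.toLp 2 (l • H1σL.toL2σ w.1,
          WithLp.toLp 2 (l • H1R.toL2 w.2, r • w.2)))
       map_add' := fun w w' => by
        rw [Prod.fst_add, Prod.snd_add, map_add, map_add, smul_add, smul_add, smul_add]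
        rfl
       map_smul' := fun c w => by
        rw [Prod.smul_fst, Prod.smul_snd, map_smul, map_smul, smul_comm l, smul_comm l,
          smul_comm r]
        rfl } : S.H1σL × H1R →ₗ[ℂ] S.FormSpace)
    (LinearMap.ker ((H1σL.trace (S := S)).toLinearMap.comp (LinearMap.fst ℂ S.H1σL H1R) -
      H1R.trace.toLinearMap.comp (LinearMap.snd ℂ S.H1σL H1R)))

theorem mem_formDomain {l r : ℂ} {p : S.FormSpace} : p ∈ S.formDomain l r ↔
    ∃ (u : S.H1σL) (y : H1R), u.fn 1 = y.fn 1 ∧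
      p = WithLp.toLp 2 (u, WithLp.toLp 2 (l • H1σL.toL2σ u,
        WithLp.toLp 2 (l • H1R.toL2 y, r • y))) := by
  constructor
  · rintro ⟨⟨u, y⟩, h, rfl⟩
    exact ⟨u, y, sub_eq_zero.1 h, rfl⟩
  · rintro ⟨u, y, h, rfl⟩
    exact ⟨(u, y), sub_eq_zero.2 h, rfl⟩

/-- The second component forces convergence of `u` in `L²_{1/σ}` besides the energy norm, so
`H1σL.exists_tendsto` applies; the fourth gives convergence of `y`. The traces are continuous and
preserve the constraint. This is what makes the projection available inside a possibly incomplete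
space. -/
theorem completeSpace_formDomain {l r : ℂ} (hl : l ≠ 0) (hr : r ≠ 0) :
    CompleteSpace (S.formDomain l r) := by
  refine Metric.complete_of_cauchySeq_tendsto fun x hx => ?_
  have hx' : CauchySeq fun n => (x n : S.FormSpace) :=
    uniformContinuous_subtype_val.comp_cauchySeq hx
  choose u y huy hxe using fun n => mem_formDomain.1 (x n).2
  simp_rw [hxe] at hx'
  have hu : CauchySeq u :=
    (WithLp.fstL 2 ℂ S.H1σL (WithLp 2 (S.L2σ × WithLp 2
      (L2 1 2 × H1R)))).uniformContinuous.comp_cauchySeq hx'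
  have h1 : CauchySeq fun n => WithLp.toLp 2 (l • H1σL.toL2σ (u n),
        WithLp.toLp 2 (l • H1R.toL2 (y n), r • (y n))) :=
    (WithLp.sndL 2 ℂ S.H1σL (WithLp 2 (S.L2σ × WithLp 2
      (L2 1 2 × H1R)))).uniformContinuous.comp_cauchySeq hx'
  have h2 : CauchySeq fun n => l • H1σL.toL2σ (u n) :=
    (WithLp.fstL 2 ℂ S.L2σ (WithLp 2 (L2 1 2 × H1R))).uniformContinuous.comp_cauchySeq h1
  have h3 : CauchySeq fun n => WithLp.toLp 2 (l • H1R.toL2 (y n), r • (y n)) :=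
    (WithLp.sndL 2 ℂ S.L2σ (WithLp 2 (L2 1 2 × H1R))).uniformContinuous.comp_cauchySeq h1
  have h4 : CauchySeq fun n => r • y n :=
    (WithLp.sndL 2 ℂ (L2 1 2) H1R).uniformContinuous.comp_cauchySeq h3
  obtain ⟨w, hw⟩ := cauchySeq_tendsto_of_complete h2
  obtain ⟨v, hv⟩ := cauchySeq_tendsto_of_complete h4
  have hw' : Tendsto (fun n => H1σL.toL2σ (u n)) atTop (𝓝 (l⁻¹ • w)) := by
    refine (hw.const_smul l⁻¹).congr fun n => ?_
    rw [smul_smul, inv_mul_cancel₀ hl, one_smul]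
  have hy : Tendsto y atTop (𝓝 (r⁻¹ • v)) := by
    refine (hv.const_smul r⁻¹).congr fun n => ?_
    rw [smul_smul, inv_mul_cancel₀ hr, one_smul]
  obtain ⟨a, ha, hae⟩ := H1σL.exists_tendsto hu hw'
  have htr : a.fn 1 = (r⁻¹ • v : H1R).fn 1 := by
    have t1 : Tendsto (fun n => (u n).fn 1) atTop (𝓝 (a.fn 1)) :=
      ((H1σL.trace (S := S)).continuous.tendsto a).comp ha
    have t2 : Tendsto (fun n => (y n).fn 1) atTop (𝓝 ((r⁻¹ • v : H1R).fn 1)) :=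
      (H1R.trace.continuous.tendsto _).comp hy
    simp_rw [huy] at t1
    exact tendsto_nhds_unique t1 t2
  refine ⟨⟨_, mem_formDomain.2 ⟨a, r⁻¹ • v, htr, rfl⟩⟩, ?_⟩
  rw [tendsto_subtype_rng]
  simp_rw [hxe]
  have e1 : Tendsto (fun n => l • H1σL.toL2σ (u n)) atTop (𝓝 (l • H1σL.toL2σ a)) := by
    rw [hae]
    exact hw'.const_smul l
  have e2 : Tendsto (fun n => l • H1R.toL2 (y n)) atTop (𝓝 (l • H1R.toL2 (r⁻¹ • v))) :=
    ((H1R.toL2.continuous.tendsto _).comp hy).const_smul l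
  have e3 : Tendsto (fun n => WithLp.toLp 2 (l • H1R.toL2 (y n), r • y n)) atTop
      (𝓝 (WithLp.toLp 2 (l • H1R.toL2 (r⁻¹ • v), r • (r⁻¹ • v)))) :=
    ((WithLp.prod_continuous_toLp 2 (L2 1 2) H1R).tendsto _).comp
      (e2.prodMk_nhds (hy.const_smul r))
  exact ((WithLp.prod_continuous_toLp 2 S.H1σL _).tendsto _).comp
    (ha.prodMk_nhds (((WithLp.prod_continuous_toLp 2 S.L2σ _).tendsto _).comp
      (e1.prodMk_nhds e3)))

/-- Weak solutions of the resolvent equation with the transmission condition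
`y(1) = l u(1) - t`. -/
theorem exists_weak_solution {l k : ℝ} (hl : 0 < l) (hk : 0 < k) (g : S.L2σ) (f : L2 1 2)
    (φ : H1R) (t : ℂ) :
    ∃ (u : S.H1σL) (y : H1R), (l : ℂ) * u.fn 1 - t = y.fn 1 ∧
      ∀ (w : S.H1σL) (v : H1R), w.fn 1 = v.fn 1 →
        inner ℂ w u + inner ℂ (H1σL.toL2σ w) ((l ^ 2 : ℂ) • H1σL.toL2σ u - g) +
          inner ℂ (H1R.toL2 v) ((l : ℂ) • H1R.toL2 y - f) + inner ℂ v ((k : ℂ) • y + φ) = 0 := by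
  obtain ⟨e, he⟩ := H1R.exists_fn_one_eq_one
  -- The substitution `y = l x + y₀` turns the affine condition `y(1) = l u(1) - t` into `x(1) =
  -- u(1)`, and makes the form Hermitian in `(u, x)`.
  set y₀ : H1R := (-t) • e with hy₀
  have hy₀1 : y₀.fn 1 = -t := by
    rw [hy₀, H1R.fn_smul, Pi.smul_apply, he]; simp
  -- The heat term becomes `k⟨v, l x⟩ = ⟨r v, r x⟩`. The form is then the inner product of the
  -- vectors `(u, l u, l x, r x)`.
  set r : ℝ := √(l * k) with hr
  have hrpos : 0 < r := Real.sqrt_pos.2 (mul_pos hl hk)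
  have hrsq : (r : ℂ) * r = (l : ℂ) * k := by
    rw [← Complex.ofReal_mul, hr, Real.mul_self_sqrt (mul_pos hl hk).le, Complex.ofReal_mul]
  have hlc : (l : ℂ) ≠ 0 := Complex.ofReal_ne_zero.2 hl.ne'
  have hrc : (r : ℂ) ≠ 0 := Complex.ofReal_ne_zero.2 hrpos.ne'
  have := completeSpace_formDomain (S := S) hlc hrc
  -- The data divided by `l` or `r`, so that pairing with `(w, l w, l v, r v)` restores the
  -- right-hand side. Orthogonality of `d` minus its projection is the weak equation.
  let d : S.FormSpace := WithLp.toLp 2 (0, WithLp.toLp 2 ((l : ℂ)⁻¹ • g, WithLp.toLp 2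
    ((l : ℂ)⁻¹ • (f - (l : ℂ) • H1R.toL2 y₀), (r : ℂ)⁻¹ • (-(φ + (k : ℂ) • y₀)))))
  obtain ⟨u, x, hux, hp⟩ := mem_formDomain.1 ((S.formDomain l r).starProjection_apply_mem d)
  refine ⟨u, (l : ℂ) • x + y₀, ?_, fun w v hwv => ?_⟩
  · rw [H1R.fn_add, H1R.fn_smul, Pi.add_apply, Pi.smul_apply, hy₀1, hux, smul_eq_mul]
    ring
  have h := (Submodule.mem_orthogonal _ _).1
    ((S.formDomain l r).sub_starProjection_mem_orthogonal d) _
    (mem_formDomain.2 ⟨w, v, hwv, rfl⟩)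
  rw [hp] at h
  have h2 : inner ℂ w (0 - u) + (inner ℂ ((l : ℂ) • H1σL.toL2σ w)
      ((l : ℂ)⁻¹ • g - (l : ℂ) • H1σL.toL2σ u) + (inner ℂ ((l : ℂ) • H1R.toL2 v)
      ((l : ℂ)⁻¹ • (f - (l : ℂ) • H1R.toL2 y₀) - (l : ℂ) • H1R.toL2 x) +
      inner ℂ ((r : ℂ) • v) ((r : ℂ)⁻¹ • (-(φ + (k : ℂ) • y₀)) - (r : ℂ) • x))) = 0 := h
  simp only [inner_sub_right, inner_smul_left, inner_smul_right, inner_neg_right, inner_add_right,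
    inner_zero_right, Complex.conj_ofReal, map_add, map_smul] at h2 ⊢
  field_simp at h2
  linear_combination -h2 - inner ℂ v x * hrsq

end TransmissionData

/-! ### Regularity of weak solutions -/

/-- Every function in `L²(p, q)` has a primitive in `H¹(p, q)`. -/
theorem H1.exists_deriv_eq {p q : ℝ} (hpq : p ≤ q) (g : L2 p q) (e : ℂ) :
    ∃ z : H1 p q, z.1.2 = g ∧ zeroExt z.1.1 p = e := by
  have hp : p ∈ Icc p q := left_mem_Icc.2 hpq
  have h := isPrimitiveOn_integral (fun x hx y hy => intervalIntegrable_L2 g hx hy) hp e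
  let w : C(Icc p q, ℂ) := ⟨fun x => e + ∫ t in p..x, g t, h.continuousOn_Icc.domRestrict⟩
  have hw : ∀ x ∈ Icc p q, zeroExt w x = e + ∫ t in p..x, g t := fun x hx => zeroExt_apply w hx
  refine ⟨⟨(w, g), ?_⟩, rfl, ?_⟩
  · exact h.congr (fun x hx => (hw x hx).symm) (Eventually.of_forall fun _ _ => rfl)
  · simp [hw p hp]

namespace TransmissionData

variable {S : TransmissionData}

theorem continuousOn_inv_σ {ε : ℝ} (hε : 0 < ε) :
    ContinuousOn (fun x => (S.σ x)⁻¹) (Icc ε 1) :=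
  (S.σ_cont.mono (Icc_subset_Icc_left hε.le)).inv₀
    fun _ hx => (S.σ_pos ⟨hε.trans_le hx.1, hx.2⟩).ne'

/-- Away from `0` the density `1/σ` is continuous, so functions vanishing near `0` are admissible
whatever the strength of the degeneracy. -/
theorem memLp_invσ_of_eq_zero {f : ℝ → ℂ} {ε : ℝ} (hε : 0 < ε) (hf : ContinuousOn f (Icc 0 1))
    (h0 : ∀ x ∈ Ioo (0 : ℝ) 1, x ≤ ε → f x = 0) : MemLp f 2 S.invσMeasure := by
  have hm : AEStronglyMeasurable f S.invσMeasure :=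
    ((hf.mono Ioo_subset_Icc_self).aestronglyMeasurable measurableSet_Ioo).mono_ac
      (withDensity_absolutelyContinuous _ _)
  rw [memLp_two_iff_integrable_sq_norm hm, integrable_invσ_iff]
  have h1 : IntegrableOn (fun x => (S.σ x)⁻¹ • ‖f x‖ ^ 2) (Icc ε 1) :=
    ((continuousOn_inv_σ hε).smul
      ((hf.mono (Icc_subset_Icc_left hε.le)).norm.pow 2)).integrableOn_Icc
  have h2 : IntegrableOn (fun x => (S.σ x)⁻¹ • ‖f x‖ ^ 2) (Ioo 0 1 ∩ Iic ε) := by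
    refine integrableOn_zero.congr_fun (fun x hx => ?_) (measurableSet_Ioo.inter measurableSet_Iic)
    simp [h0 x hx.1 hx.2]
  refine (h2.union h1).mono_set fun x hx => ?_
  rcases le_total x ε with h | h
  · exact Or.inl ⟨hx, h⟩
  · exact Or.inr ⟨h, hx.2.le⟩

namespace H1σL

theorem exists_dx_eq_of_ae_eq_zero {ε : ℝ} (hε : 0 < ε) (g : L2 0 1)
    (hg : ∀ᵐ x ∂(volume.restrict (Ioo (0 : ℝ) 1)), x ≤ ε → g x = 0) :
    ∃ u : S.H1σL, u.dx = g ∧ ∀ x ∈ Icc (0 : ℝ) 1, x ≤ ε → u.fn x = 0 := by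
  have h0 : ∀ x ∈ Icc (0 : ℝ) 1, x ≤ ε → ∫ t in (0 : ℝ)..x, g t = 0 := by
    intro x hx hxε
    refine (intervalIntegral.integral_congr_ae (g := fun _ => 0) ?_).trans (by simp)
    filter_upwards [ae_mem_Icc_of_ae_restrict hg] with t ht htI
    rw [uIoc_of_le hx.1] at htI
    exact ht ⟨htI.1.le, htI.2.trans hx.2⟩ (htI.2.trans hxε)
  have hc : ContinuousOn (fun x => ∫ t in (0 : ℝ)..x, g t) (Icc 0 1) := by
    have := isPrimitiveOn_integral (fun x hx y hy => intervalIntegrable_L2 g hx hy)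
      (left_mem_Icc.2 (zero_le_one (α := ℝ))) 0
    simpa using this.continuousOn_Icc
  obtain ⟨u, hu, hux⟩ := exists_dx_eq (S := S) g
    (memLp_invσ_of_eq_zero hε hc fun x hx => h0 x (Ioo_subset_Icc_self hx))
  exact ⟨u, hu, fun x hx hxε => (hux x hx).trans (h0 x hx hxε)⟩

variable (S) in
theorem exists_fn_one_eq_one : ∃ u : S.H1σL, u.fn 1 = 1 := by
  have hμ : (volume.restrict (Ioo (0 : ℝ) 1)) (Ioo (1 / 2) 1) ≠ ∞ :=
    ((Measure.restrict_apply_le _ _).trans_lt measure_Ioo_lt_top).ne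
  -- The height `2` compensates the length `1/2`, so the primitive equals `1` at `1` and vanishes on
  -- `[0, 1/2]`.
  set g : L2 0 1 := indicatorConstLp 2 (measurableSet_Ioo (a := (1 / 2 : ℝ)) (b := 1)) hμ (2 : ℂ)
  have hg : g =ᵐ[volume.restrict (Ioo (0 : ℝ) 1)] (Ioo (1 / 2 : ℝ) 1).indicator fun _ => 2 :=
    indicatorConstLp_coeFn
  obtain ⟨u, hu, -⟩ := exists_dx_eq_of_ae_eq_zero (S := S) (ε := 1 / 2) (by norm_num) g (by
    filter_upwards [hg] with x hx hxε
    rw [hx, indicator_of_notMem]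
    exact fun h => (h.1.trans_le hxε).false)
  refine ⟨u, ?_⟩
  rw [fn_eq_integral u (by norm_num), hu, intervalIntegral.integral_of_le zero_le_one,
    integral_Ioc_eq_integral_Ioo, integral_congr_ae hg, integral_indicator measurableSet_Ioo,
    Measure.restrict_restrict measurableSet_Ioo,
    inter_eq_self_of_subset_left (Ioo_subset_Ioo_left (by norm_num))]
  simp
  norm_num

end H1σL

/-- On `(ε, 1)`, `|g|/σ ≤ 1/σ + |g|²/σ`, and both terms are integrable. Integrability need not reach
`0`, which is why the flux is a primitive on `(0, 1]` only. -/
theorem intervalIntegrable_div_σ (g : S.L2σ) {x y : ℝ} (hx : x ∈ Ioc (0 : ℝ) 1)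
    (hy : y ∈ Ioc (0 : ℝ) 1) : IntervalIntegrable (fun t => g t / (S.σ t : ℂ)) volume x y := by
  have key : ∀ ε ∈ Ioc (0 : ℝ) 1,
      IntervalIntegrable (fun t => g t / (S.σ t : ℂ)) volume ε 1 := by
    intro ε hε
    rw [intervalIntegrable_iff_integrableOn_Ioo_of_le hε.2]
    have hsub : Ioo ε 1 ⊆ Ioo 0 1 := Ioo_subset_Ioo_left hε.1.le
    have h1 : IntegrableOn (fun t => (S.σ t)⁻¹) (Ioo ε 1) :=
      (continuousOn_inv_σ hε.1).integrableOn_Icc.mono_set Ioo_subset_Icc_self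
    have h2 : IntegrableOn (fun t => (S.σ t)⁻¹ • ‖g t‖ ^ 2) (Ioo ε 1) :=
      (integrable_invσ_iff.1 ((memLp_two_iff_integrable_sq_norm
        (Lp.aestronglyMeasurable g)).1 (Lp.memLp g))).mono_set hsub
    have hgm : AEStronglyMeasurable g (volume.restrict (Ioo 0 1)) := by
      refine (Lp.aestronglyMeasurable g).mono_ac ?_
      intro s hs
      have h3 := ae_invσ (S := S) (P := fun x => x ∉ s)
      rw [ae_iff, ae_iff] at h3
      simpa using h3.1 (by simpa using hs)
    have hm : AEStronglyMeasurable (fun t => g t / (S.σ t : ℂ)) (volume.restrict (Ioo ε 1)) := by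
      simp_rw [div_eq_mul_inv, ← Complex.ofReal_inv]
      refine (hgm.mono_measure (Measure.restrict_mono hsub le_rfl)).mul ?_
      exact Complex.continuous_ofReal.comp_aestronglyMeasurable h1.aestronglyMeasurable
    refine Integrable.mono' (h1.add h2) hm ?_
    refine (ae_restrict_iff' measurableSet_Ioo).2 (Eventually.of_forall fun t ht => ?_)
    have hσ := S.σ_pos (Ioo_subset_Ioc_self (hsub ht))
    rw [norm_div, Complex.norm_real, Real.norm_of_nonneg hσ.le, div_eq_inv_mul, Pi.add_apply,
      smul_eq_mul]
    have h3 : ‖g t‖ ≤ 1 + ‖g t‖ ^ 2 := by nlinarith [sq_nonneg (‖g t‖ - 1)]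
    calc (S.σ t)⁻¹ * ‖g t‖ ≤ (S.σ t)⁻¹ * (1 + ‖g t‖ ^ 2) := by gcongr
      _ = _ := by ring
  exact (key x hx).trans (key y hy).symm

theorem memLp_η_mul (f : L2 0 1) :
    MemLp (fun x => (S.η x : ℂ) * f x) 2 (volume.restrict (Ioo 0 1)) := by
  obtain ⟨C, hC⟩ := isCompact_Icc.exists_bound_of_continuousOn S.η_cont
  refine (Lp.memLp f).of_le_mul (c := C) ?_ ?_
  · refine AEStronglyMeasurable.mul ?_ (Lp.aestronglyMeasurable f)
    exact (Complex.continuous_ofReal.comp_continuousOn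
      (S.η_cont.mono Ioo_subset_Icc_self)).aestronglyMeasurable measurableSet_Ioo
  · refine (ae_restrict_iff' measurableSet_Ioo).2 (Eventually.of_forall fun x hx => ?_)
    rw [norm_mul, Complex.norm_real]
    exact mul_le_mul_of_nonneg_right (hC x (Ioo_subset_Icc_self hx)) (norm_nonneg _)

/-- A weak solution on `(0, 1)` has the expected flux on every `(ε, 1)`. -/
theorem ae_flux_eq_of_weak {u : S.H1σL} {g : S.L2σ} {e : ℂ}
    (h : ∀ w : S.H1σL, inner ℂ w u + inner ℂ (H1σL.toL2σ w) g = inner ℂ (w.fn 1) e)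
    {q : ℝ → ℂ} (hq : IsPrimitiveOn (Ioc 0 1) q fun x => g x / (S.σ x : ℂ)) (hq1 : q 1 = e)
    {ε : ℝ} (hε : ε ∈ Ioc (0 : ℝ) 1) :
    ∀ᵐ x ∂(volume.restrict (Ioo (0 : ℝ) 1)), ε < x → q x = (S.η x : ℂ) * u.dx x := by
  have hsub : Ioo ε 1 ⊆ Ioo 0 1 := Ioo_subset_Ioo_left hε.1.le
  have hIcc : Icc ε 1 ⊆ Ioc 0 1 := fun x hx => ⟨hε.1.trans_le hx.1, hx.2⟩
  have hqc : ContinuousOn q (Icc ε 1) := (hq.mono hIcc).continuousOn_Icc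
  -- The test function is the primitive of this residual cut off to `(ε, 1)`. It vanishes on `[0,
  -- ε]`, so no boundary term appears at the left end, and the weak equation makes the cut-off
  -- residual orthogonal to itself.
  set r : ℝ → ℂ := fun x => (S.η x : ℂ) * u.dx x - q x with hr
  have hψ : MemLp ((Ioo ε 1).indicator r) 2 (volume.restrict (Ioo (0 : ℝ) 1)) := by
    rw [memLp_indicator_iff_restrict measurableSet_Ioo,
      Measure.restrict_restrict measurableSet_Ioo, inter_eq_self_of_subset_left hsub]
    refine ((memLp_η_mul u.dx).mono_measure (Measure.restrict_mono hsub le_rfl)).sub ?_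
    obtain ⟨C, hC⟩ := isCompact_Icc.exists_bound_of_continuousOn hqc
    refine MemLp.of_bound
      ((hqc.mono Ioo_subset_Icc_self).aestronglyMeasurable measurableSet_Ioo) C ?_
    exact (ae_restrict_iff' measurableSet_Ioo).2
      (Eventually.of_forall fun x hx => hC x (Ioo_subset_Icc_self hx))
  set ψ : L2 0 1 := hψ.toLp with hψdef
  have hψe : ψ =ᵐ[volume.restrict (Ioo (0 : ℝ) 1)] (Ioo ε 1).indicator r := hψ.coeFn_toLp
  have hψ0 : ∀ᵐ x ∂(volume.restrict (Ioo (0 : ℝ) 1)), x ≤ ε → ψ x = 0 := by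
    filter_upwards [hψe] with x hx hxε
    rw [hx, indicator_of_notMem]
    exact fun h => (h.1.trans_le hxε).false
  obtain ⟨w, hw, hw0⟩ := H1σL.exists_dx_eq_of_ae_eq_zero (S := S) hε.1 ψ hψ0
  have cut : ∀ f : ℝ → ℂ, (∀ᵐ x ∂(volume.restrict (Ioo (0 : ℝ) 1)), x ≤ ε → f x = 0) →
      ∫ x in Ioo (0 : ℝ) 1, f x = ∫ x in Ioo ε 1, f x := by
    intro f hf
    refine (setIntegral_eq_of_subset_of_ae_sdiff_eq_zero
      measurableSet_Ioo.nullMeasurableSet hsub ?_)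
    filter_upwards [(ae_restrict_iff' measurableSet_Ioo).1 hf] with x hx hxd
    exact hx hxd.1 (not_lt.1 fun h => hxd.2 ⟨h, hxd.1.2⟩)
  have e1 : inner ℂ w u = ∫ x in Ioo ε 1, inner ℂ (ψ x) ((S.η x : ℂ) * u.dx x) := by
    rw [H1σL.inner_eq, hw, ← cut]
    · refine integral_congr_ae (Eventually.of_forall fun x => ?_)
      simp only [RCLike.inner_apply]
      ring
    · filter_upwards [hψ0] with x hx hxε
      rw [hx hxε, inner_zero_left]
  have e2 : inner ℂ (H1σL.toL2σ w) g = ∫ x in Ioo ε 1, inner ℂ (w.fn x) (g x / (S.σ x : ℂ)) := by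
    rw [L2.inner_def, integral_invσ, ← cut]
    · refine integral_congr_ae ?_
      filter_upwards [ae_invσ.1 (H1σL.coeFn_toL2σ w)] with x hx
      rw [hx, RCLike.inner_apply, RCLike.inner_apply, Complex.real_smul, Complex.ofReal_inv]
      ring
    · filter_upwards [ae_restrict_mem measurableSet_Ioo] with x hx hxε
      rw [hw0 x (Ioo_subset_Icc_self hx) hxε, inner_zero_left]
  have hb : IsBoundedBilinearMap ℝ (fun p : ℂ × ℂ => inner ℂ p.1 p.2) :=
    isBoundedBilinearMap_inner
  have h1I : (1 : ℝ) ∈ Ioc (0 : ℝ) 1 := by norm_num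
  have hwp : IsPrimitiveOn (Ioc 0 1) w.fn ψ := by
    rw [← hw]
    exact w.isPrimitiveOn.mono Ioc_subset_Icc_self
  have hi1 := intervalIntegrable_bilin hb hε.2 (hwp ε hε 1 h1I).1 hqc
  have hi2 := intervalIntegrable_bilin (IsBoundedBilinearMap.swap hb) hε.2 (hq ε hε 1 h1I).1
    (hwp.mono hIcc).continuousOn_Icc
  have e3 := (hwp.bilin hb hq ε hε 1 h1I).2
  simp only at e3 hi1 hi2
  rw [intervalIntegral.integral_add hi1 hi2, hw0 ε (Ioc_subset_Icc_self hε) le_rfl,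
    inner_zero_left, sub_zero, intervalIntegral.integral_of_le hε.2,
    intervalIntegral.integral_of_le hε.2, integral_Ioc_eq_integral_Ioo,
    integral_Ioc_eq_integral_Ioo, hq1, ← h w, e1, e2] at e3
  have e4 := add_right_cancel e3
  have e5 : inner ℂ ψ ψ = 0 := by
    have hi3 : IntegrableOn (fun x => inner ℂ (ψ x) ((S.η x : ℂ) * u.dx x)) (Ioo ε 1) := by
      refine ((integrable_η_mul (S := S) ψ u.dx).mono_measure
        (Measure.restrict_mono hsub le_rfl)).congr (Eventually.of_forall fun x => ?_)
      simp only [RCLike.inner_apply]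
      ring
    have hi1' : IntegrableOn (fun x => inner ℂ (ψ x) (q x)) (Ioo ε 1) := by
      rwa [intervalIntegrable_iff_integrableOn_Ioo_of_le hε.2] at hi1
    rw [L2.inner_def, cut, ← sub_eq_zero.2 e4, ← integral_sub hi3 hi1']
    · refine integral_congr_ae ?_
      filter_upwards [ae_restrict_of_ae_restrict_of_subset hsub hψe,
        ae_restrict_mem measurableSet_Ioo] with x hx hxI
      rw [← inner_sub_right]
      congr 1
      rw [hx, indicator_of_mem hxI]
    · filter_upwards [hψ0] with x hx hxε
      rw [hx hxε, inner_zero_left]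
  have e6 : ψ = 0 := inner_self_eq_zero.1 e5
  filter_upwards [hψe, (Lp.eq_zero_iff_ae_eq_zero).1 e6, ae_restrict_mem measurableSet_Ioo]
    with x h1 h2 h3 h4
  rw [h2, indicator_of_mem (show x ∈ Ioo ε 1 from ⟨h4, h3.2⟩)] at h1
  exact (sub_eq_zero.1 h1.symm).symm

/-- A weak solution of the transmission problem is a strong one. -/
theorem exists_strong_of_weak {u : S.H1σL} {g : S.L2σ} {f : L2 1 2} {ζ : H1R}
    (h : ∀ (w : S.H1σL) (v : H1R), w.fn 1 = v.fn 1 →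
      inner ℂ w u + inner ℂ (H1σL.toL2σ w) g + inner ℂ (H1R.toL2 v) f + inner ℂ v ζ = 0) :
    ∃ (z : H1 1 2) (q : ℝ → ℂ), f = z.1.2 ∧
      ζ.dx =ᵐ[volume.restrict (Ioo 1 2)] zeroExt z.1.1 ∧
      q =ᵐ[volume.restrict (Ioo 0 1)] (fun x => (S.η x : ℂ) * u.dx x) ∧
      IsPrimitiveOn (Ioc 0 1) q (fun x => g x / (S.σ x : ℂ)) ∧ q 1 = zeroExt z.1.1 1 := by
  obtain ⟨χ, hχ⟩ := H1σL.exists_fn_one_eq_one S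
  -- The common flux at `1`, read off by testing the wave part with a function of trace `1`.
  set d : ℂ := inner ℂ χ u + inner ℂ (H1σL.toL2σ χ) g with hd
  obtain ⟨z, hz, hz1⟩ := H1.exists_deriv_eq one_le_two f d
  have hzp : IsPrimitiveOn (Icc 1 2) (zeroExt z.1.1) z.1.2 := z.2
  have hzL : MemLp (zeroExt z.1.1) 2 (volume.restrict (Ioo (1 : ℝ) 2)) := by
    obtain ⟨C, hC⟩ := isCompact_Icc.exists_bound_of_continuousOn hzp.continuousOn_Icc
    refine MemLp.of_bound ((hzp.continuousOn_Icc.mono Ioo_subset_Icc_self).aestronglyMeasurable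
      measurableSet_Ioo) C ?_
    exact (ae_restrict_iff' measurableSet_Ioo).2
      (Eventually.of_forall fun x hx => hC x (Ioo_subset_Icc_self hx))
  have hparts : ∀ v : H1R,
      inner ℂ (H1R.toL2 v) f = - inner ℂ (v.fn 1) d - inner ℂ v.dx hzL.toLp := by
    intro v
    have h1 := v.integral_inner_eq z
    rw [hz, hz1] at h1
    rw [L2.inner_def, L2.inner_def]
    refine Eq.trans ?_ (h1.trans ?_)
    · refine integral_congr_ae ?_
      filter_upwards [H1R.coeFn_toL2 v] with x hx
      rw [hx]
    · congr 1
      refine integral_congr_ae ?_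
      filter_upwards [hzL.coeFn_toLp] with x hx
      rw [hx]
  -- The pair `(v(1) χ, v)` is admissible for every `v`. After integration by parts the boundary
  -- terms `v(1), d` cancel, leaving `⟨v_x, ζ_x - z⟩ = 0`, and the derivatives `v_x` fill all of
  -- `L²(1, 2)`.
  have hζ : ζ.dx = hzL.toLp := by
    refine ext_inner_left ℂ fun p => ?_
    obtain ⟨v, rfl⟩ := H1R.dx_surjective p
    have h1 := h (v.fn 1 • χ) v (by rw [H1σL.fn_smul, Pi.smul_apply, hχ]; simp)
    rw [inner_smul_left, map_smul, inner_smul_left, ← mul_add, ← hd, hparts, RCLike.inner_apply,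
      H1R.inner_eq] at h1
    linear_combination h1
  obtain ⟨e, he⟩ := H1R.exists_fn_one_eq_one
  -- Conversely, `w` is completed by `w(1) e`; with `ζ_x = z` known, only the boundary term `d`
  -- survives from the heat side.
  have hwave : ∀ w : S.H1σL,
      inner ℂ w u + inner ℂ (H1σL.toL2σ w) g = inner ℂ (w.fn 1) d := by
    intro w
    have hv1 : (w.fn 1 • e).fn 1 = w.fn 1 := by rw [H1R.fn_smul, Pi.smul_apply, he]; simp
    have h1 := h w (w.fn 1 • e) hv1.symm
    rw [hparts, hv1, H1R.inner_eq, hζ] at h1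
    linear_combination h1
  have h1I : (1 : ℝ) ∈ Ioc (0 : ℝ) 1 := by norm_num
  have hq := isPrimitiveOn_integral (fun x hx y hy => intervalIntegrable_div_σ g hx hy) h1I d
  refine ⟨z, _, hz.symm, ?_, ?_, hq, by simp [hz1]⟩
  · rw [hζ]
    exact hzL.coeFn_toLp
  · have h2 : ∀ n : ℕ, ∀ᵐ x ∂(volume.restrict (Ioo (0 : ℝ) 1)), 1 / ((n : ℝ) + 1) < x →
        (d + ∫ t in (1 : ℝ)..x, g t / (S.σ t : ℂ)) = (S.η x : ℂ) * u.dx x := fun n =>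
      ae_flux_eq_of_weak hwave hq (by simp)
        ⟨Nat.one_div_pos_of_nat, by
          rw [div_le_one (by positivity)]
          linarith [n.cast_nonneg (α := ℝ)]⟩
    filter_upwards [ae_all_iff.2 h2, ae_restrict_mem measurableSet_Ioo] with x hx hxI
    obtain ⟨n, hn⟩ := exists_nat_one_div_lt hxI.1
    exact hx n hn

/-! ### The operator is m-dissipative -/

/-- Substituting `v = l u - F.u` leaves `l² u - σ (η u_x)_x = F.v + l F.u` on the wave side, and
turns `v(1) = y(1)` into `y(1) = l u(1) - F.u(1)`. The memory is eliminated through `ζ = k y + φ`.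
-/
theorem exists_mem_graph {l : ℝ} (hl : 0 < l) (F : S.Energy) :
    ∃ U : S.Energy, (U, (l : ℂ) • U - F) ∈ S.graph := by
  obtain ⟨φ, hφ⟩ := exists_memory_solution hl F.γ
  obtain ⟨u, y, huy, hweak⟩ := exists_weak_solution hl (conductivity_pos hl)
    (F.v + (l : ℂ) • H1σL.toL2σ F.u) F.y φ (F.u.fn 1)
  obtain ⟨γ, γs, Γ, hγ, hΓ0, hΓ, hγs, hζ⟩ := hφ y
  obtain ⟨z, q, hz, hζz, hq, hqp, hq1⟩ := exists_strong_of_weak hweak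
  refine ⟨WithLp.toLp 2 (u, WithLp.toLp 2 (H1σL.toL2σ ((l : ℂ) • u - F.u),
    WithLp.toLp 2 (H1R.toL2 y, γ))), q, y, z, Γ, γs, ?_⟩
  refine
    { v_eq := H1σL.coeFn_toL2σ ((l : ℂ) • u - F.u)
      flux_eq := hq
      flux_deriv := ?_
      y_eq := H1R.coeFn_toL2 y
      zeta_eq := ?_
      zeta_deriv := hz
      γ_eq := hγ
      γ_zero := hΓ0
      γ_deriv := hΓ
      γ_value := hγs
      flux_one := hq1
      v_one := ?_ }
  · have h1 : (l : ℂ) • H1σL.toL2σ ((l : ℂ) • u - F.u) - F.v =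
        (l ^ 2 : ℂ) • H1σL.toL2σ u - (F.v + (l : ℂ) • H1σL.toL2σ F.u) := by
      rw [map_sub, map_smul, smul_sub, smul_smul, sq]
      abel
    change IsPrimitiveOn (Ioc 0 1) q fun x =>
      ((l : ℂ) • H1σL.toL2σ ((l : ℂ) • u - F.u) - F.v : S.L2σ) x / (S.σ x : ℂ)
    rw [h1]
    exact hqp
  · change (zeta y γ).dx =ᵐ[_] _
    rw [hζ]
    exact hζz
  · change ((l : ℂ) • u - F.u).fn 1 = y.fn 1
    rw [sub_eq_add_neg, ← neg_one_smul ℂ F.u, H1σL.fn_add, H1σL.fn_smul, H1σL.fn_smul, ← huy]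
    simp [sub_eq_add_neg]

theorem isMDissipative_operator (S : TransmissionData) : IsMDissipative S.operator := by
  refine ⟨fun U => ?_, fun l hl F => ?_⟩
  · have h := S.operator.mem_graph U
    rw [operator_graph] at h
    obtain ⟨q, y, z, Γ, γs, h⟩ := h
    exact h.dissipative
  · obtain ⟨U, hU⟩ := exists_mem_graph hl F
    rw [← operator_graph, LinearPMap.mem_graph_iff] at hU
    obtain ⟨V, hV, hAV⟩ := hU
    refine ⟨V, ?_⟩
    dsimp only at hV hAV
    rw [hAV, hV, sub_sub_cancel]

end TransmissionData

end DegenerateWaveHeat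

theorem proposition2p1 (S : DegenerateWaveHeat.TransmissionData) :
    DegenerateWaveHeat.IsMDissipative S.operator ∧
      Dense (S.operator.domain : Set S.Energy) ∧
      ∃ T : ℝ → S.Energy →L[ℂ] S.Energy,
        DegenerateWaveHeat.IsContractionSemigroup T ∧
        DegenerateWaveHeat.IsGenerator S.operator T ∧
        ∀ U₀ ∈ S.operator.domain,
          DegenerateWaveHeat.IsClassicalSolution S.operator U₀ (fun t => T t U₀) ∧
          ∀ U : ℝ → S.Energy, DegenerateWaveHeat.IsClassicalSolution S.operator U₀ U →
            Set.EqOn U (fun t => T t U₀) (Set.Ici 0) := by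
  have hA := S.isMDissipative_operator
  obtain ⟨hdense, T, hT, hAT⟩ := DegenerateWaveHeat.TransmissionData.generation_of_isMDissipative hA
  exact ⟨hA, hdense, T, hT, hAT, fun U₀ hU₀ => hAT.isClassicalSolution hA hT hU₀⟩
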